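/- \textbf{Setting.} Consider $n\ge 2$ nodes, $K$ classes and times $t=1,\dots,T$. At time $t$ every node belongs to one class; $\Theta_t\in\{0,1\}^{n\times K}$ is the membership matrix, $B_t$ is a symmetric $K\times K$ matrix of probabilities, and $P_t=\Theta_tB_t\Theta_t^{\top}$. One observes symmetric matrices $A_t$ whose entries $A_t(i,j)$, $i<j$, $1\le t\le T$, are independent Bernoulli variables with means $P_t(i,j)$; the diagonal is filled with a fixed constant, $A_t(i,i)=d$ (for example $d=10$). Let $n_{\max}$ be the largest class size over all classes and times, and let $\|\cdot\|$ be the spectral norm, $[x]$ the integer part of $x$. \textbf{Assumptions.} Let $\tau,c_0,\beta,L>0$, $C_\alpha,C_\lambda\ge1$, $W_{\max}$ be given, and let $l$ be the largest integer strictly smaller than $\beta$. Let $\alpha_n>0$ satisfy $\alpha_n\ge C_\alpha^{-1}c_0\log n/n$ and $C_\alpha^{-1}\alpha_n\le\max_{k,k'}|B_t(k,k')|\le C_\alpha\alpha_n$ for all $t$, and put $H_t=\alpha_n^{-1}B_t$. Assume: (A1) for $k\le k'$, $H_t(k,k')=f(t/T;k,k')$ where $f(\cdot;k,k')$ is $l$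 times differentiable on $[0,1]$ and $|f^{(l)}(x)-f^{(l)}(x')|\le L|x-x'|^{\beta-l}$; (A2) at most $s$ nodes change class between consecutive times; (A3) all eigenvalues of all $H_t$ lie in $[C_\lambda^{-1},C_\lambda]$; (A4) with $F_{r,1}=\{-r,\dots,r\}$, $F_{r,2}=\{0,\dots,r\}$, $F_{r,3}=\{-r,\dots,0\}$, the kernels $W^{(j)}_{r,l}$ satisfy $|W^{(j)}_{r,l}|\le W_{\max}$ on $F_{r,j}$ and $|F_{r,j}|^{-1}\sum_{i\in F_{r,j}}i^kW^{(j)}_{r,l}(i)=\mathbf 1(k=0)$ for $k=0,\dots,l$. \textbf{Estimator.} For $0\le r\le T/2$ put $\hat P_{t,r}=|F_{r,j}|^{-1}\sum_{i\in F_{r,j}}W^{(j)}_{r,l}(i)A_{t+i}$, with $j=1$ if $r<t\le T-r$, $j=2$ if $t\le r$, $j=3$ if $t>T-r$; let $P_{t,r}$ be the same expression with $P_{t+i}$ in place of $A_{t+i}$, let $\Delta_t(r)=\|\hat P_{t,r}-P_t\|$, and let $\Delta^{\circ}_t(r)$ be the spectral norm of $\hat P_{t,r}-P_t$ with its diagonal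 replaced by zeros. Let $$\delta_1=\sqrt{n\alpha_n},\qquad \delta_2=\Big(\frac{\alpha_n^{\beta+1}n^{\beta+1}}{T^\beta}\Big)^{\frac1{2\beta+1}}+(\alpha_n^3\,n\,n_{\max}\,s)^{1/4}.$$ \textbf{Claim.} There are constants $C_T,C_s>0$, depending only on $\tau,c_0,W_{\max},\beta,L,C_\alpha,C_\lambda$, such that for all $C_0>0$ and all $d$ there is $C_\Delta>0$, depending only on these parameters, $C_0$ and $d$, such that the following holds in every model as above and at every time $t$. Put $$r^*=\min\Big(\Big[C_T\big((n\alpha_n)^{-1}T^{2\beta}\big)^{1/(2\beta+1)}\Big],\ \Big[C_s\sqrt{(\alpha_n n_{\max}s)^{-1}n}\Big]\Big),$$ where the second term is $+\infty$ if $s=0$. Then $r^*\le T/2$, and $r^*$ is optimal up to a constant for the bias--variance bound $$U(r)=\frac{L}{l!}W_{\max}\alpha_n n\Big(\frac rT\Big)^{\beta}+2\sqrt2\,W_{\max}C_\lambda\alpha_n\sqrt{n_{\max}rs}+C_0\sqrt{\frac{n\alpha_n}{r\vee1}},$$ that is, $U(r^*)\le C_\Delta U(r)$ for all integers $0\le r\le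 T/2$. Moreover, both for $r=r^*$ and for any minimizer $r$ of $\|P_{t,r}-P_t\|+C_0\sqrt{n\alpha_n/(r\vee1)}$ over the integers $0\le r\le T/2$, with probability at least $1-4n^{-\tau}$, $$\Delta^{\circ}_t(r)\le C_\Delta\min(\delta_1,\delta_2)\qquad\text{and}\qquad \Delta_t(r)\le C_\Delta\min\big(\delta_1,\max(\delta_2,1)\big).$$ In particular $\Delta_t(r)\le C_\Delta\min(\delta_1,\delta_2)$ whenever $\delta_2\ge1$. -/

import Mathlib

open MeasureTheory ProbabilityTheory
open scoped BigOperators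

noncomputable section

/-- Spectral norm of a real square matrix: the operator norm on Euclidean space. -/
def specNorm {n : ℕ} (M : Matrix (Fin n) (Fin n) ℝ) : ℝ :=
  ‖Matrix.toEuclideanCLM (n := Fin n) (𝕜 := ℝ) M‖

/-- The matrix with its diagonal replaced by zeros. -/
def offDiagPart {n : ℕ} (M : Matrix (Fin n) (Fin n) ℝ) : Matrix (Fin n) (Fin n) ℝ :=
  M - Matrix.diagonal M.diag

/-- Largest absolute value of an entry. -/
def maxAbsEntry {K : ℕ} (M : Matrix (Fin K) (Fin K) ℝ) : ℝ :=
  ⨆ p : Fin K × Fin K, |M p.1 p.2|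

/-- The largest integer strictly smaller than `β` (for `0 < β`). -/
def holderOrder (β : ℝ) : ℕ := ⌈β⌉₊ - 1

/-- The Hölder class `Σ(β, L)` on `[0,1]`: `f` has `l` derivatives on `[0,1]` (one-sided at the
endpoints) and the `l`-th one is Hölder of exponent `β - l` with constant `L`, where `l` is the
largest integer strictly smaller than `β`.  The Hölder condition makes the `l`-th derivative
continuous, so that being `l` times differentiable is the same as being `l` times continuously
differentiable. -/
def HolderClass (β L : ℝ) (f : ℝ → ℝ) : Prop :=
  ContDiffOn ℝ (holderOrder β : ℕ) f (Set.Icc 0 1) ∧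
  ∀ x ∈ Set.Icc (0 : ℝ) 1, ∀ y ∈ Set.Icc (0 : ℝ) 1,
    |iteratedDerivWithin (holderOrder β) f (Set.Icc 0 1) x
      - iteratedDerivWithin (holderOrder β) f (Set.Icc 0 1) y|
      ≤ L * |x - y| ^ (β - (holderOrder β : ℝ))

/-- A dynamic stochastic block model with `n` nodes, `K` classes and time points `1, …, T`.
`label t i` is the class of node `i` at time `t`, `conn t` the connectivity matrix at time `t`
and `adj t` the observed adjacency matrix, whose diagonal is filled with the constant `d`.
Only the times `1 ≤ t ≤ T` matter. -/
structure DSBM {Ω : Type*} [MeasurableSpace Ω] (μ : Measure Ω) (n K T : ℕ) (d : ℝ) where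
  label : ℤ → Fin n → Fin K
  conn : ℤ → Matrix (Fin K) (Fin K) ℝ
  adj : ℤ → Ω → Matrix (Fin n) (Fin n) ℝ
  conn_symm : ∀ t : ℤ, 1 ≤ t → t ≤ T → (conn t).IsSymm
  conn_mem : ∀ t : ℤ, 1 ≤ t → t ≤ T → ∀ k k', conn t k k' ∈ Set.Icc (0 : ℝ) 1
  adj_measurable : ∀ t : ℤ, 1 ≤ t → t ≤ T → ∀ i j, Measurable fun ω => adj t ω i j
  adj_symm : ∀ t : ℤ, 1 ≤ t → t ≤ T → ∀ ω, (adj t ω).IsSymm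
  adj_diag : ∀ t : ℤ, 1 ≤ t → t ≤ T → ∀ ω i, adj t ω i i = d
  adj_zero_or_one : ∀ t : ℤ, 1 ≤ t → t ≤ T → ∀ ω i j, i < j → adj t ω i j = 0 ∨ adj t ω i j = 1
  adj_prob : ∀ t : ℤ, 1 ≤ t → t ≤ T → ∀ i j, i < j →
    μ.real {ω | adj t ω i j = 1} = conn t (label t i) (label t j)
  adj_indep : iIndepFun
    (fun (p : {p : ℤ × Fin n × Fin n // (1 ≤ p.1 ∧ p.1 ≤ T) ∧ p.2.1 < p.2.2}) ω =>
      adj p.1.1 ω p.1.2.1 p.1.2.2) μ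

/-- The window `F_{r,j}`: two-sided (`j = 0`), right (`j = 1`), left (`j = 2`). -/
def window (r : ℕ) (j : Fin 3) : Finset ℤ :=
  ![Finset.Icc (-(r : ℤ)) r, Finset.Icc 0 (r : ℤ), Finset.Icc (-(r : ℤ)) 0] j

/-- The set `D_{r,j}` of times at which the window `F_{r,j}` is used. -/
def windowDomain (T r : ℕ) (j : Fin 3) : Finset ℤ :=
  ![Finset.Icc (1 + (r : ℤ)) (T - r), Finset.Icc 1 (r : ℤ), Finset.Icc (T - r + 1 : ℤ) T] j

/-- Discrete kernels of order `l` bounded by `Wmax`; `W r j i` is the value at `i` of the kernel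
for the window `F_{r,j}`. -/
def IsDiscreteKernel (l : ℕ) (Wmax : ℝ) (W : ℕ → Fin 3 → ℤ → ℝ) : Prop :=
  ∀ (r : ℕ) (j : Fin 3),
    (∀ i ∈ window r j, |W r j i| ≤ Wmax) ∧
    ∀ k ≤ l, ((window r j).card : ℝ)⁻¹ * ∑ i ∈ window r j, (i : ℝ) ^ k * W r j i
      = if k = 0 then 1 else 0

/-- Kernel smoothing in time of a sequence `M` of matrices, at time `t`, with width `r`. -/
def kernelSmooth {n : ℕ} (T : ℕ) (W : ℕ → Fin 3 → ℤ → ℝ) (r : ℕ)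
    (M : ℤ → Matrix (Fin n) (Fin n) ℝ) (t : ℤ) : Matrix (Fin n) (Fin n) ℝ :=
  ∑ j : Fin 3, if t ∈ windowDomain T r j then
    ((window r j).card : ℝ)⁻¹ • ∑ i ∈ window r j, W r j i • M (t + i) else 0

/-- `δ₁ = √(n α)`. -/
def delta1 (n : ℕ) (α : ℝ) : ℝ := Real.sqrt (n * α)

/-- `δ₂ = (α^{β+1} n^{β+1} / T^β)^{1/(2β+1)} + (α³ n n_max s)^{1/4}`. -/
def delta2 (n T nmax s : ℕ) (α β : ℝ) : ℝ :=
  (α ^ (β + 1) * (n : ℝ) ^ (β + 1) / (T : ℝ) ^ β) ^ (1 / (2 * β + 1))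
    + (α ^ 3 * n * nmax * s) ^ ((1 : ℝ) / 4)

/-- The window width
`min ([C_T ((n α)⁻¹ T^{2β})^{1/(2β+1)}], [C_s √(n / (α n_max s))])`;
for `s = 0` the second quantity is infinite. -/
def optWidth (CT Cs : ℝ) (n T nmax s : ℕ) (α β : ℝ) : ℕ :=
  if s = 0 then ⌊CT * (((n : ℝ) * α)⁻¹ * (T : ℝ) ^ (2 * β)) ^ (1 / (2 * β + 1))⌋₊
  else min ⌊CT * (((n : ℝ) * α)⁻¹ * (T : ℝ) ^ (2 * β)) ^ (1 / (2 * β + 1))⌋₊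
    ⌊Cs * Real.sqrt ((α * nmax * s)⁻¹ * n)⌋₊

/-- The bound `C₀ √(n α / (r ∨ 1))` on the stochastic part of the error. -/
def varBound (C₀ : ℝ) (n : ℕ) (α : ℝ) (r : ℕ) : ℝ :=
  C₀ * Real.sqrt (n * α / (max r 1 : ℕ))

/-- The bound `(L / l!) W_max α n (r/T)^β + 2 √2 W_max C_λ α √(n_max r s)` on the bias. -/
def biasBound (Wmax β L Cl : ℝ) (n T nmax s : ℕ) (α : ℝ) (r : ℕ) : ℝ :=
  L / (holderOrder β).factorial * Wmax * α * n * ((r : ℝ) / T) ^ β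
    + 2 * Real.sqrt 2 * Wmax * Cl * α * Real.sqrt (nmax * r * s)

namespace DSBM

variable {Ω : Type*} [MeasurableSpace Ω] {μ : Measure Ω} {n K T : ℕ} {d : ℝ}

/-- The clustering matrix `Θ_t`. -/
def clusterMatrix (m : DSBM μ n K T d) (t : ℤ) : Matrix (Fin n) (Fin K) ℝ :=
  Matrix.of fun i k => if m.label t i = k then 1 else 0

/-- The edge probability matrix `P_t = Θ_t B_t Θ_tᵀ`. -/
def edgeProb (m : DSBM μ n K T d) (t : ℤ) : Matrix (Fin n) (Fin n) ℝ :=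
  m.clusterMatrix t * m.conn t * (m.clusterMatrix t).transpose

/-- The rescaled connectivity matrix `H_t = α⁻¹ B_t`. -/
def scaledConn (m : DSBM μ n K T d) (α : ℝ) (t : ℤ) : Matrix (Fin K) (Fin K) ℝ :=
  α⁻¹ • m.conn t

/-- The largest class size over all classes and all times. -/
def nmax (m : DSBM μ n K T d) : ℕ :=
  (Finset.Icc (1 : ℤ) T).sup fun t => Finset.univ.sup fun k : Fin K =>
    (Finset.univ.filter fun i : Fin n => m.label t i = k).card

/-- `C_α⁻¹ α ≤ ‖B_t‖_∞ ≤ C_α α` at all times. -/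
def SparsityLevel (m : DSBM μ n K T d) (Cα α : ℝ) : Prop :=
  ∀ t : ℤ, 1 ≤ t → t ≤ T →
    Cα⁻¹ * α ≤ maxAbsEntry (m.conn t) ∧ maxAbsEntry (m.conn t) ≤ Cα * α

/-- The entries of `H_t` are values at `t/T` of functions of the Hölder class `Σ(β, L)`. -/
def SmoothConn (m : DSBM μ n K T d) (α β L : ℝ) : Prop :=
  ∀ k k' : Fin K, k ≤ k' → ∃ f : ℝ → ℝ, HolderClass β L f ∧
    ∀ t : ℤ, 1 ≤ t → t ≤ T → m.scaledConn α t k k' = f ((t : ℝ) / T)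

/-- At most `s` nodes change their class between consecutive times. -/
def SlowSwitching (m : DSBM μ n K T d) (s : ℕ) : Prop :=
  ∀ t : ℤ, 1 ≤ t → t + 1 ≤ T →
    (Finset.univ.filter fun i : Fin n => m.label t i ≠ m.label (t + 1) i).card ≤ s

/-- The eigenvalues of `H_t` lie in `[C_λ⁻¹, C_λ]` at all times. -/
def EigenvalueBounds (m : DSBM μ n K T d) (α Cl : ℝ) : Prop :=
  ∀ t : ℤ, 1 ≤ t → t ≤ T → ∀ ev : ℝ,
    Module.End.HasEigenvalue (Matrix.toLin' (m.scaledConn α t)) ev → Cl⁻¹ ≤ ev ∧ ev ≤ Cl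

/-- The kernel estimator `P̂_{t,r}` of `P_t`. -/
def estimator (m : DSBM μ n K T d) (W : ℕ → Fin 3 → ℤ → ℝ) (r : ℕ) (t : ℤ) (ω : Ω) :
    Matrix (Fin n) (Fin n) ℝ :=
  kernelSmooth T W r (fun u => m.adj u ω) t

/-- The total error `Δ_t(r) = ‖P̂_{t,r} - P_t‖`. -/
def totalError (m : DSBM μ n K T d) (W : ℕ → Fin 3 → ℤ → ℝ) (r : ℕ) (t : ℤ) (ω : Ω) : ℝ :=
  specNorm (m.estimator W r t ω - m.edgeProb t)

/-- The off-diagonal error: the spectral norm of `P̂_{t,r} - P_t` with its diagonal removed. -/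
def offDiagError (m : DSBM μ n K T d) (W : ℕ → Fin 3 → ℤ → ℝ) (r : ℕ) (t : ℤ) (ω : Ω) : ℝ :=
  specNorm (offDiagPart (m.estimator W r t ω - m.edgeProb t))

/-- The bias `‖P_{t,r} - P_t‖`, where `P_{t,r}` is the kernel smoothing of the `P_u`. -/
def bias (m : DSBM μ n K T d) (W : ℕ → Fin 3 → ℤ → ℝ) (r : ℕ) (t : ℤ) : ℝ :=
  specNorm (kernelSmooth T W r m.edgeProb t - m.edgeProb t)

/-- `r` minimizes `‖P_{t,r} - P_t‖ + C₀ √(n α / (r ∨ 1))` over the widths `0 ≤ r ≤ T/2`. -/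
def IsBalancedWidth (m : DSBM μ n K T d) (W : ℕ → Fin 3 → ℤ → ℝ) (C₀ α : ℝ) (t : ℤ) (r : ℕ) :
    Prop :=
  2 * r ≤ T ∧ ∀ r' : ℕ, 2 * r' ≤ T →
    m.bias W r t + varBound C₀ n α r ≤ m.bias W r' t + varBound C₀ n α r'

end DSBM

end

/-! The error splits into a stochastic part `P̂_{t,r} - P_{t,r}`, the bias `P_{t,r} - P_t`, and the
diagonal. The diagonal is harmless: the kernel weights average to one, so the estimator has exactly
`d` there, and the diagonal error is at most `|d| + 1`.

Stochastic part. A window average of `N ≥ max r 1` adjacency matrices behaves like `1/N` times a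
sparse random matrix of density `b = N Cα α`, whence the noise level `√(nα / max r 1)`. That no
logarithm is lost comes from the Feige–Ofek argument. By a `1/4`-net of the unit ball it suffices to
bound the bilinear form at pairs of lattice points `x, y`. On light pairs, `|x_i y_j| ≤ √(nb)/n`,
the exponents of the Chernoff bound stay bounded and its probability beats the square of the size of
the net. On heavy pairs this fails, and one argues deterministically from two properties that hold
with high probability: bounded row and column sums, and `Discrepancy`, which controls the edge count
between any two sets of nodes. `Discrepancy` keeps the parameter `φ` of the Chernoff bound free. For
each pair of level sets of `x` and `y` a good `φ` is chosen (`level_block_le`), after which the sums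
over levels are geometric (`sum_heavy_le`). The outcome is `exists_specNorm_centered_tail`.

Bias. Compare `P_{t+i}` with `Θ_t B_{t+i} Θ_tᵀ`, where the labels are frozen. The frozen part is
treated entrywise: the vanishing moments of the kernel kill the Taylor polynomial. The difference
involves at most `r s` switched nodes, so it is controlled by a factor of Frobenius norm `√(2rs)`,
another of norm `√n_max`, and `‖B‖ ≤ α C_λ` (`DSBM.bias_le`).

Width. Each bias term grows with `r` and meets the noise level at an explicit width (`smoothWidth`,
`switchWidth`); the two common values are the two summands of `δ₂`. The width `r*` is essentially
the smaller of the two. With `V` the noise level at `r*`, both bias terms at `r*` are at most a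
constant times `V`, and `V` is at most `δ₁` and at most a constant times `δ₂`. Below `r*` the noise
is at least `V`; above it some bias term is at least a constant times `V` (`optWidth_balance`). This
is the optimality. A minimizer of the exact criterion is compared with `r*`, so its bias and noise
are also of order `V`. -/

/-! ### Heavy pairs: level sets and the discrepancy property -/

/-- The entropy `m log (e n / m)`, which bounds the logarithm of `n.choose m`. -/
noncomputable def choiceEntropy (n m : ℕ) : ℝ := m * (1 + Real.log (n / m))

/-- Sum of the entries of `M` over `I × J`. -/
def blockSum {n : ℕ} (M : Fin n → Fin n → ℝ) (I J : Finset (Fin n)) : ℝ :=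
  ∑ i ∈ I, ∑ j ∈ J, M i j

/-- The term at the smallest exponent of `S` is below `2`, and each further step in the exponent
halves the term. -/
lemma sum_one_div_sqrt_four_pow_le (S : Finset ℕ) {a : ℝ}
    (hS : ∀ s ∈ S, 1 / 4 < a * 4 ^ s) : ∑ s ∈ S, 1 / √(a * 4 ^ s) ≤ 4 := by
  rcases S.eq_empty_or_nonempty with rfl | hne
  · simp
  obtain ⟨s₀, hs₀, hmin⟩ := S.exists_min_image id hne
  have key : ∀ s ∈ S, 1 / √(a * 4 ^ s) ≤ 2 * (1 / 2 : ℝ) ^ (s - s₀) := by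
    intro s hs
    obtain ⟨k, rfl⟩ : ∃ k, s = s₀ + k := ⟨s - s₀, by have := hmin s hs; simp at this; omega⟩
    have h1 : ((2 : ℝ) ^ k / 2) ≤ √(a * 4 ^ (s₀ + k)) := by
      apply Real.le_sqrt_of_sq_le
      have := hS s₀ hs₀
      rw [pow_add, ← mul_assoc, div_pow, ← pow_mul, mul_comm k 2, pow_mul]
      norm_num
      have h4 : (0 : ℝ) < 4 ^ k := by positivity
      nlinarith
    rw [Nat.add_sub_cancel_left, one_div_pow, div_le_iff₀ (lt_of_lt_of_le (by positivity) h1)]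
    have h2 : (0 : ℝ) < 2 ^ k := by positivity
    calc (1 : ℝ) = 2 * (1 / 2 ^ k) * (2 ^ k / 2) := by field_simp
      _ ≤ _ := by gcongr
  have inj : Set.InjOn (fun s => s - s₀) (S : Set ℕ) := by
    intro x hx y hy hxy
    have h1 := hmin x hx; have h2 := hmin y hy
    simp at h1 h2 hxy; omega
  calc ∑ s ∈ S, 1 / √(a * 4 ^ s) ≤ ∑ s ∈ S, 2 * (1 / 2 : ℝ) ^ (s - s₀) := Finset.sum_le_sum key
    _ = 2 * ∑ s ∈ S.image (fun s => s - s₀), (1 / 2 : ℝ) ^ s := by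
        rw [Finset.sum_image inj, Finset.mul_sum]
    _ ≤ 2 * 2 := by
        gcongr
        have := summable_geometric_two.sum_le_tsum (S.image (fun s => s - s₀))
          (fun i _ => by positivity)
        rwa [tsum_geometric_two] at this
    _ = 4 := by norm_num

/-- The mirror image: the term at the largest exponent is below `1` and the terms halve downwards.
-/
lemma sum_one_div_sqrt_div_four_pow_le (S : Finset ℕ) {a : ℝ}
    (hS : ∀ s ∈ S, 1 < a / 4 ^ s) : ∑ s ∈ S, 1 / √(a / 4 ^ s) ≤ 2 := by
  rcases S.eq_empty_or_nonempty with rfl | hne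
  · simp
  obtain ⟨s₀, hs₀, hmax⟩ := S.exists_max_image id hne
  have key : ∀ s ∈ S, 1 / √(a / 4 ^ s) ≤ (1 / 2 : ℝ) ^ (s₀ - s) := by
    intro s hs
    obtain ⟨k, rfl⟩ : ∃ k, s₀ = s + k := ⟨s₀ - s, by have := hmax s hs; simp at this; omega⟩
    have h1 : ((2 : ℝ) ^ k) ≤ √(a / 4 ^ s) := by
      apply Real.le_sqrt_of_sq_le
      have := hS _ hs₀
      rw [lt_div_iff₀ (by positivity), one_mul, pow_add] at this
      rw [← pow_mul, mul_comm k 2, pow_mul, le_div_iff₀ (by positivity)]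
      norm_num
      linarith
    rw [Nat.add_sub_cancel_left, one_div_pow]
    gcongr
  have inj : Set.InjOn (fun s => s₀ - s) (S : Set ℕ) := by
    intro x hx y hy hxy
    have h1 := hmax x hx; have h2 := hmax y hy
    simp at h1 h2 hxy; omega
  calc ∑ s ∈ S, 1 / √(a / 4 ^ s) ≤ ∑ s ∈ S, (1 / 2 : ℝ) ^ (s₀ - s) := Finset.sum_le_sum key
    _ = ∑ s ∈ S.image (fun s => s₀ - s), (1 / 2 : ℝ) ^ s := by
        rw [Finset.sum_image inj]
    _ ≤ 2 := by
        have := summable_geometric_two.sum_le_tsum (S.image (fun s => s₀ - s))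
          (fun i _ => by positivity)
        rwa [tsum_geometric_two] at this

/-- The arithmetic behind `level_block_le`. There `X` and `Y` are the scales of two levels, `p X²`
and `J = q Y²` the sizes of the level sets, and `c = 1 + log (n / J)`. With `exp φ` of order
`√(h/q)` the exponential term costs `p/√h`, while the entropy term costs `q/√v` after division by
`φ`. -/
lemma div_le_of_exponential_bound {b K e p q X Y J D h v φ c : ℝ} (hK : 0 ≤ K)
    (hD0 : 0 < D) (hX : 0 < X) (hY : 0 < Y) (hp : 0 ≤ p) (hq0 : 0 < q)
    (hh0 : 0 < h) (hv0 : 0 < v) (hφ1 : 1 ≤ φ)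
    (e1 : b * (p * X ^ 2) * J / (X * Y) = D * (p * q) / h)
    (e2 : J / (X * Y) = D * q / v)
    (hmain : φ * e ≤ b * (p * X ^ 2) * J * Real.exp φ + K * (J * c))
    (hexp : Real.exp φ ≤ Real.exp 2 * (4 * √(h / q)))
    (hlog : c ≤ φ * (3 + 2 * √v))
    (hsq : √(h / q) * q ≤ 4 * √h) (hsv : 1 / 2 ≤ √v) :
    e / (X * Y) ≤ D * (16 * Real.exp 2 * (p * (1 / √h)) + 8 * K * (q * (1 / √v))) := by
  have hφ0 : 0 < φ := by linarith
  have hsv0 : 0 < √v := by positivity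
  have part1 : b * (p * X ^ 2) * J * Real.exp φ / (X * Y)
      ≤ D * (16 * Real.exp 2 * (p * (1 / √h))) := by
    calc b * (p * X ^ 2) * J * Real.exp φ / (X * Y) = D * (p * q) / h * Real.exp φ := by
          rw [← e1]; ring
      _ ≤ D * (p * q) / h * (Real.exp 2 * (4 * √(h / q))) := by gcongr
      _ = D * p * (Real.exp 2 * 4) / h * (√(h / q) * q) := by ring
      _ ≤ D * p * (Real.exp 2 * 4) / h * (4 * √h) := by gcongr
      _ = D * (16 * Real.exp 2 * (p * (1 / √h))) := by
          have : h = √h * √h := (Real.mul_self_sqrt hh0.le).symm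
          have h5 : 0 < √h := by positivity
          have : √h / h = 1 / √h := by
            rw [div_eq_div_iff hh0.ne' h5.ne']; linarith
          calc _ = D * p * (Real.exp 2 * 16) * (√h / h) := by ring
            _ = _ := by rw [this]; ring
  have part2 : K * (J * c) / (X * Y)
      ≤ φ * (D * (8 * K * (q * (1 / √v)))) := by
    have hvv : v = √v * √v := (Real.mul_self_sqrt hv0.le).symm
    calc K * (J * c) / (X * Y)
        = K * (D * q / v) * c := by rw [← e2]; ring
      _ ≤ K * (D * q / v) * (φ * (3 + 2 * √v)) := by gcongr
      _ = φ * K * D * q * ((3 + 2 * √v) / v) := by ring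
      _ ≤ φ * K * D * q * (8 * (1 / √v)) := by
          gcongr
          rw [mul_one_div, div_le_div_iff₀ hv0 hsv0]
          nlinarith
      _ = _ := by ring
  have hfin : φ * (e / (X * Y)) ≤ φ * (D * (16 * Real.exp 2 * (p * (1 / √h))
      + 8 * K * (q * (1 / √v)))) := by
    calc φ * (e / (X * Y)) = φ * e / (X * Y) := by ring
      _ ≤ (b * (p * X ^ 2) * J * Real.exp φ + K * (J * c)) / (X * Y) := by
          gcongr
      _ ≤ D * (16 * Real.exp 2 * (p * (1 / √h))) + φ * (D * (8 * K * (q * (1 / √v)))) := by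
          rw [add_div]; exact add_le_add part1 part2
      _ ≤ φ * (D * (16 * Real.exp 2 * (p * (1 / √h)))) + φ * (D * (8 * K * (q * (1 / √v)))) := by
          exact add_le_add (le_mul_of_one_le_left (by positivity) hφ1) le_rfl
      _ = _ := by ring
  exact le_of_mul_le_mul_left hfin hφ0

/-- A block sum between two level sets, bounded by optimizing the parameter of the
discrepancy property. -/
lemma level_block_le {n : ℕ} (hn : 2 ≤ n) {b K e p q X Y J : ℝ} (hb : 0 < b) (hK : 0 ≤ K)
    (hX : 0 < X) (hY : 0 < Y) (hJ : 1 ≤ J)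
    (hp : 0 ≤ p) (hqJ : J = q * Y ^ 2) (hq16 : q ≤ 16)
    (hv : 1 / 4 < √(n * b) / Y * X) (hh : 1 < n / √(n * b) / X / Y)
    (hdisc : ∀ φ : ℕ, 1 ≤ φ → φ ≤ 8 * n →
      φ * e ≤ b * (p * X ^ 2) * J * Real.exp φ + K * (J * (1 + Real.log (n / J)))) :
    e / (X * Y) ≤ √(n * b) * (16 * Real.exp 2 * (p * (1 / √(n / √(n * b) / X / Y)))
      + 8 * K * (q * (1 / √(√(n * b) / Y * X)))) := by
  have hn0 : (0 : ℝ) < n := by positivity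
  have hn2 : (2 : ℝ) ≤ n := by exact_mod_cast hn
  set D := √(n * b) with hD
  have hD0 : 0 < D := by positivity
  have hDD : D ^ 2 = n * b := Real.sq_sqrt (by positivity)
  set h := n / D / X / Y with hhdef
  set v := D / Y * X with hvdef
  have hh0 : 0 < h := by positivity
  have hv0 : 0 < v := by positivity
  have hq0 : 0 < q := by
    by_contra hcon
    have : q * Y ^ 2 ≤ 0 := mul_nonpos_of_nonpos_of_nonneg (not_lt.1 hcon) (by positivity)
    linarith
  have hhq : h / q = n / (v * J) := by
    rw [hhdef, hvdef, hqJ]; field_simp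
  have e1 : b * (p * X ^ 2) * J / (X * Y) = D * (p * q) / h := by
    rw [hhdef, hqJ]; field_simp; rw [hDD]; ring
  have e2 : J / (X * Y) = D * q / v := by
    rw [hvdef, hqJ]; field_simp
  clear_value h v D
  -- The factor `16` compensates `q ≤ 16`, so that the logarithm in `ψ` is nonnegative.
  have hge : 1 ≤ 16 * (h / q) := by
    have : 1 / 16 ≤ h / q := by
      rw [div_le_div_iff₀ (by norm_num) hq0]; linarith
    linarith
  have hle : h / q ≤ 4 * n := by
    rw [hhq, div_le_iff₀ (by positivity)]
    have h1 : 1 / 4 * 1 ≤ v * J := mul_le_mul hv.le hJ (by norm_num) hv0.le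
    have h2 := mul_le_mul_of_nonneg_left h1 hn0.le
    linarith
  -- Chosen so that `exp ψ = 4 e √(h/q)`; rounding up to an integer costs at most another factor
  -- `e`.
  set ψ := 1 + Real.log (16 * (h / q)) / 2 with hψ
  have hψ1 : 1 ≤ ψ := by
    have := Real.log_nonneg hge
    rw [hψ]; linarith
  set φ := ⌈ψ⌉₊ with hφ
  have hφψ : ψ ≤ φ := Nat.le_ceil _
  have hφlt : (φ : ℝ) < ψ + 1 := Nat.ceil_lt_add_one (by linarith)
  clear_value φ ψ
  have hφ1 : (1 : ℝ) ≤ φ := hψ1.trans hφψ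
  -- `Discrepancy` is only available up to `8 n`; since `h/q ≤ 4n`, the parameter is at most of
  -- order `log n`.
  have hφn : φ ≤ 8 * n := by
    have h1 : Real.log (16 * (h / q)) ≤ Real.log (64 * n) :=
      Real.log_le_log (by positivity) (by linarith)
    have h2 : Real.log (64 * n) ≤ 6 * 0.7 + (n - 1) := by
      rw [Real.log_mul (by norm_num) hn0.ne', show (64 : ℝ) = 2 ^ 6 by norm_num, Real.log_pow]
      have := Real.log_two_lt_d9
      have := Real.log_le_sub_one_of_pos hn0
      push_cast; linarith
    have : (φ : ℝ) ≤ 8 * n := by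
      rw [hψ] at hφlt; norm_num at h2; linarith
    exact_mod_cast this
  have hφ1' : 1 ≤ φ := by exact_mod_cast hφ1
  have hmain := hdisc φ hφ1' hφn
  have hexp : Real.exp φ ≤ Real.exp 2 * (4 * √(h / q)) := by
    calc Real.exp φ ≤ Real.exp (2 + Real.log (16 * (h / q)) / 2) := by
          apply Real.exp_le_exp.2; rw [hψ] at hφlt; linarith
      _ = Real.exp 2 * (4 * √(h / q)) := by
          rw [Real.exp_add, ← Real.log_sqrt (by positivity), Real.exp_log (by positivity),
            Real.sqrt_mul (by norm_num), show √(16 : ℝ) = 4 by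
              rw [show (16 : ℝ) = 4 ^ 2 by norm_num]; exact Real.sqrt_sq (by norm_num)]
  have hsv : 1 / 2 ≤ √v := Real.le_sqrt_of_sq_le (by norm_num; linarith)
  have hsv0 : 0 < √v := by positivity
  have hlog : 1 + Real.log (n / J) ≤ φ * (3 + 2 * √v) := by
    have h1 : n / J = h / q * v := by rw [hhq]; field_simp
    rw [h1, Real.log_mul (by positivity) hv0.ne']
    have h2 : Real.log v ≤ 2 * √v := by
      have := Real.log_sqrt hv0.le
      have := Real.log_le_sub_one_of_pos hsv0
      linarith
    have h3 : Real.log (h / q) ≤ Real.log (16 * (h / q)) :=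
      Real.log_le_log (by positivity) (by have : 0 < h / q := by positivity
                                          linarith)
    have h4 : Real.log (16 * (h / q)) ≤ 2 * φ := by rw [hψ] at hφψ; linarith
    have h5 : 0 ≤ (φ - 1) * (1 + 2 * √v) := mul_nonneg (by linarith) (by positivity)
    linarith
  have hsq : √(h / q) * q ≤ 4 * √h := by
    rw [Real.sqrt_div hh0.le]
    have h1 : √q * √q = q := Real.mul_self_sqrt hq0.le
    have h2 : √q ≤ 4 := by
      rw [show (4 : ℝ) = √(4 ^ 2) from (Real.sqrt_sq (by norm_num)).symm]
      exact Real.sqrt_le_sqrt (by linarith)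
    have h3 : 0 < √q := by positivity
    calc √h / √q * q = √h * √q := by field_simp; linarith
      _ ≤ 4 * √h := by rw [mul_comm]; exact mul_le_mul_of_nonneg_right h2 (Real.sqrt_nonneg h)
  exact div_le_of_exponential_bound hK hD0 hX hY hp hq0 hh0 hv0 hφ1
    e1 e2 hmain hexp hlog hsq hsv

/-- The discrepancy property of a nonnegative matrix. -/
def Discrepancy {n : ℕ} (b K : ℝ) (M : Fin n → Fin n → ℝ) : Prop :=
  ∀ I J : Finset (Fin n), I.Nonempty → J.Nonempty → ∀ φ : ℕ, 1 ≤ φ → φ ≤ 8 * n →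
    φ * blockSum M I J ≤ b * I.card * J.card * Real.exp φ
      + K * choiceEntropy n (max I.card J.card)

lemma blockSum_swap {n : ℕ} (M : Fin n → Fin n → ℝ) (I J : Finset (Fin n)) :
    blockSum (fun i j => M j i) I J = blockSum M J I := Finset.sum_comm

lemma Discrepancy.swap {n : ℕ} {b K : ℝ} {M : Fin n → Fin n → ℝ} (h : Discrepancy b K M) :
    Discrepancy b K fun i j => M j i := by
  intro I J hI hJ φ h1 h2
  have := h J I hJ hI φ h1 h2
  rw [blockSum_swap, max_comm]
  linarith

/-- Pairs of levels on which degree bounds do not suffice. -/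
def BalancedLevels (n : ℕ) (b : ℝ) (s t : ℕ) : Prop :=
  1 / 4 < √(n * b) / 4 ^ t * 4 ^ s ∧ 1 / 4 < √(n * b) / 4 ^ s * 4 ^ t ∧
    1 < n / √(n * b) / 4 ^ s / 4 ^ t

lemma BalancedLevels.swap {n : ℕ} {b : ℝ} {s t : ℕ} (h : BalancedLevels n b s t) :
    BalancedLevels n b t s := by
  refine ⟨h.2.1, h.1, ?_⟩
  have := h.2.2
  rwa [div_right_comm] at this

-- Restricting to `|I_s| ≤ |J_t|` makes the entropy that of `J_t`. The exponential terms are summed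
-- over `t` first and the entropy terms over `s` first; both inner sums are geometric. The outer
-- weights sum to at most `16`, hence `512 = 16 · 16 · 2 = 8 · 16 · 4`. The opposite ordering of
-- sizes is obtained by transposing the matrix.
open Classical in
lemma sum_level_blocks_le {n : ℕ} (hn : 2 ≤ n) {b K : ℝ} (hb : 0 < b) (hK : 0 ≤ K)
    {M : Fin n → Fin n → ℝ} (hdisc : Discrepancy b K M)
    (S : Finset ℕ) (I J : ℕ → Finset (Fin n))
    (hI : ∑ s ∈ S, ((I s).card : ℝ) / (4 ^ s) ^ 2 ≤ 16)
    (hJ : ∑ s ∈ S, ((J s).card : ℝ) / (4 ^ s) ^ 2 ≤ 16) :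
    ∑ s ∈ S, ∑ t ∈ S, (if BalancedLevels n b s t ∧ (I s).card ≤ (J t).card then
        blockSum M (I s) (J t) / (4 ^ s * 4 ^ t) else 0)
      ≤ √(n * b) * (512 * Real.exp 2 + 512 * K) := by
  set D := √(n * b) with hD
  have hD0 : 0 ≤ D := Real.sqrt_nonneg _
  have hJ16 : ∀ t ∈ S, ((J t).card : ℝ) / (4 ^ t) ^ 2 ≤ 16 := fun t ht =>
    (Finset.single_le_sum (f := fun s => ((J s).card : ℝ) / (4 ^ s) ^ 2)
      (fun _ _ => by positivity) ht).trans hJ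
  have hterm : ∀ s ∈ S, ∀ t ∈ S,
      (if BalancedLevels n b s t ∧ (I s).card ≤ (J t).card then
        blockSum M (I s) (J t) / (4 ^ s * 4 ^ t) else 0)
      ≤ D * (16 * Real.exp 2 * (((I s).card : ℝ) / (4 ^ s) ^ 2 *
            (if 1 < n / D / 4 ^ s / 4 ^ t then 1 / √(n / D / 4 ^ s / 4 ^ t) else 0))
          + 8 * K * (((J t).card : ℝ) / (4 ^ t) ^ 2 *
            (if 1 / 4 < D / 4 ^ t * 4 ^ s then 1 / √(D / 4 ^ t * 4 ^ s) else 0))) := by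
    intro s hs t ht
    have hpos : 0 ≤ D * (16 * Real.exp 2 * (((I s).card : ℝ) / (4 ^ s) ^ 2 *
            (if 1 < n / D / 4 ^ s / 4 ^ t then 1 / √(n / D / 4 ^ s / 4 ^ t) else 0))
          + 8 * K * (((J t).card : ℝ) / (4 ^ t) ^ 2 *
            (if 1 / 4 < D / 4 ^ t * 4 ^ s then 1 / √(D / 4 ^ t * 4 ^ s) else 0))) := by
      have h1 : 0 ≤ (if 1 < n / D / 4 ^ s / 4 ^ t then 1 / √(n / D / 4 ^ s / 4 ^ t) else 0) := by
        split_ifs <;> positivity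
      have h2 : 0 ≤ (if 1 / 4 < D / 4 ^ t * 4 ^ s then 1 / √(D / 4 ^ t * 4 ^ s) else 0) := by
        split_ifs <;> positivity
      positivity
    by_cases hcond : BalancedLevels n b s t ∧ (I s).card ≤ (J t).card
    · rw [if_pos hcond]
      obtain ⟨hG, hcard⟩ := hcond
      have g1 : 1 < n / D / 4 ^ s / 4 ^ t := hG.2.2
      have g2 : 1 / 4 < D / 4 ^ t * 4 ^ s := hG.1
      rw [if_pos g1, if_pos g2] at hpos
      rw [if_pos g1, if_pos g2]
      rcases (I s).eq_empty_or_nonempty with hIe | hIne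
      · rw [hIe] at hpos ⊢
        simpa [blockSum] using hpos
      have hJne : (J t).Nonempty := by
        rw [← Finset.card_pos]; exact (Finset.card_pos.2 hIne).trans_le hcard
      refine level_block_le hn hb hK (by positivity) (by positivity)
        (J := (J t).card) (by exact_mod_cast Finset.card_pos.2 hJne) (by positivity)
        (by field_simp) (hJ16 t ht) hG.1 hG.2.2 ?_
      intro φ h1 h2
      have := hdisc (I s) (J t) hIne hJne φ h1 h2
      rw [max_eq_right hcard, choiceEntropy] at this
      rwa [div_mul_cancel₀ _ (by positivity)]
    · rw [if_neg hcond]; exact hpos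
  calc _ ≤ ∑ s ∈ S, ∑ t ∈ S, D * (16 * Real.exp 2 * (((I s).card : ℝ) / (4 ^ s) ^ 2 *
            (if 1 < n / D / 4 ^ s / 4 ^ t then 1 / √(n / D / 4 ^ s / 4 ^ t) else 0))
          + 8 * K * (((J t).card : ℝ) / (4 ^ t) ^ 2 *
            (if 1 / 4 < D / 4 ^ t * 4 ^ s then 1 / √(D / 4 ^ t * 4 ^ s) else 0))) :=
        Finset.sum_le_sum fun s hs => Finset.sum_le_sum fun t ht => hterm s hs t ht
    _ = D * (16 * Real.exp 2 * (∑ s ∈ S, ((I s).card : ℝ) / (4 ^ s) ^ 2 * ∑ t ∈ S,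
            (if 1 < n / D / 4 ^ s / 4 ^ t then 1 / √(n / D / 4 ^ s / 4 ^ t) else 0))
          + 8 * K * (∑ t ∈ S, ((J t).card : ℝ) / (4 ^ t) ^ 2 * ∑ s ∈ S,
            (if 1 / 4 < D / 4 ^ t * 4 ^ s then 1 / √(D / 4 ^ t * 4 ^ s) else 0))) := by
        rw [mul_add]
        simp_rw [mul_add, Finset.sum_add_distrib, Finset.mul_sum]
        congr 1
        rw [Finset.sum_comm]
    _ ≤ D * (16 * Real.exp 2 * (∑ s ∈ S, ((I s).card : ℝ) / (4 ^ s) ^ 2 * 2)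
          + 8 * K * (∑ t ∈ S, ((J t).card : ℝ) / (4 ^ t) ^ 2 * 4)) := by
        gcongr with s hs t ht
        · rw [← Finset.sum_filter]
          exact sum_one_div_sqrt_div_four_pow_le _ fun s hs => (Finset.mem_filter.1 hs).2
        · rw [← Finset.sum_filter]
          exact sum_one_div_sqrt_four_pow_le _ fun s hs => (Finset.mem_filter.1 hs).2
    _ = D * (16 * Real.exp 2 * ((∑ s ∈ S, ((I s).card : ℝ) / (4 ^ s) ^ 2) * 2)
          + 8 * K * ((∑ t ∈ S, ((J t).card : ℝ) / (4 ^ t) ^ 2) * 4)) := by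
        rw [Finset.sum_mul, Finset.sum_mul]
    _ ≤ D * (16 * Real.exp 2 * (16 * 2) + 8 * K * (16 * 4)) := by gcongr
    _ = _ := by ring

/-- The base-4 level of a real number in `[-1, 1] \ {0}`. -/
lemma exists_level_function : ∃ lv : ℝ → ℕ, ∀ z : ℝ, z ≠ 0 → |z| ≤ 1 →
    1 / 4 ^ lv z < 4 * |z| ∧ |z| ≤ 1 / 4 ^ lv z := by
  have : ∀ z : ℝ, ∃ s : ℕ, z ≠ 0 → |z| ≤ 1 → 1 / 4 ^ s < 4 * |z| ∧ |z| ≤ 1 / 4 ^ s := by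
    intro z
    by_cases hz : z ≠ 0 ∧ |z| ≤ 1
    · obtain ⟨s, h1, h2⟩ := exists_nat_pow_near_of_lt_one (abs_pos.2 hz.1) hz.2
        (by norm_num : (0 : ℝ) < 1 / 4) (by norm_num)
      refine ⟨s, fun _ _ => ⟨?_, by simpa [one_div] using h2⟩⟩
      rw [pow_succ, one_div_pow] at h1
      linarith
    · exact ⟨0, fun h1 h2 => absurd ⟨h1, h2⟩ hz⟩
  exact Classical.axiomOfChoice this

/-- An index of level `s` has `4⁻ˢ < 4 |x i|`, so it contributes at most `16 x i ^ 2`. -/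
lemma sum_level_card_le {n : ℕ} {lv : ℝ → ℕ}
    (hlv : ∀ z : ℝ, z ≠ 0 → |z| ≤ 1 → 1 / 4 ^ lv z < 4 * |z| ∧ |z| ≤ 1 / 4 ^ lv z)
    {x : Fin n → ℝ} (hx : ∑ i, x i ^ 2 ≤ 1) (hx1 : ∀ i, |x i| ≤ 1) (S : Finset ℕ)
    (hS : ∀ i, lv (x i) ∈ S) :
    ∑ s ∈ S, (((Finset.univ.filter fun i => x i ≠ 0 ∧ lv (x i) = s).card : ℕ) : ℝ)
      / (4 ^ s) ^ 2 ≤ 16 := by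
  calc _ ≤ ∑ s ∈ S, ∑ i with lv (x i) = s, 16 * x i ^ 2 := by
        refine Finset.sum_le_sum fun s _ => ?_
        rw [Finset.card_eq_sum_ones, Nat.cast_sum, Finset.sum_div]
        refine (Finset.sum_le_sum (g := fun i => 16 * x i ^ 2) fun i hi => ?_).trans
          (Finset.sum_le_sum_of_subset_of_nonneg ?_ fun i _ _ => by positivity)
        · obtain ⟨h0, rfl⟩ := (Finset.mem_filter.1 hi).2
          have h1 := (hlv _ h0 (hx1 i)).1
          calc ((1 : ℕ) : ℝ) / (4 ^ lv (x i)) ^ 2 = (1 / 4 ^ lv (x i)) ^ 2 := by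
                rw [div_pow]; simp
            _ ≤ (4 * |x i|) ^ 2 := by gcongr
            _ = 16 * x i ^ 2 := by rw [mul_pow, sq_abs]; norm_num
        · intro i hi
          simp only [Finset.mem_filter] at hi ⊢
          exact ⟨hi.1, hi.2.2⟩
    _ = ∑ i, 16 * x i ^ 2 := Finset.sum_fiberwise_of_maps_to (fun i _ => hS i) _
    _ = 16 * ∑ i, x i ^ 2 := by rw [Finset.mul_sum]
    _ ≤ 16 := by linarith

lemma abs_le_one_of_sum_sq_le_one {n : ℕ} {x : Fin n → ℝ} (hx : ∑ i, x i ^ 2 ≤ 1) (i : Fin n) :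
    |x i| ≤ 1 := by
  rw [← sq_le_one_iff_abs_le_one]
  exact (Finset.single_le_sum (f := fun i => x i ^ 2) (fun _ _ => sq_nonneg _)
    (Finset.mem_univ i)).trans hx

open Classical in
/-- The contribution of the heavy pairs to the bilinear form of a matrix with bounded degrees and
the discrepancy property. -/
lemma sum_heavy_le {n : ℕ} (hn : 2 ≤ n) {b K R : ℝ} (hb : 0 < b) (hK : 0 ≤ K)
    {M : Fin n → Fin n → ℝ} (hM : ∀ i j, 0 ≤ M i j) (hdisc : Discrepancy b K M)
    (hrow : ∀ i, ∑ j, M i j ≤ R) (hcol : ∀ j, ∑ i, M i j ≤ R)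
    {x y : Fin n → ℝ} (hx : ∑ i, x i ^ 2 ≤ 1) (hy : ∑ i, y i ^ 2 ≤ 1) :
    ∑ i, ∑ j, (if √(n * b) / n < |x i * y j| then |x i * y j| * M i j else 0)
      ≤ 2 * R / √(n * b) + 2 * (√(n * b) * (512 * Real.exp 2 + 512 * K)) := by
  obtain ⟨lv, hlv⟩ := exists_level_function
  have hn0 : (0 : ℝ) < n := by positivity
  set D := √(n * b) with hD
  have hD0 : 0 < D := by positivity
  have hx1 := abs_le_one_of_sum_sq_le_one hx
  have hy1 := abs_le_one_of_sum_sq_le_one hy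
  set S : Finset ℕ := Finset.univ.image (fun i => lv (x i)) ∪ Finset.univ.image (fun i => lv (y i))
    with hS
  have hSx : ∀ i, lv (x i) ∈ S := fun i =>
    Finset.mem_union_left _ (Finset.mem_image_of_mem _ (Finset.mem_univ i))
  have hSy : ∀ i, lv (y i) ∈ S := fun i =>
    Finset.mem_union_right _ (Finset.mem_image_of_mem _ (Finset.mem_univ i))
  set I : ℕ → Finset (Fin n) := fun s => Finset.univ.filter fun i => x i ≠ 0 ∧ lv (x i) = s with hI
  set J : ℕ → Finset (Fin n) := fun s => Finset.univ.filter fun i => y i ≠ 0 ∧ lv (y i) = s with hJ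
  have hIc := sum_level_card_le hlv hx hx1 S hSx
  have hJc := sum_level_card_le hlv hy hy1 S hSy
  have hR : 0 ≤ R := (Finset.sum_nonneg fun j _ => hM ⟨0, by omega⟩ j).trans (hrow _)
  have hpt : ∀ i j, (if D / n < |x i * y j| then |x i * y j| * M i j else 0)
      ≤ x i ^ 2 / D * M i j + y j ^ 2 / D * M i j +
        ∑ s ∈ S, ∑ t ∈ S, (if BalancedLevels n b s t then
          (if i ∈ I s then if j ∈ J t then M i j else 0 else 0) / (4 ^ s * 4 ^ t) else 0) := by
    intro i j
    have hMij := hM i j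
    have hnn : ∀ s ∈ S, ∀ t ∈ S, 0 ≤ (if BalancedLevels n b s t then
          (if i ∈ I s then if j ∈ J t then M i j else 0 else 0) / ((4 : ℝ) ^ s * 4 ^ t) else 0) := by
      intro s _ t _
      split_ifs <;> positivity
    have hsum := Finset.sum_nonneg fun s hs => Finset.sum_nonneg (hnn s hs)
    have hx2 : 0 ≤ x i ^ 2 / D * M i j := by positivity
    have hy2 : 0 ≤ y j ^ 2 / D * M i j := by positivity
    split_ifs with hheavy
    swap
    · linarith
    -- If one coordinate dominates the other by a factor `D`, the product is at most a square
    -- divided by `D`, and the row or column sums suffice. Only comparable coordinates need the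
    -- discrepancy property, and their levels are balanced.
    by_cases hxy : |y j| ≤ |x i| / D
    · have : |x i * y j| * M i j ≤ x i ^ 2 / D * M i j := by
        gcongr
        rw [abs_mul, ← sq_abs, sq, mul_div_assoc]
        gcongr
      linarith
    by_cases hyx : |x i| ≤ |y j| / D
    · have : |x i * y j| * M i j ≤ y j ^ 2 / D * M i j := by
        gcongr
        rw [abs_mul, ← sq_abs (y j), sq, mul_comm, mul_div_assoc]
        gcongr
      linarith
    have hne : x i * y j ≠ 0 := by
      intro h0
      rw [h0, abs_zero] at hheavy
      exact absurd hheavy (not_lt.2 (by positivity))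
    have hxi : x i ≠ 0 := left_ne_zero_of_mul hne
    have hyj : y j ≠ 0 := right_ne_zero_of_mul hne
    obtain ⟨x4, x1⟩ := hlv _ hxi (hx1 i)
    obtain ⟨y4, y1⟩ := hlv _ hyj (hy1 j)
    push Not at hxy hyx
    rw [div_lt_iff₀ hD0] at hxy hyx
    have hG : BalancedLevels n b (lv (x i)) (lv (y j)) := by
      set X : ℝ := 4 ^ lv (x i)
      set Y : ℝ := 4 ^ lv (y j)
      have hX0 : 0 < X := by positivity
      have hY0 : 0 < Y := by positivity
      refine ⟨?_, ?_, ?_⟩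
      · rw [← hD, div_mul_eq_mul_div, lt_div_iff₀ hY0]
        have h1 : 1 / X < 4 * (1 / Y * D) := by
          calc 1 / X < 4 * |x i| := x4
            _ ≤ 4 * (|y j| * D) := by linarith
            _ ≤ 4 * (1 / Y * D) := by gcongr
        rw [div_lt_iff₀ hX0] at h1
        have h2 : 4 * (1 / Y * D) * X = 4 * (D * X) / Y := by ring
        rw [h2, lt_div_iff₀ hY0] at h1
        linarith
      · rw [← hD, div_mul_eq_mul_div, lt_div_iff₀ hX0]
        have h1 : 1 / Y < 4 * (1 / X * D) := by
          calc 1 / Y < 4 * |y j| := y4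
            _ ≤ 4 * (|x i| * D) := by linarith
            _ ≤ 4 * (1 / X * D) := by gcongr
        rw [div_lt_iff₀ hY0] at h1
        have h2 : 4 * (1 / X * D) * Y = 4 * (D * Y) / X := by ring
        rw [h2, lt_div_iff₀ hX0] at h1
        linarith
      · rw [← hD, lt_div_iff₀ hY0, lt_div_iff₀ hX0, lt_div_iff₀ hD0]
        have h1 : D / n < 1 / X * (1 / Y) := by
          refine hheavy.trans_le ?_
          rw [abs_mul]
          exact mul_le_mul x1 y1 (abs_nonneg _) (by positivity)
        rw [div_mul_div_comm, div_lt_div_iff₀ hn0 (by positivity)] at h1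
        linarith
    have hiI : i ∈ I (lv (x i)) := by simp [hI, hxi]
    have hjJ : j ∈ J (lv (y j)) := by simp [hJ, hyj]
    have hsingle : |x i * y j| * M i j ≤ ∑ s ∈ S, ∑ t ∈ S, (if BalancedLevels n b s t then
          (if i ∈ I s then if j ∈ J t then M i j else 0 else 0) / (4 ^ s * 4 ^ t) else 0) := by
      refine le_trans ?_ (Finset.single_le_sum
        (fun s hs => Finset.sum_nonneg (hnn s hs)) (hSx i))
      refine le_trans ?_ (Finset.single_le_sum (fun t ht => hnn _ (hSx i) t ht) (hSy j))
      simp only [if_pos hG, if_pos hiI, if_pos hjJ]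
      rw [abs_mul, mul_comm _ (M i j), div_eq_mul_one_div, ← one_div_mul_one_div]
      gcongr
    linarith
  have hblock : ∀ s t, ∑ i, ∑ j, (if i ∈ I s then if j ∈ J t then M i j else 0 else 0)
      = blockSum M (I s) (J t) := by
    intro s t
    simp only [blockSum]
    have h1 : ∀ i, ∑ j, (if i ∈ I s then if j ∈ J t then M i j else 0 else 0)
        = if i ∈ I s then ∑ j ∈ J t, M i j else 0 := by
      intro i
      split_ifs
      · simp
      · simp
    simp_rw [h1]
    simp
  have hlevels : ∑ i, ∑ j, ∑ s ∈ S, ∑ t ∈ S, (if BalancedLevels n b s t then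
          (if i ∈ I s then if j ∈ J t then M i j else 0 else 0) / ((4 : ℝ) ^ s * 4 ^ t) else 0)
      = ∑ s ∈ S, ∑ t ∈ S, (if BalancedLevels n b s t then
          blockSum M (I s) (J t) / (4 ^ s * 4 ^ t) else 0) := by
    simp_rw [← hblock, Finset.sum_div]
    rw [Finset.sum_congr rfl fun i _ => Finset.sum_comm, Finset.sum_comm]
    refine Finset.sum_congr rfl fun s _ => ?_
    rw [Finset.sum_congr rfl fun i _ => Finset.sum_comm, Finset.sum_comm]
    refine Finset.sum_congr rfl fun t _ => ?_
    split_ifs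
    · rfl
    · simp
  have hbs : ∀ I J, 0 ≤ blockSum M I J := fun I J =>
    Finset.sum_nonneg fun i _ => Finset.sum_nonneg fun j _ => hM i j
  have h1 := sum_level_blocks_le hn hb hK hdisc S I J hIc hJc
  have h2 := sum_level_blocks_le hn hb hK hdisc.swap S J I hJc hIc
  rw [Finset.sum_comm] at h2
  have hle : ∑ s ∈ S, ∑ t ∈ S, (if BalancedLevels n b s t then
          blockSum M (I s) (J t) / (4 ^ s * 4 ^ t) else 0)
      ≤ 2 * (D * (512 * Real.exp 2 + 512 * K)) := by
    -- One copy of the bound for each ordering of the sizes of the two level sets.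
    rw [two_mul]
    refine le_trans ?_ (add_le_add h1 h2)
    rw [← Finset.sum_add_distrib]
    refine Finset.sum_le_sum fun s _ => ?_
    rw [← Finset.sum_add_distrib]
    refine Finset.sum_le_sum fun t _ => ?_
    rw [blockSum_swap M (J t) (I s), mul_comm ((4 : ℝ) ^ t)]
    have h0 : 0 ≤ blockSum M (I s) (J t) / ((4 : ℝ) ^ s * 4 ^ t) :=
      div_nonneg (hbs _ _) (by positivity)
    by_cases hG : BalancedLevels n b s t
    · rcases le_total (I s).card (J t).card with hc | hc
      · rw [if_pos hG, if_pos ⟨hG, hc⟩]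
        split_ifs <;> linarith
      · rw [if_pos hG, if_pos (⟨hG.swap, hc⟩ : BalancedLevels n b t s ∧ _)]
        split_ifs <;> linarith
    · rw [if_neg hG]
      split_ifs <;> linarith
  have hrows : ∑ i, ∑ j, x i ^ 2 / D * M i j ≤ R / D := by
    calc _ = ∑ i, x i ^ 2 / D * ∑ j, M i j := by simp_rw [Finset.mul_sum]
      _ ≤ ∑ i, x i ^ 2 / D * R := by gcongr with i; exact hrow i
      _ = (∑ i, x i ^ 2) * (R / D) := by
          rw [Finset.sum_mul]; exact Finset.sum_congr rfl fun i _ => by ring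
      _ ≤ 1 * (R / D) := by gcongr
      _ = R / D := one_mul _
  have hcols : ∑ i, ∑ j, y j ^ 2 / D * M i j ≤ R / D := by
    rw [Finset.sum_comm]
    calc _ = ∑ j, y j ^ 2 / D * ∑ i, M i j := by simp_rw [Finset.mul_sum]
      _ ≤ ∑ j, y j ^ 2 / D * R := by gcongr with j; exact hcol j
      _ = (∑ j, y j ^ 2) * (R / D) := by
          rw [Finset.sum_mul]; exact Finset.sum_congr rfl fun i _ => by ring
      _ ≤ 1 * (R / D) := by gcongr
      _ = R / D := one_mul _
  calc _ ≤ ∑ i, ∑ j, (x i ^ 2 / D * M i j + y j ^ 2 / D * M i j +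
        ∑ s ∈ S, ∑ t ∈ S, (if BalancedLevels n b s t then
          (if i ∈ I s then if j ∈ J t then M i j else 0 else 0) / (4 ^ s * 4 ^ t) else 0)) :=
        Finset.sum_le_sum fun i _ => Finset.sum_le_sum fun j _ => hpt i j
    _ ≤ R / D + R / D + 2 * (D * (512 * Real.exp 2 + 512 * K)) := by
        simp_rw [Finset.sum_add_distrib]
        rw [hlevels]
        exact add_le_add (add_le_add hrows hcols) hle
    _ = _ := by ring

/-! ### The spectral norm as a bilinear form, and a finite net of the unit ball -/

/-- The bilinear form of a matrix. -/
def bilin {n : ℕ} (M : Matrix (Fin n) (Fin n) ℝ) (x y : Fin n → ℝ) : ℝ :=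
  ∑ i, ∑ j, x i * y j * M i j

lemma inner_toEuclideanCLM {n : ℕ} (M : Matrix (Fin n) (Fin n) ℝ)
    (x y : EuclideanSpace ℝ (Fin n)) :
    inner ℝ x (Matrix.toEuclideanCLM (n := Fin n) (𝕜 := ℝ) M y) = bilin M x y := by
  rw [PiLp.inner_apply, bilin]
  refine Finset.sum_congr rfl fun i _ => ?_
  have : (Matrix.toEuclideanCLM (n := Fin n) (𝕜 := ℝ) M y) i = ∑ j, M i j * y j := by
    rw [Matrix.ofLp_toEuclideanCLM]; rfl
  rw [this]
  simp only [RCLike.inner_apply, conj_trivial]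
  rw [Finset.sum_mul]
  exact Finset.sum_congr rfl fun j _ => by ring

lemma norm_sq_euclidean {n : ℕ} (x : EuclideanSpace ℝ (Fin n)) : ‖x‖ ^ 2 = ∑ i, x i ^ 2 := by
  rw [EuclideanSpace.norm_sq_eq]
  simp

lemma norm_le_one_iff_sum_sq {n : ℕ} (x : EuclideanSpace ℝ (Fin n)) :
    ‖x‖ ≤ 1 ↔ ∑ i, x i ^ 2 ≤ 1 := by
  rw [← norm_sq_euclidean, sq_le_one_iff₀ (norm_nonneg x)]

lemma specNorm_nonneg {n : ℕ} (M : Matrix (Fin n) (Fin n) ℝ) : 0 ≤ specNorm M := norm_nonneg _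

lemma specNorm_zero {n : ℕ} : specNorm (0 : Matrix (Fin n) (Fin n) ℝ) = 0 := by
  simp [specNorm]

lemma specNorm_add_le {n : ℕ} (M N : Matrix (Fin n) (Fin n) ℝ) :
    specNorm (M + N) ≤ specNorm M + specNorm N := by
  rw [specNorm, map_add]; exact norm_add_le _ _

lemma specNorm_smul {n : ℕ} (a : ℝ) (M : Matrix (Fin n) (Fin n) ℝ) :
    specNorm (a • M) = |a| * specNorm M := by
  rw [specNorm, map_smul, norm_smul, Real.norm_eq_abs, specNorm]

lemma abs_bilin_le {n : ℕ} (M : Matrix (Fin n) (Fin n) ℝ) (x y : EuclideanSpace ℝ (Fin n)) :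
    |bilin M x y| ≤ specNorm M * ‖x‖ * ‖y‖ := by
  rw [← inner_toEuclideanCLM]
  calc _ ≤ ‖x‖ * ‖Matrix.toEuclideanCLM (n := Fin n) (𝕜 := ℝ) M y‖ := abs_real_inner_le_norm _ _
    _ ≤ ‖x‖ * (specNorm M * ‖y‖) := by
        gcongr; exact ContinuousLinearMap.le_opNorm _ _
    _ = _ := by ring

/-- For a unit vector `y`, testing against the normalized image of `y` recovers the norm of that
image. -/
lemma specNorm_le_of_bilin {n : ℕ} {M : Matrix (Fin n) (Fin n) ℝ} {B : ℝ} (hB : 0 ≤ B)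
    (h : ∀ x y : Fin n → ℝ, ∑ i, x i ^ 2 ≤ 1 → ∑ i, y i ^ 2 ≤ 1 → bilin M x y ≤ B) :
    specNorm M ≤ B := by
  refine ContinuousLinearMap.opNorm_le_of_unit_norm hB fun y hy => ?_
  set z := Matrix.toEuclideanCLM (n := Fin n) (𝕜 := ℝ) M y with hz
  rcases eq_or_ne z 0 with h0 | h0
  · rw [h0, norm_zero]; exact hB
  have h1 := h (‖z‖⁻¹ • z : EuclideanSpace ℝ (Fin n)) y
    ((norm_le_one_iff_sum_sq _).1 (by rw [norm_smul, norm_inv, norm_norm,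
      inv_mul_cancel₀ (norm_ne_zero_iff.2 h0)]))
    ((norm_le_one_iff_sum_sq _).1 hy.le)
  rw [← inner_toEuclideanCLM, ← hz, inner_smul_left, real_inner_self_eq_norm_sq] at h1
  simp only [conj_trivial] at h1
  rwa [sq, inv_mul_cancel_left₀ (norm_ne_zero_iff.2 h0)] at h1

lemma specNorm_transpose {n : ℕ} (M : Matrix (Fin n) (Fin n) ℝ) :
    specNorm M.transpose = specNorm M := by
  have key : ∀ N : Matrix (Fin n) (Fin n) ℝ, specNorm N.transpose ≤ specNorm N := by
    intro N
    refine specNorm_le_of_bilin (specNorm_nonneg N) fun x y hx hy => ?_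
    have h1 : bilin N.transpose x y = bilin N y x := by
      rw [bilin, bilin, Finset.sum_comm]
      exact Finset.sum_congr rfl fun i _ => Finset.sum_congr rfl fun j _ => by
        rw [Matrix.transpose_apply]; ring
    have h2 := abs_bilin_le N (WithLp.toLp 2 y) (WithLp.toLp 2 x)
    have hx' : ‖(WithLp.toLp 2 x : EuclideanSpace ℝ (Fin n))‖ ≤ 1 := (norm_le_one_iff_sum_sq _).2 hx
    have hy' : ‖(WithLp.toLp 2 y : EuclideanSpace ℝ (Fin n))‖ ≤ 1 := (norm_le_one_iff_sum_sq _).2 hy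
    rw [h1]
    refine (le_abs_self _).trans (h2.trans ?_)
    rw [mul_assoc]
    exact mul_le_of_le_one_right (specNorm_nonneg N) (mul_le_one₀ hy' (norm_nonneg _) hx')
  refine le_antisymm (key M) ?_
  simpa using key M.transpose

/-- Integer vectors in the ball of radius `4 √n`. -/
noncomputable def latticeBall (n : ℕ) : Finset (Fin n → ℤ) :=
  (Fintype.piFinset fun _ => Finset.Icc (-(16 * n : ℤ)) (16 * n)).filter
    fun a => ∑ i, a i ^ 2 ≤ 16 * n

/-- Point of the `1/4`-net of the unit ball. -/
noncomputable def latticePoint {n : ℕ} (a : Fin n → ℤ) : Fin n → ℝ := fun i => a i / (4 * √n)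

lemma mem_latticeBall {n : ℕ} {a : Fin n → ℤ} :
    a ∈ latticeBall n ↔ ∑ i, a i ^ 2 ≤ 16 * n := by
  rw [latticeBall, Finset.mem_filter, and_iff_right_iff_imp, Fintype.mem_piFinset]
  intro h i
  have h1 : a i ^ 2 ≤ 16 * n :=
    (Finset.single_le_sum (f := fun i => a i ^ 2) (fun _ _ => sq_nonneg _)
      (Finset.mem_univ i)).trans h
  rw [Finset.mem_Icc]
  constructor <;> nlinarith [sq_nonneg (a i - 1), sq_nonneg (a i + 1)]

lemma latticePoint_sum_sq_le {n : ℕ} {a : Fin n → ℤ} (ha : a ∈ latticeBall n) :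
    ∑ i, latticePoint a i ^ 2 ≤ 1 := by
  rw [mem_latticeBall] at ha
  rcases Nat.eq_zero_or_pos n with rfl | hn
  · simp
  have hn0 : (0 : ℝ) < n := by positivity
  have h1 : (∑ i, (a i : ℝ) ^ 2) ≤ 16 * n := by exact_mod_cast ha
  simp only [latticePoint, div_pow, mul_pow, Real.sq_sqrt hn0.le]
  rw [← Finset.sum_div, div_le_one (by positivity)]
  linarith

/-- Rounding towards zero does not increase absolute values, so rounded vectors remain in the ball.
-/
lemma exists_int_toward_zero (y : ℝ) : ∃ k : ℤ, |y - k| ≤ 1 ∧ |(k : ℝ)| ≤ |y| := by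
  rcases le_total 0 y with h | h
  · refine ⟨⌊y⌋, ?_, ?_⟩
    · rw [abs_of_nonneg (by linarith [Int.floor_le y])]; linarith [Int.lt_floor_add_one y]
    · have : (0 : ℝ) ≤ ⌊y⌋ := by exact_mod_cast Int.floor_nonneg.2 h
      rw [abs_of_nonneg this, abs_of_nonneg h]; exact Int.floor_le y
  · refine ⟨⌈y⌉, ?_, ?_⟩
    · rw [abs_of_nonpos (by linarith [Int.le_ceil y])]; linarith [Int.ceil_lt_add_one y]
    · have : (⌈y⌉ : ℝ) ≤ 0 := by
        have : ⌈y⌉ ≤ 0 := Int.ceil_le.2 (by simpa using h)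
        exact_mod_cast this
      rw [abs_of_nonpos this, abs_of_nonpos h]; linarith [Int.le_ceil y]

lemma exists_latticePoint_near {n : ℕ} {x : Fin n → ℝ} (hx : ∑ i, x i ^ 2 ≤ 1) :
    ∃ a ∈ latticeBall n, ∑ i, (x i - latticePoint a i) ^ 2 ≤ (1 / 4) ^ 2 := by
  rcases Nat.eq_zero_or_pos n with rfl | hn
  · exact ⟨0, by simp [mem_latticeBall], by simp⟩
  have hn0 : (0 : ℝ) < n := by positivity
  choose k hk1 hk2 using fun i => exists_int_toward_zero (4 * √n * x i)
  have hss : √(n : ℝ) ^ 2 = n := Real.sq_sqrt hn0.le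
  refine ⟨k, ?_, ?_⟩
  · rw [mem_latticeBall]
    have : (∑ i, (k i : ℝ) ^ 2) ≤ 16 * n := by
      calc (∑ i, (k i : ℝ) ^ 2) ≤ ∑ i, (4 * √n * x i) ^ 2 :=
            Finset.sum_le_sum fun i _ => sq_le_sq.2 (hk2 i)
        _ = 16 * n * ∑ i, x i ^ 2 := by
            rw [Finset.mul_sum]
            exact Finset.sum_congr rfl fun i _ => by rw [mul_pow, mul_pow, hss]; ring
        _ ≤ 16 * n := mul_le_of_le_one_right (by positivity) hx
    exact_mod_cast this
  · have h1 : ∀ i, (x i - latticePoint k i) ^ 2 ≤ 1 / (16 * n) := by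
      intro i
      have e : x i - latticePoint k i = (4 * √n * x i - k i) / (4 * √n) := by
        rw [latticePoint]; field_simp
      rw [e, div_pow, mul_pow, hss]
      rw [show (4 : ℝ) ^ 2 = 16 by norm_num]
      gcongr
      exact (sq_le_one_iff_abs_le_one _).2 (hk1 i)
    calc _ ≤ ∑ i : Fin n, 1 / (16 * (n : ℝ)) := Finset.sum_le_sum fun i _ => h1 i
      _ = (1 / 4) ^ 2 := by
        rw [Finset.sum_const, Finset.card_univ, Fintype.card_fin, nsmul_eq_mul]
        field_simp; norm_num

/-- Replacing both arguments by net points at distance `1/4` changes the form by at most half the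
spectral norm, which is absorbed on the left. -/
lemma specNorm_le_of_latticeBall {n : ℕ} {M : Matrix (Fin n) (Fin n) ℝ} {B : ℝ} (hB : 0 ≤ B)
    (h : ∀ a ∈ latticeBall n, ∀ b ∈ latticeBall n,
      bilin M (latticePoint a) (latticePoint b) ≤ B) : specNorm M ≤ 2 * B := by
  have hN := specNorm_nonneg M
  have key : specNorm M ≤ B + specNorm M / 2 := by
    refine specNorm_le_of_bilin (by positivity) fun x y hx hy => ?_
    obtain ⟨a, ha, hxa⟩ := exists_latticePoint_near hx
    obtain ⟨b, hb, hyb⟩ := exists_latticePoint_near hy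
    have e : bilin M x y = bilin M (latticePoint a) (latticePoint b)
        + bilin M (fun i => x i - latticePoint a i) y
        + bilin M (latticePoint a) (fun i => y i - latticePoint b i) := by
      simp only [bilin, ← Finset.sum_add_distrib]
      exact Finset.sum_congr rfl fun i _ => Finset.sum_congr rfl fun j _ => by ring
    have norm_le : ∀ (z : Fin n → ℝ) (c : ℝ), 0 ≤ c → ∑ i, z i ^ 2 ≤ c ^ 2 →
        ‖(WithLp.toLp 2 z : EuclideanSpace ℝ (Fin n))‖ ≤ c := by
      intro z c hc hz
      refine le_of_sq_le_sq ?_ hc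
      rw [norm_sq_euclidean]; exact hz
    have h1 := abs_bilin_le M (WithLp.toLp 2 fun i => x i - latticePoint a i) (WithLp.toLp 2 y)
    have h2 := abs_bilin_le M (WithLp.toLp 2 (latticePoint a))
      (WithLp.toLp 2 fun i => y i - latticePoint b i)
    have n1 := norm_le (fun i => x i - latticePoint a i) (1 / 4) (by norm_num) hxa
    have n2 := norm_le (fun i => y i - latticePoint b i) (1 / 4) (by norm_num) hyb
    have n3 := norm_le y 1 (by norm_num) (by simpa using hy)
    have n4 := norm_le (latticePoint a) 1 (by norm_num) (by simpa using latticePoint_sum_sq_le ha)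
    have h3 := h a ha b hb
    have h1' : bilin M (fun i => x i - latticePoint a i) y ≤ specNorm M * (1 / 4) * 1 :=
      (le_abs_self _).trans (h1.trans (by gcongr))
    have h2' : bilin M (latticePoint a) (fun i => y i - latticePoint b i)
        ≤ specNorm M * 1 * (1 / 4) :=
      (le_abs_self _).trans (h2.trans (by gcongr))
    rw [e]
    linarith
  linarith

lemma sum_half_pow_natAbs_le (N : ℕ) :
    ∑ k ∈ Finset.Icc (-(N : ℤ)) N, (1 / 2 : ℝ) ^ k.natAbs ≤ 4 := by
  have hg : ∀ s : Finset ℕ, ∑ k ∈ s, (1 / 2 : ℝ) ^ k ≤ 2 := by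
    intro s
    have := summable_geometric_two.sum_le_tsum s (fun i _ => by positivity)
    rwa [tsum_geometric_two] at this
  calc _ ≤ ∑ k ∈ (Finset.range (N + 1)).image (fun m : ℕ => (m : ℤ))
        ∪ (Finset.range (N + 1)).image (fun m : ℕ => -(m : ℤ)), (1 / 2 : ℝ) ^ k.natAbs := by
        refine Finset.sum_le_sum_of_subset_of_nonneg ?_ fun _ _ _ => by positivity
        intro k hk
        rw [Finset.mem_Icc] at hk
        simp only [Finset.mem_union, Finset.mem_image, Finset.mem_range]
        rcases le_total 0 k with h | h
        · exact Or.inl ⟨k.natAbs, by omega, by omega⟩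
        · exact Or.inr ⟨k.natAbs, by omega, by omega⟩
    _ ≤ ∑ k ∈ (Finset.range (N + 1)).image (fun m : ℕ => (m : ℤ)), (1 / 2 : ℝ) ^ k.natAbs
        + ∑ k ∈ (Finset.range (N + 1)).image (fun m : ℕ => -(m : ℤ)), (1 / 2 : ℝ) ^ k.natAbs := by
        rw [← Finset.sum_union_inter]
        exact le_add_of_nonneg_right (Finset.sum_nonneg fun _ _ => by positivity)
    _ ≤ 2 + 2 := by
        rw [Finset.sum_image fun _ _ _ _ h => by simpa using h,
          Finset.sum_image fun _ _ _ _ h => by simpa using h]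
        simp only [Int.natAbs_neg, Int.natAbs_natCast]
        exact add_le_add (hg _) (hg _)
    _ = 4 := by norm_num

/-- On the ball `∑ |a i| ≤ ∑ a i ^ 2 ≤ 16 n`, so every point has weight at least `1` under `2 ^ (16
n) ∏ 2 ^ (-|a i|)`. Summed over the whole box, this weight factorizes into geometric sums. -/
lemma card_latticeBall_le (n : ℕ) : ((latticeBall n).card : ℝ) ≤ Real.exp (18 * n) := by
  calc ((latticeBall n).card : ℝ) = ∑ a ∈ latticeBall n, 1 := by simp
    _ ≤ ∑ a ∈ latticeBall n, 2 ^ (16 * n) * ∏ i, (1 / 2 : ℝ) ^ (a i).natAbs := by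
        refine Finset.sum_le_sum fun a ha => ?_
        rw [mem_latticeBall] at ha
        rw [Finset.prod_pow_eq_pow_sum, one_div_pow, mul_one_div, one_le_div (by positivity)]
        refine pow_le_pow_right₀ (by norm_num) ?_
        have : (∑ i, (a i).natAbs : ℕ) ≤ (∑ i, (a i) ^ 2 : ℤ) := by
          push_cast
          refine Finset.sum_le_sum fun i _ => ?_
          rw [← sq_abs]
          have := abs_nonneg (a i)
          rcases this.eq_or_lt with h | h
          · rw [← h]; norm_num
          · nlinarith
        omega
    _ ≤ ∑ a ∈ Fintype.piFinset fun _ : Fin n => Finset.Icc (-(16 * n : ℤ)) (16 * n),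
          2 ^ (16 * n) * ∏ i, (1 / 2 : ℝ) ^ (a i).natAbs :=
        Finset.sum_le_sum_of_subset_of_nonneg (Finset.filter_subset _ _)
          fun _ _ _ => by positivity
    _ = 2 ^ (16 * n) * ∏ i : Fin n, ∑ k ∈ Finset.Icc (-(16 * n : ℤ)) (16 * n),
          (1 / 2 : ℝ) ^ k.natAbs := by
        rw [← Finset.mul_sum, Finset.prod_univ_sum]
    _ ≤ 2 ^ (16 * n) * ∏ i : Fin n, 4 := by
        gcongr with i
        have := sum_half_pow_natAbs_le (16 * n)
        push_cast at this; exact this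
    _ = 2 ^ (18 * n) := by
        rw [Finset.prod_const, Finset.card_univ, Fintype.card_fin,
          show (4 : ℝ) = 2 ^ 2 by norm_num, ← pow_mul, ← pow_add]
        congr 1; ring
    _ ≤ Real.exp 1 ^ (18 * n) := by
        gcongr; have := Real.exp_one_gt_d9; linarith
    _ = Real.exp (18 * n) := by
        rw [← Real.exp_nat_mul]; push_cast; ring_nf

/-! ### Exponential tails for blocks and for light pairs -/

/-- The exponential tail bound for linear combinations of independent Bernoulli variables. -/
def ChernoffBound {Ω ι : Type*} [MeasurableSpace Ω] [Fintype ι] {n : ℕ} (μ : Measure Ω)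
    (A : ι → Fin n → Fin n → Ω → ℝ) (p : ι → Fin n → Fin n → ℝ) : Prop :=
  ∀ (c : ι → Fin n → Fin n → ℝ) (k : ℝ),
    μ.real {ω | ∑ u, ∑ i, ∑ j, p u i j * (Real.exp (c u i j) - 1) + k
      ≤ ∑ u, ∑ i, ∑ j, c u i j * A u i j ω} ≤ Real.exp (-k)

section ChernoffConsequences

variable {Ω ι : Type*} [MeasurableSpace Ω] [Fintype ι] {n : ℕ} {μ : Measure Ω}
  [IsProbabilityMeasure μ] {A : ι → Fin n → Fin n → Ω → ℝ} {p : ι → Fin n → Fin n → ℝ} {pm : ℝ}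

lemma ChernoffBound.tail_le (h : ChernoffBound μ A p) (c : ι → Fin n → Fin n → ℝ) {V k : ℝ}
    (hV : ∑ u, ∑ i, ∑ j, p u i j * (Real.exp (c u i j) - 1) ≤ V) :
    μ.real {ω | V + k ≤ ∑ u, ∑ i, ∑ j, c u i j * A u i j ω} ≤ Real.exp (-k) :=
  (measureReal_mono fun ω hω => by
    simp only [Set.mem_ofPred_eq] at hω ⊢; linarith).trans (h c k)

lemma ChernoffBound.block_tail_le (h : ChernoffBound μ A p) (hp : ∀ u i j, p u i j ≤ pm)
    (I J : Finset (Fin n)) {φ k : ℝ} (hφ : 0 ≤ φ) :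
    μ.real {ω | Fintype.card ι * pm * I.card * J.card * (Real.exp φ - 1) + k
      ≤ φ * blockSum (fun i j => ∑ u, A u i j ω) I J} ≤ Real.exp (-k) := by
  have hexp : 0 ≤ Real.exp φ - 1 := by linarith [Real.one_le_exp hφ]
  have := h.tail_le (fun _ i j => if i ∈ I then if j ∈ J then φ else 0 else 0)
    (V := Fintype.card ι * pm * I.card * J.card * (Real.exp φ - 1)) (k := k) ?_
  · convert this using 5 with ω
    have : ∀ u, ∑ i, ∑ j, (if i ∈ I then if j ∈ J then φ else 0 else 0) * A u i j ω
        = φ * ∑ i ∈ I, ∑ j ∈ J, A u i j ω := by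
      intro u
      have h1 : ∀ i, ∑ j, (if i ∈ I then if j ∈ J then φ else 0 else 0) * A u i j ω
          = if i ∈ I then φ * ∑ j ∈ J, A u i j ω else 0 := by
        intro i
        split_ifs
        · simp [ite_mul, Finset.mul_sum]
        · simp
      simp_rw [h1]
      simp [Finset.mul_sum]
    simp_rw [this]
    rw [← Finset.mul_sum]
    have h2 : ∑ u, ∑ i ∈ I, ∑ j ∈ J, A u i j ω = ∑ i ∈ I, ∑ j ∈ J, ∑ u, A u i j ω := by
      rw [Finset.sum_comm]
      exact Finset.sum_congr rfl fun i _ => Finset.sum_comm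
    rw [h2, blockSum]
  · have h1 : ∀ u, ∑ i, ∑ j,
        p u i j * (Real.exp (if i ∈ I then if j ∈ J then φ else 0 else 0) - 1)
        ≤ ∑ i ∈ I, ∑ j ∈ J, pm * (Real.exp φ - 1) := by
      intro u
      rw [← Fintype.sum_ite_mem I]
      refine Finset.sum_le_sum fun i _ => ?_
      split_ifs
      · rw [← Fintype.sum_ite_mem J]
        refine Finset.sum_le_sum fun j _ => ?_
        split_ifs
        · exact mul_le_mul_of_nonneg_right (hp u i j) hexp
        · simp
      · simp
    refine (Finset.sum_le_sum fun u _ => h1 u).trans (le_of_eq ?_)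
    simp only [Finset.sum_const, nsmul_eq_mul, Finset.card_univ]
    ring

/-- On light pairs the coefficients can be scaled by `θ` so that the exponents lie in `[-1, 1]`,
where `exp c - 1 ≤ c + c²`. The linear terms are the means; the quadratic ones sum to at most `n`,
which is the `1` in `1 + k / n`. -/
lemma ChernoffBound.light_tail_le (h : ChernoffBound μ A p) (hp0 : ∀ u i j, 0 ≤ p u i j)
    (hp : ∀ u i j, p u i j ≤ pm) {w : ι → ℝ} {W : ℝ} (hW : 0 < W) (hw : ∀ u, |w u| ≤ W)
    (hn : 0 < n) (hb : 0 < Fintype.card ι * pm)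
    {x y : Fin n → ℝ} (hx : ∑ i, x i ^ 2 ≤ 1) (hy : ∑ i, y i ^ 2 ≤ 1) (k : ℝ) :
    μ.real {ω | W * √(n * (Fintype.card ι * pm)) * (1 + k / n) ≤ ∑ i, ∑ j,
        (if √(n * (Fintype.card ι * pm)) / n < |x i * y j| then 0
          else x i * y j * ∑ u, w u * (A u i j ω - p u i j))} ≤ Real.exp (-k) := by
  have hn0 : (0 : ℝ) < n := by positivity
  set D := √(n * (Fintype.card ι * pm)) with hD
  have hD0 : 0 < D := by positivity
  have hDD : D ^ 2 = n * (Fintype.card ι * pm) := Real.sq_sqrt (by positivity)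
  -- This turns the light threshold `D / n` times the weight bound `W` into `1`.
  set θ := n / (W * D) with hθ
  have hθ0 : 0 < θ := by positivity
  set c : ι → Fin n → Fin n → ℝ := fun u i j =>
    if D / n < |x i * y j| then 0 else θ * (x i * y j * w u) with hc
  have hc1 : ∀ u i j, |c u i j| ≤ 1 := by
    intro u i j
    simp only [hc]
    split_ifs with hl
    · simp
    · rw [abs_mul, abs_mul, abs_of_pos hθ0]
      calc θ * (|x i * y j| * |w u|) ≤ θ * (D / n * W) := by
            gcongr
            · exact not_lt.1 hl
            · exact hw u
        _ = 1 := by rw [hθ]; field_simp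
  have hc2 : ∀ u i j, c u i j ^ 2 ≤ θ ^ 2 * W ^ 2 * (x i ^ 2 * y j ^ 2) := by
    intro u i j
    simp only [hc]
    split_ifs with hl
    · rw [zero_pow two_ne_zero]; positivity
    · have : w u ^ 2 ≤ W ^ 2 := sq_le_sq.2 (by rw [abs_of_pos hW]; exact hw u)
      calc (θ * (x i * y j * w u)) ^ 2 = θ ^ 2 * w u ^ 2 * (x i ^ 2 * y j ^ 2) := by ring
        _ ≤ _ := by gcongr
  have hpm : ∀ u i j, p u i j * (Real.exp (c u i j) - 1)
      ≤ p u i j * c u i j + pm * (θ ^ 2 * W ^ 2 * (x i ^ 2 * y j ^ 2)) := by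
    intro u i j
    have h1 := (abs_le.1 (Real.abs_exp_sub_one_sub_id_le (hc1 u i j))).2
    calc p u i j * (Real.exp (c u i j) - 1) ≤ p u i j * (c u i j + c u i j ^ 2) := by
          apply mul_le_mul_of_nonneg_left _ (hp0 u i j); linarith
      _ = p u i j * c u i j + p u i j * c u i j ^ 2 := by ring
      _ ≤ _ := by
          gcongr
          · exact (hp0 u i j).trans (hp u i j)
          · exact hp u i j
          · exact hc2 u i j
  have hxy : ∑ i, ∑ j, x i ^ 2 * y j ^ 2 ≤ 1 := by
    rw [← Finset.sum_mul_sum]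
    exact mul_le_one₀ hx (Finset.sum_nonneg fun _ _ => sq_nonneg _) hy
  have hV : ∑ u, ∑ i, ∑ j, p u i j * (Real.exp (c u i j) - 1)
      ≤ ∑ u, ∑ i, ∑ j, p u i j * c u i j + n := by
    calc _ ≤ ∑ u, ∑ i, ∑ j,
          (p u i j * c u i j + pm * (θ ^ 2 * W ^ 2 * (x i ^ 2 * y j ^ 2))) :=
          Finset.sum_le_sum fun u _ => Finset.sum_le_sum fun i _ =>
            Finset.sum_le_sum fun j _ => hpm u i j
      _ = ∑ u, ∑ i, ∑ j, p u i j * c u i j +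
          Fintype.card ι * pm * (θ ^ 2 * W ^ 2) * ∑ i, ∑ j, x i ^ 2 * y j ^ 2 := by
          simp_rw [Finset.sum_add_distrib, ← Finset.mul_sum]
          rw [Finset.sum_const, nsmul_eq_mul, Finset.card_univ]
          ring
      _ ≤ ∑ u, ∑ i, ∑ j, p u i j * c u i j + Fintype.card ι * pm * (θ ^ 2 * W ^ 2) := by
          exact add_le_add le_rfl (mul_le_of_le_one_right (by positivity) hxy)
      _ = _ := by
          congr 1
          have : (Fintype.card ι : ℝ) * pm = D ^ 2 / n := by rw [hDD]; field_simp
          rw [this, hθ]; field_simp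
  refine (measureReal_mono fun ω hω => ?_).trans (h.tail_le c (k := k) hV)
  simp only [Set.mem_ofPred_eq] at hω ⊢
  have e : ∑ u, ∑ i, ∑ j, c u i j * A u i j ω - ∑ u, ∑ i, ∑ j, p u i j * c u i j
      = θ * ∑ i, ∑ j, (if D / n < |x i * y j| then 0
          else x i * y j * ∑ u, w u * (A u i j ω - p u i j)) := by
    rw [← Finset.sum_sub_distrib, Finset.mul_sum]
    simp_rw [← Finset.sum_sub_distrib, Finset.mul_sum]
    rw [Finset.sum_comm]
    refine Finset.sum_congr rfl fun i _ => ?_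
    rw [Finset.sum_comm]
    refine Finset.sum_congr rfl fun j _ => ?_
    simp only [hc]
    split_ifs
    · simp
    · rw [Finset.mul_sum]
      exact Finset.sum_congr rfl fun u _ => by ring
  have h2 := mul_le_mul_of_nonneg_left hω hθ0.le
  rw [← e] at h2
  have h3 : θ * (W * D * (1 + k / n)) = n + k := by rw [hθ]; field_simp
  linarith

end ChernoffConsequences

/-! ### Entropy, union bounds and spectral concentration -/

/-- Passing from `a` to `m` costs `a log (m / a) ≤ m - a`, which the linear term of the entropy
gains. -/
lemma choiceEntropy_mono {n a m : ℕ} (ha : 1 ≤ a) (ham : a ≤ m) (hmn : m ≤ n) :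
    choiceEntropy n a ≤ choiceEntropy n m := by
  have ha0 : (0 : ℝ) < a := by positivity
  have hm0 : (0 : ℝ) < m := by have : 0 < m := by omega
                               positivity
  have hn0 : (0 : ℝ) < n := by have : 0 < n := by omega
                               positivity
  have h1 : (n : ℝ) / a = n / m * (m / a) := by field_simp
  have h2 : 0 ≤ Real.log (n / m) := Real.log_nonneg (by
    rw [one_le_div hm0]; exact_mod_cast hmn)
  have h3 : Real.log (m / a) ≤ m / a - 1 := Real.log_le_sub_one_of_pos (by positivity)
  have h4 : (a : ℝ) ≤ m := by exact_mod_cast ham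
  rw [choiceEntropy, choiceEntropy, h1, Real.log_mul (by positivity) (by positivity)]
  have h5 : a * Real.log (m / a) ≤ m - a := by
    calc a * Real.log (m / a) ≤ a * (m / a - 1) := by gcongr
      _ = m - a := by field_simp
  nlinarith [mul_le_mul_of_nonneg_right h4 h2]

lemma log_le_choiceEntropy {n m : ℕ} (hm : 1 ≤ m) (hmn : m ≤ n) :
    Real.log n ≤ choiceEntropy n m := by
  refine le_trans ?_ (choiceEntropy_mono le_rfl hm hmn)
  simp [choiceEntropy]

lemma choose_le_exp_choiceEntropy {n a : ℕ} (ha : 1 ≤ a) (han : a ≤ n) :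
    (n.choose a : ℝ) ≤ Real.exp (choiceEntropy n a) := by
  have ha0 : (0 : ℝ) < a := by positivity
  have hn0 : (0 : ℝ) < n := by have : 0 < n := by omega
                               positivity
  calc (n.choose a : ℝ) ≤ n ^ a / a.factorial := Nat.choose_le_pow_div a n
    _ = (n / a) ^ a * (a ^ a / a.factorial) := by rw [div_pow]; field_simp
    _ ≤ (n / a) ^ a * Real.exp a := by
        gcongr
        exact Real.pow_div_factorial_le_exp _ ha0.le _
    _ = Real.exp (choiceEntropy n a) := by
        rw [choiceEntropy, mul_add, mul_one, Real.exp_add, mul_comm]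
        congr 1
        rw [← Real.log_pow, Real.exp_log (by positivity)]

/-- Grouping the sets by size, one unit of `K` pays for the number of sets of that size; what
remains is bounded using that the entropy is at least `log n` at every size. -/
lemma sum_exp_neg_choiceEntropy_le {n : ℕ} {K : ℝ} (hK : 1 ≤ K) :
    ∑ I : Finset (Fin n) with I.Nonempty, Real.exp (-(K * choiceEntropy n I.card))
      ≤ n * Real.exp (-((K - 1) * Real.log n)) := by
  calc ∑ I : Finset (Fin n) with I.Nonempty, Real.exp (-(K * choiceEntropy n I.card))
      = ∑ a ∈ Finset.Icc 1 n, ∑ I ∈ Finset.univ.filter (fun I : Finset (Fin n) => I.Nonempty) with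
          I.card = a, Real.exp (-(K * choiceEntropy n I.card)) := by
        rw [Finset.sum_fiberwise_of_maps_to]
        intro I hI
        rw [Finset.mem_Icc]
        exact ⟨Finset.card_pos.2 (Finset.mem_filter.1 hI).2,
          (Finset.card_le_univ I).trans (by simp)⟩
    _ ≤ ∑ a ∈ Finset.Icc 1 n, Real.exp (-((K - 1) * Real.log n)) := by
        refine Finset.sum_le_sum fun a ha => ?_
        obtain ⟨ha1, han⟩ := Finset.mem_Icc.1 ha
        calc _ = ∑ I ∈ Finset.univ.filter (fun I : Finset (Fin n) => I.Nonempty) with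
                I.card = a, Real.exp (-(K * choiceEntropy n a)) :=
              Finset.sum_congr rfl fun I hI => by rw [(Finset.mem_filter.1 hI).2]
          _ ≤ ∑ I ∈ Finset.powersetCard a (Finset.univ : Finset (Fin n)),
                Real.exp (-(K * choiceEntropy n a)) := by
              refine Finset.sum_le_sum_of_subset_of_nonneg ?_ fun _ _ _ => (Real.exp_pos _).le
              intro I hI
              rw [Finset.mem_powersetCard]
              exact ⟨Finset.subset_univ _, (Finset.mem_filter.1 hI).2⟩
          _ = n.choose a * Real.exp (-(K * choiceEntropy n a)) := by
              rw [Finset.sum_const, Finset.card_powersetCard, nsmul_eq_mul]; simp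
          _ ≤ Real.exp (choiceEntropy n a) * Real.exp (-(K * choiceEntropy n a)) := by
              gcongr; exact choose_le_exp_choiceEntropy ha1 han
          _ = Real.exp (-((K - 1) * choiceEntropy n a)) := by
              rw [← Real.exp_add]; ring_nf
          _ ≤ _ := by
              apply Real.exp_le_exp.2
              have := mul_le_mul_of_nonneg_left (log_le_choiceEntropy ha1 han)
                (by linarith : 0 ≤ K - 1)
              linarith
    _ = _ := by simp

/-- A weighted sum of centered matrices is bounded by the heavy/light decomposition. -/
lemma specNorm_centered_le {Ω ι : Type*} [Fintype ι] {n : ℕ} (hn : 2 ≤ n) {pm W Rr K ρ : ℝ}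
    (hb : 0 < Fintype.card ι * pm) (hW : 0 < W) (hK : 0 ≤ K) (hRr : 0 ≤ Rr) (hρ : 0 ≤ ρ)
    {A : ι → Fin n → Fin n → Ω → ℝ} {p : ι → Fin n → Fin n → ℝ} {w : ι → ℝ} {ω : Ω}
    (hA : ∀ u i j, 0 ≤ A u i j ω) (hp0 : ∀ u i j, 0 ≤ p u i j) (hp : ∀ u i j, p u i j ≤ pm)
    (hw : ∀ u, |w u| ≤ W)
    (hdisc : Discrepancy (Fintype.card ι * pm) K fun i j => ∑ u, A u i j ω)
    (hrow : ∀ i, ∑ j, ∑ u, A u i j ω ≤ Rr * (n * (Fintype.card ι * pm)))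
    (hcol : ∀ j, ∑ i, ∑ u, A u i j ω ≤ Rr * (n * (Fintype.card ι * pm)))
    (hlight : ∀ a ∈ latticeBall n, ∀ b ∈ latticeBall n, ∑ i, ∑ j,
        (if √(n * (Fintype.card ι * pm)) / n < |latticePoint a i * latticePoint b j| then 0
          else latticePoint a i * latticePoint b j * ∑ u, w u * (A u i j ω - p u i j))
        ≤ ρ * √(n * (Fintype.card ι * pm))) :
    specNorm (Matrix.of fun i j => ∑ u, w u * (A u i j ω - p u i j))
      ≤ 2 * (ρ + W * (2 * Rr + 2 * (512 * Real.exp 2 + 512 * K) + 1))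
        * √(n * (Fintype.card ι * pm)) := by
  have hn0 : (0 : ℝ) < n := by positivity
  set b := Fintype.card ι * pm with hbdef
  set D := √(n * b) with hD
  have hD0 : 0 < D := by positivity
  have hDD : D ^ 2 = n * b := Real.sq_sqrt (by positivity)
  rw [mul_assoc]
  refine specNorm_le_of_latticeBall (by positivity) fun a ha a' ha' => ?_
  have hx := latticePoint_sum_sq_le ha
  have hy := latticePoint_sum_sq_le ha'
  have hl := hlight a ha a' ha'
  set x := latticePoint a
  set y := latticePoint a'
  set M : Fin n → Fin n → ℝ := fun i j => ∑ u, A u i j ω with hM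
  have hM0 : ∀ i j, 0 ≤ M i j := fun i j => Finset.sum_nonneg fun u _ => hA u i j
  have hheavy := sum_heavy_le hn hb hK hM0 hdisc hrow hcol hx hy
  have hpt : ∀ i j, x i * y j * ∑ u, w u * (A u i j ω - p u i j)
      ≤ (if D / n < |x i * y j| then 0 else x i * y j * ∑ u, w u * (A u i j ω - p u i j))
        + W * (if D / n < |x i * y j| then |x i * y j| * M i j else 0)
        + W * D * (x i ^ 2 * y j ^ 2) := by
    intro i j
    split_ifs with h
    · have h1 : |∑ u, w u * (A u i j ω - p u i j)| ≤ W * M i j + W * b := by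
        calc _ ≤ ∑ u, |w u * (A u i j ω - p u i j)| := Finset.abs_sum_le_sum_abs _ _
          _ ≤ ∑ u, W * (A u i j ω + pm) := by
              refine Finset.sum_le_sum fun u _ => ?_
              rw [abs_mul]
              have := hA u i j; have := hp0 u i j; have := hp u i j
              have h2 : |A u i j ω - p u i j| ≤ A u i j ω + pm := by
                rw [abs_le]; constructor <;> linarith
              exact mul_le_mul (hw u) h2 (abs_nonneg _) hW.le
          _ = _ := by
              rw [← Finset.mul_sum, Finset.sum_add_distrib, Finset.sum_const, nsmul_eq_mul,
                Finset.card_univ, hM, hbdef]; ring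
      -- The means on heavy pairs: `b = (D / n) * D` and `D / n < |x i * y j|` there.
      have h3 : |x i * y j| * b ≤ D * (x i ^ 2 * y j ^ 2) := by
        have e : D * (x i ^ 2 * y j ^ 2) = |x i * y j| * (|x i * y j| * D) := by
          rw [← mul_pow, ← sq_abs]; ring
        rw [e]
        gcongr
        calc b = D / n * D := by
              rw [div_mul_eq_mul_div, ← sq, hDD]; field_simp
          _ ≤ _ := by gcongr
      calc x i * y j * ∑ u, w u * (A u i j ω - p u i j)
          ≤ |x i * y j| * |∑ u, w u * (A u i j ω - p u i j)| := by
            rw [← abs_mul]; exact le_abs_self _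
        _ ≤ |x i * y j| * (W * M i j + W * b) := by gcongr
        _ = W * (|x i * y j| * M i j) + W * (|x i * y j| * b) := by ring
        _ ≤ W * (|x i * y j| * M i j) + W * (D * (x i ^ 2 * y j ^ 2)) := by gcongr
        _ = _ := by ring
    · have : 0 ≤ W * D * (x i ^ 2 * y j ^ 2) := by positivity
      linarith
  have hxy : ∑ i, ∑ j, x i ^ 2 * y j ^ 2 ≤ 1 := by
    rw [← Finset.sum_mul_sum]
    exact mul_le_one₀ hx (Finset.sum_nonneg fun _ _ => sq_nonneg _) hy
  have hR : 2 * (Rr * (n * b)) / D = 2 * Rr * D := by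
    rw [← hDD]; field_simp
  rw [hR] at hheavy
  calc bilin _ x y ≤ ∑ i, ∑ j,
        ((if D / n < |x i * y j| then 0 else x i * y j * ∑ u, w u * (A u i j ω - p u i j))
        + W * (if D / n < |x i * y j| then |x i * y j| * M i j else 0)
        + W * D * (x i ^ 2 * y j ^ 2)) :=
        Finset.sum_le_sum fun i _ => Finset.sum_le_sum fun j _ => hpt i j
    _ = ∑ i, ∑ j,
        (if D / n < |x i * y j| then 0 else x i * y j * ∑ u, w u * (A u i j ω - p u i j))
        + W * (∑ i, ∑ j, if D / n < |x i * y j| then |x i * y j| * M i j else 0)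
        + W * D * ∑ i, ∑ j, (x i ^ 2 * y j ^ 2) := by
        simp_rw [Finset.sum_add_distrib, ← Finset.mul_sum]
    _ ≤ ρ * D + W * (2 * Rr * D + 2 * (D * (512 * Real.exp 2 + 512 * K))) + W * D * 1 := by
        gcongr
    _ = _ := by ring

/-- Union bound over `I`, `J` and the integers `φ`. The entropy of the larger size dominates the
mean of the two entropies, so the exponential bound factorizes over `I` and `J`. -/
lemma discrepancy_failure_le {Ω ι : Type*} [MeasurableSpace Ω] [Fintype ι] {n : ℕ}
    {μ : Measure Ω} [IsProbabilityMeasure μ] (hn : 2 ≤ n) {A : ι → Fin n → Fin n → Ω → ℝ}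
    {p : ι → Fin n → Fin n → ℝ} {pm τ : ℝ} (h : ChernoffBound μ A p) (hpm : 0 ≤ pm)
    (hp : ∀ u i j, p u i j ≤ pm) (hτ : 0 < τ) :
    μ.real {ω | ¬ Discrepancy (Fintype.card ι * pm) (τ + 10) fun i j => ∑ u, A u i j ω}
      ≤ (n : ℝ) ^ (-τ) := by
  set K := τ + 10 with hK
  set b := Fintype.card ι * pm with hb
  have hn0 : (0 : ℝ) < n := by positivity
  set NE := Finset.univ.filter (fun I : Finset (Fin n) => I.Nonempty) with hNE
  set κ : Finset (Fin n) → ℝ := fun I => choiceEntropy n I.card with hκ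
  have hcard : ∀ I ∈ NE, 1 ≤ I.card ∧ I.card ≤ n := fun I hI =>
    ⟨Finset.card_pos.2 (Finset.mem_filter.1 hI).2, (Finset.card_le_univ I).trans (by simp)⟩
  have hblock : ∀ I ∈ NE, ∀ J ∈ NE, ∀ φ : ℕ,
      μ.real {ω | b * I.card * J.card * (Real.exp φ - 1) + K * choiceEntropy n (max I.card J.card)
        ≤ φ * blockSum (fun i j => ∑ u, A u i j ω) I J}
      ≤ Real.exp (-(K / 2 * κ I)) * Real.exp (-(K / 2 * κ J)) := by
    intro I hI J hJ φ
    refine (h.block_tail_le hp I J (Nat.cast_nonneg φ)).trans ?_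
    rw [← Real.exp_add]
    apply Real.exp_le_exp.2
    have h1 := choiceEntropy_mono (hcard I hI).1 (le_max_left I.card J.card)
      (max_le (hcard I hI).2 (hcard J hJ).2)
    have h2 := choiceEntropy_mono (hcard J hJ).1 (le_max_right I.card J.card)
      (max_le (hcard I hI).2 (hcard J hJ).2)
    have h3 := mul_le_mul_of_nonneg_left h1 (by linarith : 0 ≤ K / 2)
    have h4 := mul_le_mul_of_nonneg_left h2 (by linarith : 0 ≤ K / 2)
    simp only [hκ]
    linarith
  calc μ.real {ω | ¬ Discrepancy b K fun i j => ∑ u, A u i j ω}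
      ≤ μ.real (⋃ I ∈ NE, ⋃ J ∈ NE, ⋃ φ ∈ Finset.range (8 * n + 1),
          {ω | b * I.card * J.card * (Real.exp φ - 1) + K * choiceEntropy n (max I.card J.card)
            ≤ φ * blockSum (fun i j => ∑ u, A u i j ω) I J}) := by
        refine measureReal_mono (fun ω hω => ?_) (measure_ne_top _ _)
        simp only [Set.mem_ofPred_eq, Discrepancy] at hω
        push Not at hω
        obtain ⟨I, J, hI, hJ, φ, h1, h2, h3⟩ := hω
        simp only [Set.mem_iUnion]
        refine ⟨I, by simpa [hNE] using hI, J, by simpa [hNE] using hJ, φ,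
          Finset.mem_range.2 (by omega), ?_⟩
        have : 0 ≤ b * I.card * J.card := by positivity
        simp only [Set.mem_ofPred_eq]
        linarith
    _ ≤ ∑ I ∈ NE, ∑ J ∈ NE, ∑ φ ∈ Finset.range (8 * n + 1),
          Real.exp (-(K / 2 * κ I)) * Real.exp (-(K / 2 * κ J)) := by
        refine (measureReal_biUnion_finset_le _ _).trans (Finset.sum_le_sum fun I hI => ?_)
        refine (measureReal_biUnion_finset_le _ _).trans (Finset.sum_le_sum fun J hJ => ?_)
        exact (measureReal_biUnion_finset_le _ _).trans
          (Finset.sum_le_sum fun φ _ => hblock I hI J hJ φ)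
    _ = (8 * n + 1) * (∑ I ∈ NE, Real.exp (-(K / 2 * κ I))) ^ 2 := by
        simp_rw [Finset.sum_const, Finset.card_range, nsmul_eq_mul]
        simp_rw [← Finset.mul_sum, ← Finset.sum_mul, sq]
        push_cast; ring
    _ ≤ (8 * n + 1) * (n * Real.exp (-((K / 2 - 1) * Real.log n))) ^ 2 := by
        gcongr
        exact sum_exp_neg_choiceEntropy_le (by linarith)
    -- With `K = τ + 10` the square equals `n ^ (-τ - 6)`, and `n ≥ 2` gives `8 n + 1 ≤ n ^ 5`.
    _ ≤ (n : ℝ) ^ (-τ) := by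
        have h2 : (2 : ℝ) ≤ n := by exact_mod_cast hn
        have h9 : (8 * n + 1 : ℝ) ≤ n ^ 5 := by
          have : (2 : ℝ) ^ 4 ≤ n ^ 4 := by gcongr
          nlinarith
        have e : (n * Real.exp (-((K / 2 - 1) * Real.log n))) ^ 2 = n ^ (-τ) / n ^ 6 := by
          rw [show -((K / 2 - 1) * Real.log n) = Real.log n * (-(K / 2 - 1)) by ring,
            ← Real.rpow_def_of_pos hn0, mul_pow, ← Real.rpow_mul_natCast hn0.le,
            eq_div_iff (by positivity), ← Real.rpow_natCast, ← Real.rpow_natCast,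
            ← Real.rpow_add hn0, ← Real.rpow_add hn0]
          congr 1
          rw [hK]; push_cast; ring
        rw [e, mul_div_assoc', div_le_iff₀ (by positivity), mul_comm]
        have h3 : (0 : ℝ) ≤ n ^ (-τ) := by positivity
        have h6 : (n : ℝ) ^ 5 ≤ n ^ 6 := pow_le_pow_right₀ (by linarith) (by norm_num)
        exact mul_le_mul_of_nonneg_left (h9.trans h6) h3

lemma exp_neg_mul_log {n : ℕ} (hn : 0 < n) (τ : ℝ) :
    Real.exp (-(τ * Real.log n)) = (n : ℝ) ^ (-τ) := by
  rw [Real.rpow_def_of_pos (by positivity)]; ring_nf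

/-- Spectral concentration of weighted sums of sparse matrices with independent entries. -/
theorem exists_specNorm_centered_tail (τ c W : ℝ) (hτ : 0 < τ) (hc : 0 < c) (hW : 0 < W) :
    ∃ C : ℝ, 0 < C ∧ ∀ {Ω ι : Type*} [MeasurableSpace Ω] [Fintype ι] (μ : Measure Ω)
      [IsProbabilityMeasure μ] (n : ℕ) (A : ι → Fin n → Fin n → Ω → ℝ)
      (p : ι → Fin n → Fin n → ℝ) (w : ι → ℝ) (pm : ℝ),
      2 ≤ n → (∀ u i j ω, 0 ≤ A u i j ω) → (∀ u i j, 0 ≤ p u i j) → (∀ u i j, p u i j ≤ pm) →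
      (∀ u, |w u| ≤ W) → 0 ≤ pm → c * Real.log n ≤ n * (Fintype.card ι * pm) →
      ChernoffBound μ A p →
      μ.real {ω | C * √(n * (Fintype.card ι * pm))
        < specNorm (Matrix.of fun i j => ∑ u, w u * (A u i j ω - p u i j))}
        ≤ 4 * (n : ℝ) ^ (-τ) := by
  -- The `2` bounds `exp 1 - 1`, for degrees tested at parameter `1`. The fraction pays for the
  -- deviation `(τ + 1) log n`, because `c log n ≤ n b`; the extra `1` covers the union over rows or
  -- columns.
  set Rr := 2 + (τ + 1) / c with hRr
  -- `36 = 2 · 18` outweighs two copies of the net; the remaining `1` is the quadratic term of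
  -- `ChernoffBound.light_tail_le`.
  set ρ := W * (37 + τ) with hρ
  refine ⟨2 * (ρ + W * (2 * Rr + 2 * (512 * Real.exp 2 + 512 * (τ + 10)) + 1)),
    by positivity, ?_⟩
  intro Ω ι _ _ μ _ n A p w pm hn hA hp0 hp hw hpm hd hch
  have hn0 : (0 : ℝ) < n := by positivity
  have hn1 : (1 : ℝ) < n := by exact_mod_cast (by omega : 1 < n)
  have hlog := Real.log_pos hn1
  set b := Fintype.card ι * pm with hbdef
  have hb : 0 < b := by
    have : 0 < n * b := lt_of_lt_of_le (by positivity) hd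
    exact pos_of_mul_pos_right this hn0.le
  set D := √(n * b) with hD
  have hexp2 : Real.exp 1 - 1 ≤ 2 := by have := Real.exp_one_lt_d9; linarith
  have hdeg : ∀ I J : Finset (Fin n), (I.card : ℝ) * J.card ≤ n →
      b * I.card * J.card * (Real.exp (1 : ℝ) - 1) + (τ + 1) * Real.log n ≤ Rr * (n * b) := by
    intro I J hIJ
    have h1 : (τ + 1) * Real.log n ≤ (τ + 1) / c * (n * b) := by
      calc (τ + 1) * Real.log n = (τ + 1) / c * (c * Real.log n) := by field_simp
        _ ≤ _ := by gcongr
    have h2 : b * I.card * J.card * (Real.exp (1 : ℝ) - 1) ≤ b * n * 2 := by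
      rw [mul_assoc b]
      have : 0 ≤ Real.exp 1 - 1 := by linarith [Real.one_le_exp (zero_le_one (α := ℝ))]
      gcongr
    rw [hRr]; linarith
  have hexpn : Real.exp (-((τ + 1) * Real.log n)) * n = (n : ℝ) ^ (-τ) := by
    rw [exp_neg_mul_log (by omega)]
    nth_rewrite 2 [← Real.rpow_one (n : ℝ)]
    rw [← Real.rpow_add hn0]; ring_nf
  set E₁ := ⋃ i ∈ (Finset.univ : Finset (Fin n)), {ω | Rr * (n * b) ≤ ∑ j, ∑ u, A u i j ω} with hE₁
  set E₂ := ⋃ j ∈ (Finset.univ : Finset (Fin n)), {ω | Rr * (n * b) ≤ ∑ i, ∑ u, A u i j ω} with hE₂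
  set E₃ := {ω | ¬ Discrepancy b (τ + 10) fun i j => ∑ u, A u i j ω} with hE₃
  set E₄ := ⋃ a ∈ latticeBall n, ⋃ a' ∈ latticeBall n, {ω | ρ * D ≤ ∑ i, ∑ j,
        (if D / n < |latticePoint a i * latticePoint a' j| then 0
          else latticePoint a i * latticePoint a' j * ∑ u, w u * (A u i j ω - p u i j))} with hE₄
  have h₁ : μ.real E₁ ≤ (n : ℝ) ^ (-τ) := by
    calc μ.real E₁ ≤ ∑ i : Fin n, Real.exp (-((τ + 1) * Real.log n)) := by
          refine (measureReal_biUnion_finset_le _ _).trans (Finset.sum_le_sum fun i _ => ?_)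
          refine (measureReal_mono fun ω hω => ?_).trans (hch.block_tail_le hp {i} Finset.univ
            (φ := 1) (k := (τ + 1) * Real.log n) zero_le_one)
          simp only [Set.mem_ofPred_eq] at hω ⊢
          refine (hdeg _ _ (by simp)).trans (hω.trans (le_of_eq ?_))
          simp [blockSum]
      _ = (n : ℝ) ^ (-τ) := by
          rw [Finset.sum_const, Finset.card_univ, Fintype.card_fin, nsmul_eq_mul, mul_comm, hexpn]
  have h₂ : μ.real E₂ ≤ (n : ℝ) ^ (-τ) := by
    calc μ.real E₂ ≤ ∑ i : Fin n, Real.exp (-((τ + 1) * Real.log n)) := by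
          refine (measureReal_biUnion_finset_le _ _).trans (Finset.sum_le_sum fun i _ => ?_)
          refine (measureReal_mono fun ω hω => ?_).trans (hch.block_tail_le hp Finset.univ {i}
            (φ := 1) (k := (τ + 1) * Real.log n) zero_le_one)
          simp only [Set.mem_ofPred_eq] at hω ⊢
          refine (hdeg _ _ (by simp)).trans (hω.trans (le_of_eq ?_))
          simp [blockSum]
      _ = (n : ℝ) ^ (-τ) := by
          rw [Finset.sum_const, Finset.card_univ, Fintype.card_fin, nsmul_eq_mul, mul_comm, hexpn]
  have h₃ : μ.real E₃ ≤ (n : ℝ) ^ (-τ) := discrepancy_failure_le hn hch hpm hp hτ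
  have h₄ : μ.real E₄ ≤ (n : ℝ) ^ (-τ) := by
    calc μ.real E₄ ≤ ∑ a ∈ latticeBall n, ∑ a' ∈ latticeBall n,
          Real.exp (-((36 + τ) * n)) := by
          refine (measureReal_biUnion_finset_le _ _).trans (Finset.sum_le_sum fun a ha => ?_)
          refine (measureReal_biUnion_finset_le _ _).trans (Finset.sum_le_sum fun a' ha' => ?_)
          refine (measureReal_mono fun ω hω => ?_).trans (hch.light_tail_le hp0 hp hW hw
            (by omega) hb (latticePoint_sum_sq_le ha) (latticePoint_sum_sq_le ha') ((36 + τ) * n))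
          simp only [Set.mem_ofPred_eq] at hω ⊢
          refine le_trans (le_of_eq ?_) hω
          rw [mul_div_assoc, div_self hn0.ne', hρ]; ring
      _ = (latticeBall n).card * ((latticeBall n).card * Real.exp (-((36 + τ) * n))) := by
          simp_rw [Finset.sum_const, nsmul_eq_mul]
      _ ≤ Real.exp (18 * n) * (Real.exp (18 * n) * Real.exp (-((36 + τ) * n))) := by
          gcongr <;> exact card_latticeBall_le n
      _ = Real.exp (-(τ * n)) := by
          rw [← Real.exp_add, ← Real.exp_add]; ring_nf
      _ ≤ Real.exp (-(τ * Real.log n)) := by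
          apply Real.exp_le_exp.2
          have := Real.log_le_sub_one_of_pos hn0
          have := mul_le_mul_of_nonneg_left (by linarith : Real.log n ≤ n) hτ.le
          linarith
      _ = _ := exp_neg_mul_log (by omega) τ
  calc _ ≤ μ.real (E₁ ∪ E₂ ∪ E₃ ∪ E₄) := by
        refine measureReal_mono (fun ω hω => ?_) (measure_ne_top _ _)
        by_contra hcon
        simp only [Set.mem_union, not_or] at hcon
        obtain ⟨⟨⟨g₁, g₂⟩, g₃⟩, g₄⟩ := hcon
        simp only [hE₁, hE₂, hE₄, Set.mem_iUnion, Set.mem_ofPred_eq, not_exists, not_le] at g₁ g₂ g₄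
        simp only [hE₃, Set.mem_ofPred_eq, not_not] at g₃
        simp only [Set.mem_ofPred_eq] at hω
        refine absurd hω (not_lt.2 ?_)
        exact specNorm_centered_le hn hb hW (by linarith) (by positivity) (by positivity)
          (fun u i j => hA u i j ω) hp0 hp hw g₃
          (fun i => (g₁ i (Finset.mem_univ i)).le) (fun j => (g₂ j (Finset.mem_univ j)).le)
          (fun a ha a' ha' => (g₄ a ha a' ha').le)
    _ ≤ μ.real E₁ + μ.real E₂ + μ.real E₃ + μ.real E₄ := by
        refine (measureReal_union_le _ _).trans (add_le_add ?_ le_rfl)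
        refine (measureReal_union_le _ _).trans (add_le_add ?_ le_rfl)
        exact measureReal_union_le _ _
    _ ≤ _ := by linarith

/-! ### The Chernoff bound for independent Bernoulli entries -/

lemma integral_exp_bernoulli {Ω : Type*} [MeasurableSpace Ω] {μ : Measure Ω}
    [IsProbabilityMeasure μ] {X : Ω → ℝ} (hX : Measurable X) (h01 : ∀ ω, X ω = 0 ∨ X ω = 1)
    (c : ℝ) : ∫ ω, Real.exp (c * X ω) ∂μ = 1 + μ.real {ω | X ω = 1} * (Real.exp c - 1) := by
  have hset : MeasurableSet {ω | X ω = 1} := hX (measurableSet_singleton 1)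
  have h1 : ∀ ω, Real.exp (c * X ω)
      = 1 + Set.indicator {ω | X ω = 1} (fun _ => Real.exp c - 1) ω := by
    intro ω
    by_cases h : X ω = 1
    · rw [Set.indicator_of_mem (by exact h), h]; simp
    · rw [Set.indicator_of_notMem (by exact h), (h01 ω).resolve_right h]; simp
  simp_rw [h1]
  rw [integral_add (integrable_const _) ((integrable_const _).indicator hset),
    integral_indicator_const _ hset]
  simp

/-- By independence the moment generating function at `1` is a product of factors `1 + p (exp c - 1)
≤ exp (p (exp c - 1))`; Markov's inequality concludes. -/
lemma measureReal_exp_tail_le_of_iIndepFun {Ω κ : Type*} [MeasurableSpace Ω] {μ : Measure Ω}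
    [IsProbabilityMeasure μ] [Fintype κ] {X : κ → Ω → ℝ} (hind : iIndepFun X μ)
    (hX : ∀ z, Measurable (X z)) (h01 : ∀ z ω, X z ω = 0 ∨ X z ω = 1) (c : κ → ℝ) (k : ℝ) :
    μ.real {ω | ∑ z, μ.real {ω | X z ω = 1} * (Real.exp (c z) - 1) + k ≤ ∑ z, c z * X z ω}
      ≤ Real.exp (-k) := by
  set V := ∑ z, μ.real {ω | X z ω = 1} * (Real.exp (c z) - 1) with hV
  have hY : iIndepFun (fun z ω => c z * X z ω) μ :=
    hind.comp (fun z x => c z * x) fun z => measurable_const_mul (c z)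
  have hYm : ∀ z, Measurable fun ω => c z * X z ω := fun z => (hX z).const_mul _
  have hmgf : mgf (∑ z, fun ω => c z * X z ω) μ 1 ≤ Real.exp V := by
    rw [hY.mgf_sum hYm, hV, Real.exp_sum]
    refine Finset.prod_le_prod (fun z _ => mgf_nonneg) fun z _ => ?_
    rw [mgf]
    simp only [one_mul]
    rw [integral_exp_bernoulli (hX z) (h01 z), add_comm]
    exact Real.add_one_le_exp _
  have hmeas : Measurable (∑ z, fun ω => c z * X z ω) := by
    rw [Finset.sum_fn]; exact Finset.measurable_sum _ fun z _ => hYm z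
  have hint : Integrable (fun ω => Real.exp (1 * (∑ z, fun ω => c z * X z ω) ω)) μ := by
    refine Integrable.of_bound (C := Real.exp (∑ z, |c z|))
      ((hmeas.const_mul 1).exp).aestronglyMeasurable (Filter.Eventually.of_forall fun ω => ?_)
    rw [Real.norm_eq_abs, Real.abs_exp, one_mul, Finset.sum_apply]
    refine Real.exp_le_exp.2 (Finset.sum_le_sum fun z _ => ?_)
    rcases h01 z ω with h | h <;> rw [h]
    · simp
    · simpa using le_abs_self (c z)
  have := measure_ge_le_exp_mul_mgf (μ := μ) (X := ∑ z, fun ω => c z * X z ω) (t := 1) (V + k)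
    zero_le_one hint
  simp only [Finset.sum_apply] at this
  refine this.trans ?_
  calc _ ≤ Real.exp (-1 * (V + k)) * Real.exp V := by gcongr
    _ = Real.exp (-k) := by rw [← Real.exp_add]; ring_nf

lemma sum_triangle_eq {ι : Type*} [Fintype ι] {n : ℕ} (F : ι → Fin n → Fin n → ℝ) :
    ∑ u, ∑ i, ∑ j, (if i < j then F u i j else 0)
      = ∑ z : {z : ι × Fin n × Fin n // z.2.1 < z.2.2}, F z.1.1 z.1.2.1 z.1.2.2 := by
  rw [← Finset.sum_subtype (Finset.univ.filter fun z : ι × Fin n × Fin n => z.2.1 < z.2.2)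
    (by simp) (fun z => F z.1 z.2.1 z.2.2), Finset.sum_filter, Fintype.sum_prod_type]
  exact Finset.sum_congr rfl fun u _ => by rw [Fintype.sum_prod_type]

namespace DSBM

variable {Ω : Type*} [MeasurableSpace Ω] {μ : Measure Ω} {n K T : ℕ} {d : ℝ}

lemma edgeProb_apply (m : DSBM μ n K T d) (t : ℤ) (i j : Fin n) :
    m.edgeProb t i j = m.conn t (m.label t i) (m.label t j) := by
  simp [edgeProb, clusterMatrix, Matrix.mul_apply, Matrix.transpose_apply]

/-- The adjacency matrices are symmetric, so only entries above the diagonal are independent. The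
rest is set to zero here and restored later by adding the transpose. -/
lemma chernoffBound [IsProbabilityMeasure μ] (m : DSBM μ n K T d) {ι : Type*} [Fintype ι]
    (v : ι → ℤ) (hv : Function.Injective v) (hvT : ∀ u, 1 ≤ v u ∧ v u ≤ T) :
    ChernoffBound μ (fun u i j ω => if i < j then m.adj (v u) ω i j else 0)
      (fun u i j => if i < j then m.edgeProb (v u) i j else 0) := by
  intro c k
  set g : {z : ι × Fin n × Fin n // z.2.1 < z.2.2} →
      {p : ℤ × Fin n × Fin n // (1 ≤ p.1 ∧ p.1 ≤ T) ∧ p.2.1 < p.2.2} :=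
    fun z => ⟨(v z.1.1, z.1.2.1, z.1.2.2), hvT _, z.2⟩ with hg
  have hginj : Function.Injective g := by
    rintro ⟨⟨u, i, j⟩, h⟩ ⟨⟨u', i', j'⟩, h'⟩ heq
    simp only [hg, Subtype.mk.injEq, Prod.mk.injEq] at heq ⊢
    exact ⟨hv heq.1, heq.2⟩
  have hind := m.adj_indep.precomp hginj
  have := measureReal_exp_tail_le_of_iIndepFun hind
    (fun z => m.adj_measurable _ (hvT _).1 (hvT _).2 _ _)
    (fun z ω => m.adj_zero_or_one _ (hvT _).1 (hvT _).2 ω _ _ z.2)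
    (fun z => c z.1.1 z.1.2.1 z.1.2.2) k
  refine le_trans (le_of_eq ?_) this
  congr 1
  ext ω
  have h1 : ∑ u, ∑ i, ∑ j, (if i < j then m.edgeProb (v u) i j else 0) * (Real.exp (c u i j) - 1)
      = ∑ z : {z : ι × Fin n × Fin n // z.2.1 < z.2.2},
        μ.real {ω | m.adj (v z.1.1) ω z.1.2.1 z.1.2.2 = 1}
          * (Real.exp (c z.1.1 z.1.2.1 z.1.2.2) - 1) := by
    simp_rw [ite_mul, zero_mul]
    rw [sum_triangle_eq fun u i j => m.edgeProb (v u) i j * (Real.exp (c u i j) - 1)]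
    refine Finset.sum_congr rfl fun z _ => ?_
    rw [m.adj_prob _ (hvT _).1 (hvT _).2 _ _ z.2, edgeProb_apply]
  have h2 : ∑ u, ∑ i, ∑ j, c u i j * (if i < j then m.adj (v u) ω i j else 0)
      = ∑ z : {z : ι × Fin n × Fin n // z.2.1 < z.2.2},
        c z.1.1 z.1.2.1 z.1.2.2 * m.adj (v z.1.1) ω z.1.2.1 z.1.2.2 := by
    simp_rw [mul_ite, mul_zero]
    rw [sum_triangle_eq fun u i j => c u i j * m.adj (v u) ω i j]
  simp only [Set.mem_ofPred_eq]
  rw [h1, h2]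

end DSBM

/-! ### Diagonals, windows and the stochastic error -/

lemma specNorm_diagonal_le {n : ℕ} {v : Fin n → ℝ} {B : ℝ} (hB : 0 ≤ B) (hv : ∀ i, |v i| ≤ B) :
    specNorm (Matrix.diagonal v) ≤ B := by
  refine specNorm_le_of_bilin hB fun x y hx hy => ?_
  have e : bilin (Matrix.diagonal v) x y = ∑ i, x i * y i * v i := by
    simp [bilin, Matrix.diagonal_apply]
  rw [e]
  calc _ ≤ ∑ i, B * ((x i ^ 2 + y i ^ 2) / 2) := by
        refine Finset.sum_le_sum fun i _ => ?_
        have h1 : |x i * y i| ≤ (x i ^ 2 + y i ^ 2) / 2 := by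
          rw [abs_le]; constructor <;> nlinarith [sq_nonneg (x i + y i), sq_nonneg (x i - y i)]
        calc x i * y i * v i ≤ |x i * y i| * |v i| := by rw [← abs_mul]; exact le_abs_self _
          _ ≤ (x i ^ 2 + y i ^ 2) / 2 * B := mul_le_mul h1 (hv i) (abs_nonneg _) (by positivity)
          _ = _ := mul_comm _ _
    _ = B * ((∑ i, x i ^ 2 + ∑ i, y i ^ 2) / 2) := by
        rw [← Finset.mul_sum, ← Finset.sum_div, Finset.sum_add_distrib]
    _ ≤ B := mul_le_of_le_one_right hB (by linarith)

lemma abs_apply_le_specNorm {n : ℕ} (M : Matrix (Fin n) (Fin n) ℝ) (i j : Fin n) :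
    |M i j| ≤ specNorm M := by
  have h := abs_bilin_le M (EuclideanSpace.single i 1) (EuclideanSpace.single j 1)
  have e : bilin M (EuclideanSpace.single i (1 : ℝ)) (EuclideanSpace.single j (1 : ℝ)) = M i j := by
    simp [bilin]
  rw [e] at h
  simpa using h

lemma specNorm_neg {n : ℕ} (M : Matrix (Fin n) (Fin n) ℝ) : specNorm (-M) = specNorm M := by
  rw [specNorm, map_neg, norm_neg, specNorm]

/-- Entries are bounded by the spectral norm, so the diagonal itself has norm at most `specNorm M`.
-/
lemma specNorm_offDiagPart_le {n : ℕ} (M : Matrix (Fin n) (Fin n) ℝ) :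
    specNorm (offDiagPart M) ≤ 2 * specNorm M := by
  rw [offDiagPart, sub_eq_add_neg]
  refine (specNorm_add_le _ _).trans ?_
  rw [specNorm_neg]
  have := specNorm_diagonal_le (specNorm_nonneg M) (v := M.diag)
    fun i => abs_apply_le_specNorm M i i
  linarith

lemma specNorm_le_offDiagPart_add {n : ℕ} (M : Matrix (Fin n) (Fin n) ℝ) {B : ℝ} (hB : 0 ≤ B)
    (h : ∀ i, |M i i| ≤ B) : specNorm M ≤ specNorm (offDiagPart M) + B := by
  calc specNorm M = specNorm (offDiagPart M + Matrix.diagonal M.diag) := by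
        rw [offDiagPart, sub_add_cancel]
    _ ≤ _ := (specNorm_add_le _ _).trans (add_le_add le_rfl (specNorm_diagonal_le hB h))

lemma offDiagPart_apply {n : ℕ} (M : Matrix (Fin n) (Fin n) ℝ) (i j : Fin n) :
    offDiagPart M i j = if i = j then 0 else M i j := by
  rw [offDiagPart, Matrix.sub_apply, Matrix.diagonal_apply]
  split_ifs with h
  · subst h; simp
  · simp

lemma offDiagPart_add {n : ℕ} (M N : Matrix (Fin n) (Fin n) ℝ) :
    offDiagPart (M + N) = offDiagPart M + offDiagPart N := by
  ext i j
  rw [Matrix.add_apply, offDiagPart_apply, offDiagPart_apply, offDiagPart_apply]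
  split_ifs <;> simp

lemma card_window_bounds (r : ℕ) (j : Fin 3) :
    r + 1 ≤ (window r j).card ∧ (window r j).card ≤ 2 * r + 1 := by
  fin_cases j <;> simp [window] <;> omega

lemma abs_le_of_mem_window {r : ℕ} {j : Fin 3} {i : ℤ} (hi : i ∈ window r j) : |i| ≤ r := by
  fin_cases j <;> simp [window] at hi <;> rw [abs_le] <;> omega

/-- An admissible smoothing uses exactly one window, which stays inside the observation period. -/
lemma exists_window {T r : ℕ} {t : ℤ} (hr : 2 * r ≤ T) (ht1 : 1 ≤ t) (htT : t ≤ T) :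
    ∃ j : Fin 3, (∀ i ∈ window r j, 1 ≤ t + i ∧ t + i ≤ T) ∧
      ∀ {n : ℕ} (W : ℕ → Fin 3 → ℤ → ℝ) (M : ℤ → Matrix (Fin n) (Fin n) ℝ),
        kernelSmooth T W r M t
          = ((window r j).card : ℝ)⁻¹ • ∑ i ∈ window r j, W r j i • M (t + i) := by
  have h0 : t ∈ windowDomain T r 0 ↔ 1 + (r : ℤ) ≤ t ∧ t ≤ T - r := by simp [windowDomain]
  have h1 : t ∈ windowDomain T r 1 ↔ 1 ≤ t ∧ t ≤ r := by simp [windowDomain]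
  have h2 : t ∈ windowDomain T r 2 ↔ (T : ℤ) - r + 1 ≤ t ∧ t ≤ T := by simp [windowDomain]
  have hs : ∀ {n : ℕ} (W : ℕ → Fin 3 → ℤ → ℝ) (M : ℤ → Matrix (Fin n) (Fin n) ℝ) (j : Fin 3),
      (∀ j', t ∈ windowDomain T r j' ↔ j' = j) → kernelSmooth T W r M t
          = ((window r j).card : ℝ)⁻¹ • ∑ i ∈ window r j, W r j i • M (t + i) := by
    intro n W M j hj
    rw [kernelSmooth, Finset.sum_eq_single j]
    · rw [if_pos ((hj j).2 rfl)]
    · intro j' _ hne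
      rw [if_neg fun hcon => hne ((hj j').1 hcon)]
    · simp
  rcases lt_or_ge (r : ℤ) t with hlt | hle
  · rcases le_or_gt t (T - r) with hle' | hgt
    · refine ⟨0, ?_, fun W M => hs W M 0 ?_⟩
      · intro i hi
        simp [window] at hi; omega
      · intro j'
        fin_cases j'
        · simpa using h0.2 (by omega)
        · simpa using fun hc => absurd (h1.1 hc) (by omega)
        · simpa using fun hc => absurd (h2.1 hc) (by omega)
    · refine ⟨2, ?_, fun W M => hs W M 2 ?_⟩
      · intro i hi
        simp [window] at hi; omega
      · intro j'
        fin_cases j'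
        · simpa using fun hc => absurd (h0.1 hc) (by omega)
        · simpa using fun hc => absurd (h1.1 hc) (by omega)
        · simpa using h2.2 (by omega)
  · refine ⟨1, ?_, fun W M => hs W M 1 ?_⟩
    · intro i hi
      simp [window] at hi; omega
    · intro j'
      fin_cases j'
      · simpa using fun hc => absurd (h0.1 hc) (by omega)
      · simpa using h1.2 (by omega)
      · simpa using fun hc => absurd (h2.1 hc) (by omega)

namespace DSBM

variable {Ω : Type*} [MeasurableSpace Ω] {μ : Measure Ω} {n K T : ℕ} {d : ℝ}

lemma edgeProb_symm (m : DSBM μ n K T d) {t : ℤ} (h1 : 1 ≤ t) (hT : t ≤ T) (i j : Fin n) :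
    m.edgeProb t i j = m.edgeProb t j i := by
  rw [edgeProb_apply, edgeProb_apply, (m.conn_symm t h1 hT).apply]

lemma edgeProb_nonneg (m : DSBM μ n K T d) {t : ℤ} (h1 : 1 ≤ t) (hT : t ≤ T) (i j : Fin n) :
    0 ≤ m.edgeProb t i j := by
  rw [edgeProb_apply]; exact (m.conn_mem t h1 hT _ _).1

lemma edgeProb_le_one (m : DSBM μ n K T d) {t : ℤ} (h1 : 1 ≤ t) (hT : t ≤ T) (i j : Fin n) :
    m.edgeProb t i j ≤ 1 := by
  rw [edgeProb_apply]; exact (m.conn_mem t h1 hT _ _).2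

lemma edgeProb_le (m : DSBM μ n K T d) {Cα α : ℝ} (hs : m.SparsityLevel Cα α) {t : ℤ}
    (h1 : 1 ≤ t) (hT : t ≤ T) (i j : Fin n) : m.edgeProb t i j ≤ Cα * α := by
  rw [edgeProb_apply]
  refine (le_abs_self _).trans (le_trans ?_ (hs t h1 hT).2)
  exact le_ciSup (f := fun p : Fin K × Fin K => |m.conn t p.1 p.2|) (Set.finite_range _).bddAbove
    (m.label t i, m.label t j)

/-- Reduces the symmetric error to its strictly upper triangular part `Y`, to which the
concentration theorem applies; the transpose costs a factor `2` in norm. -/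
lemma offDiagPart_smooth_sub_eq (m : DSBM μ n K T d) {t : ℤ} {F : Finset ℤ}
    (hF : ∀ i ∈ F, 1 ≤ t + i ∧ t + i ≤ T) (w : ℤ → ℝ) (ω : Ω) (N : ℝ) :
    let Y : Matrix (Fin n) (Fin n) ℝ := Matrix.of fun i j => ∑ u : F, w u *
      ((if i < j then m.adj (t + u) ω i j else 0) - (if i < j then m.edgeProb (t + u) i j else 0))
    offDiagPart (N • (∑ i ∈ F, w i • m.adj (t + i) ω) - N • ∑ i ∈ F, w i • m.edgeProb (t + i))
      = N • (Y + Y.transpose) := by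
  intro Y
  ext i j
  rw [offDiagPart_apply]
  have e : (N • (∑ i ∈ F, w i • m.adj (t + i) ω) - N • ∑ i ∈ F, w i • m.edgeProb (t + i)) i j
      = N * ∑ u : F, w u * (m.adj (t + u) ω i j - m.edgeProb (t + u) i j) := by
    rw [← smul_sub, ← Finset.sum_sub_distrib, Matrix.smul_apply, Matrix.sum_apply, smul_eq_mul,
      ← Finset.sum_coe_sort F]
    congr 1
    refine Finset.sum_congr rfl fun u _ => ?_
    simp only [Matrix.sub_apply, Matrix.smul_apply, smul_eq_mul]
    ring
  rw [e, Matrix.smul_apply, Matrix.add_apply, Matrix.transpose_apply, smul_eq_mul]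
  rcases lt_trichotomy i j with h | h | h
  · simp [Y, h, h.ne, h.not_gt]
  · simp [Y, h]
  · simp only [h.ne', if_false, Y, Matrix.of_apply, h.not_gt, h, if_true, sub_self, mul_zero,
      Finset.sum_const_zero, zero_add]
    congr 1
    refine Finset.sum_congr rfl fun u _ => ?_
    obtain ⟨g1, g2⟩ := hF u u.2
    rw [edgeProb_symm m g1 g2, (m.adj_symm _ g1 g2 ω).apply]

end DSBM

/-- The stochastic part of the off-diagonal error. -/
theorem exists_stochastic_error_tail (τ c₀ Wmax Cα : ℝ) (hτ : 0 < τ) (hc₀ : 0 < c₀)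
    (hCα : 1 ≤ Cα) :
    ∃ C : ℝ, 0 < C ∧ ∀ {Ω : Type*} [MeasurableSpace Ω] (μ : Measure Ω) [IsProbabilityMeasure μ]
      (n K T : ℕ) (d α : ℝ) (m : DSBM μ n K T d) (l : ℕ) (W : ℕ → Fin 3 → ℤ → ℝ) (t : ℤ) (r : ℕ),
      2 ≤ n → 1 ≤ t → t ≤ T → 0 < α → Cα⁻¹ * c₀ * Real.log n / n ≤ α → m.SparsityLevel Cα α →
      IsDiscreteKernel l Wmax W → 2 * r ≤ T →
      μ.real {ω | C * √(n * α / (max r 1 : ℕ))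
        < specNorm (offDiagPart (m.estimator W r t ω - kernelSmooth T W r m.edgeProb t))}
        ≤ 4 * (n : ℝ) ^ (-τ) := by
  -- The concentration theorem needs a positive weight bound, and the sign of `Wmax` is not yet
  -- known.
  have hW1 : 0 < max Wmax 1 := by positivity
  obtain ⟨C, hC, hmain⟩ := exists_specNorm_centered_tail τ c₀ (max Wmax 1) hτ hc₀ hW1
  have hCα0 : 0 < Cα := by linarith
  refine ⟨2 * C * √Cα, by positivity, ?_⟩
  intro Ω _ μ _ n K T d α m l W t r hn ht1 htT hα hαn hsp hker hr
  have hn0 : (0 : ℝ) < n := by positivity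
  obtain ⟨j, hF, hsm⟩ := exists_window hr ht1 htT
  set F := window r j with hFdef
  set N : ℝ := (F.card : ℝ) with hN
  have hNr : ((max r 1 : ℕ) : ℝ) ≤ N := by
    have h1 : r + 1 ≤ F.card := (card_window_bounds r j).1
    rw [hN]; exact_mod_cast max_le (by omega) (by omega)
  have hN1 : 1 ≤ N := le_trans (by exact_mod_cast le_max_right r 1) hNr
  have hN0 : 0 < N := by linarith
  have hcardF : (Fintype.card F : ℝ) = N := by rw [Fintype.card_coe]
  -- The sparsity lower bound already gives this for a single matrix; averaging `N ≥ 1` matrices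
  -- only raises the density.
  have hd : c₀ * Real.log n ≤ n * (N * (Cα * α)) := by
    rw [div_le_iff₀ hn0, mul_assoc, inv_mul_le_iff₀ hCα0] at hαn
    calc c₀ * Real.log n ≤ 1 * (Cα * (α * n)) := by rw [one_mul]; exact hαn
      _ ≤ N * (Cα * (α * n)) := by gcongr
      _ = _ := by ring
  have h := hmain μ n (fun (u : F) i j ω => if i < j then m.adj (t + u) ω i j else 0)
    (fun u i j => if i < j then m.edgeProb (t + u) i j else 0) (fun u => W r j u) (Cα * α) hn
    ?_ ?_ ?_ ?_ (by positivity) (by rw [hcardF]; exact hd)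
    (m.chernoffBound (fun u : F => t + u) (fun u v huv => Subtype.ext (add_left_cancel huv)) fun u => hF u u.2)
  · refine (measureReal_mono (fun ω hω => ?_) (measure_ne_top _ _)).trans h
    simp only [Set.mem_ofPred_eq] at hω ⊢
    rw [DSBM.estimator, hsm, hsm, m.offDiagPart_smooth_sub_eq hF, specNorm_smul,
      abs_of_pos (inv_pos.2 hN0)] at hω
    rw [hcardF]
    set Y : Matrix (Fin n) (Fin n) ℝ := Matrix.of fun i k => ∑ u : F, W r j u *
      ((if i < k then m.adj (t + u) ω i k else 0) - (if i < k then m.edgeProb (t + u) i k else 0))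
    have h1 : specNorm (Y + Y.transpose) ≤ 2 * specNorm Y := by
      refine (specNorm_add_le _ _).trans ?_
      rw [specNorm_transpose]; linarith
    have h2 : 2 * C * √Cα * √(n * α / (max r 1 : ℕ)) < N⁻¹ * (2 * specNorm Y) :=
      hω.trans_le (by gcongr)
    rw [inv_mul_eq_div, lt_div_iff₀ hN0] at h2
    -- After division by `N` the norm bound becomes `√Cα * √(n α / N)`, and `N ≥ max r 1`.
    have h3 : √(n * (N * (Cα * α))) ≤ √Cα * √(n * α / (max r 1 : ℕ)) * N := by
      have hm : (0 : ℝ) < (max r 1 : ℕ) := by positivity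
      refine Real.sqrt_le_iff.2 ⟨by positivity, ?_⟩
      rw [mul_pow, mul_pow, Real.sq_sqrt hCα0.le, Real.sq_sqrt (by positivity)]
      calc n * (N * (Cα * α)) = Cα * (n * α / N) * N ^ 2 := by field_simp
        _ ≤ _ := by gcongr
    have h4 := mul_le_mul_of_nonneg_left h3 hC.le
    linarith
  · intro u i k ω
    split_ifs with hik
    · rcases m.adj_zero_or_one _ (hF u u.2).1 (hF u u.2).2 ω i k hik with h0 | h0 <;> rw [h0]
      exact zero_le_one
    · exact le_rfl
  · intro u i k
    split_ifs
    · exact m.edgeProb_nonneg (hF u u.2).1 (hF u u.2).2 _ _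
    · exact le_rfl
  · intro u i k
    split_ifs
    · exact m.edgeProb_le hsp (hF u u.2).1 (hF u u.2).2 _ _
    · positivity
  · intro u
    exact ((hker r j).1 u u.2).trans (le_max_left _ _)

/-! ### Smoothness bias -/

/-- Taylor expansion on `[0,1]` with a Hölder remainder. -/
lemma exists_taylor_bound {L γ : ℝ} (hL : 0 ≤ L) (hγ : 0 < γ) (l : ℕ) :
    ∀ f : ℝ → ℝ, ContDiffOn ℝ l f (Set.Icc 0 1) →
    (∀ x ∈ Set.Icc (0 : ℝ) 1, ∀ y ∈ Set.Icc (0 : ℝ) 1,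
      |iteratedDerivWithin l f (Set.Icc 0 1) x - iteratedDerivWithin l f (Set.Icc 0 1) y|
        ≤ L * |x - y| ^ γ) →
    ∀ x ∈ Set.Icc (0 : ℝ) 1, ∃ a : ℕ → ℝ, ∀ y ∈ Set.Icc (0 : ℝ) 1,
      |f y - f x - ∑ k ∈ Finset.range l, a k * (y - x) ^ (k + 1)| ≤ L * |y - x| ^ (l + γ) := by
  -- Induction through the derivative of `f`. The coefficients stay anonymous, since the kernel
  -- annihilates them whatever they are. The mean value inequality keeps the constant `L` rather
  -- than `L / l!`; the lost factorial is restored in `DSBM.bias_le`.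
  induction l with
  | zero =>
    intro f _ hh x hx
    refine ⟨0, fun y hy => ?_⟩
    simpa using hh y hy x hx
  | succ l ih =>
    intro f hf hh x hx
    have hud : UniqueDiffOn ℝ (Set.Icc (0 : ℝ) 1) := uniqueDiffOn_Icc zero_lt_one
    have hf' := (contDiffOn_succ_iff_derivWithin (n := l) hud).1 (by exact_mod_cast hf)
    set g := derivWithin f (Set.Icc 0 1) with hg
    obtain ⟨a, ha⟩ := ih g hf'.2.2 (by simpa only [iteratedDerivWithin_succ'] using hh) x hx
    -- Coefficients of the antiderivative of the expansion of `g`.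
    refine ⟨fun k => if k = 0 then g x else a (k - 1) / (k + 1), fun y hy => ?_⟩
    set φ : ℝ → ℝ := fun z => f z - f x - ∑ k ∈ Finset.range (l + 1),
      (if k = 0 then g x else a (k - 1) / (k + 1)) * (z - x) ^ (k + 1) with hφ
    have hsub : Set.uIcc x y ⊆ Set.Icc 0 1 := Set.uIcc_subset_Icc hx hy
    have hpoly : ∀ z, HasDerivAt (fun z => ∑ k ∈ Finset.range (l + 1),
        (if k = 0 then g x else a (k - 1) / (k + 1)) * (z - x) ^ (k + 1))
        (g x + ∑ k ∈ Finset.range l, a k * (z - x) ^ (k + 1)) z := by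
      intro z
      have h1 : ∀ k ∈ Finset.range (l + 1), HasDerivAt
          (fun z => (if k = 0 then g x else a (k - 1) / (k + 1)) * (z - x) ^ (k + 1))
          ((if k = 0 then g x else a (k - 1)) * (z - x) ^ k) z := by
        intro k _
        have h2 := (((hasDerivAt_id z).sub_const x).pow (k + 1)).const_mul
          (if k = 0 then g x else a (k - 1) / (k + 1))
        refine HasDerivAt.congr_deriv h2 ?_
        have hk : (k : ℝ) + 1 ≠ 0 := by positivity
        split_ifs with h0
        · subst h0; simp
        · push_cast; simp; field_simp
      have h3 := HasDerivAt.fun_sum h1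
      refine HasDerivAt.congr_deriv h3 ?_
      rw [Finset.sum_range_succ']
      simp [add_comm]
    have hderiv : ∀ z ∈ Set.uIcc x y, HasDerivWithinAt φ
        (g z - (g x + ∑ k ∈ Finset.range l, a k * (z - x) ^ (k + 1))) (Set.uIcc x y) z := by
      intro z hz
      have h1 : HasDerivWithinAt f (g z) (Set.uIcc x y) z :=
        (hf'.1 z (hsub hz)).hasDerivWithinAt.mono hsub
      exact (h1.sub_const (f x)).sub (hpoly z).hasDerivWithinAt
    have hbound : ∀ z ∈ Set.uIcc x y,
        ‖g z - (g x + ∑ k ∈ Finset.range l, a k * (z - x) ^ (k + 1))‖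
          ≤ L * |y - x| ^ (l + γ) := by
      intro z hz
      rw [Real.norm_eq_abs, ← sub_sub]
      refine (ha z (hsub hz)).trans ?_
      have := Set.abs_sub_left_of_mem_uIcc hz
      gcongr
    have h := (convex_uIcc x y).norm_image_sub_le_of_norm_hasDerivWithin_le hderiv hbound
      Set.left_mem_uIcc Set.right_mem_uIcc
    have hx0 : φ x = 0 := by simp [hφ]
    rw [hx0, sub_zero, Real.norm_eq_abs, Real.norm_eq_abs, mul_assoc,
      ← Real.rpow_add_one' (abs_nonneg _) (by positivity)] at h
    have e : ((l + 1 : ℕ) : ℝ) + γ = l + γ + 1 := by push_cast; ring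
    rw [e]
    exact h

lemma holderOrder_lt {β : ℝ} (hβ : 0 < β) : (holderOrder β : ℝ) < β := by
  have h1 : 0 < ⌈β⌉₊ := Nat.ceil_pos.2 hβ
  rw [holderOrder, Nat.cast_sub h1]
  have := Nat.ceil_lt_add_one hβ.le
  push_cast; linarith

/-- Kernel smoothing error of a Hölder function on a grid. -/
lemma abs_smooth_sub_le {β L Wmax : ℝ} (hβ : 0 < β) (hL : 0 ≤ L) (hWm : 0 ≤ Wmax) {f : ℝ → ℝ}
    (hf : HolderClass β L f) {F : Finset ℤ} (hne : F.Nonempty) {w : ℤ → ℝ} {T r : ℕ} {t : ℤ}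
    (ht : 1 ≤ t ∧ t ≤ T) (hF : ∀ i ∈ F, 1 ≤ t + i ∧ t + i ≤ T) (hr : ∀ i ∈ F, |i| ≤ r)
    (hw : ∀ i ∈ F, |w i| ≤ Wmax)
    (hmom : ∀ k ≤ holderOrder β, (F.card : ℝ)⁻¹ * ∑ i ∈ F, (i : ℝ) ^ k * w i
      = if k = 0 then 1 else 0) :
    |(F.card : ℝ)⁻¹ * ∑ i ∈ F, w i * f (((t + i : ℤ) : ℝ) / T) - f ((t : ℝ) / T)|
      ≤ Wmax * (L * ((r : ℝ) / T) ^ β) := by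
  have hT0 : (0 : ℝ) < T := by
    have : (0 : ℤ) < T := by omega
    exact_mod_cast this
  have hN0 : (0 : ℝ) < F.card := by exact_mod_cast Finset.card_pos.2 hne
  have hmem : ∀ u : ℤ, 1 ≤ u ∧ u ≤ T → (u : ℝ) / T ∈ Set.Icc (0 : ℝ) 1 := by
    intro u hu
    have h1 : (1 : ℝ) ≤ u := by exact_mod_cast hu.1
    have h2 : (u : ℝ) ≤ T := by exact_mod_cast hu.2
    exact ⟨by positivity, (div_le_one hT0).2 h2⟩
  obtain ⟨a, ha⟩ := exists_taylor_bound hL (sub_pos.2 (holderOrder_lt hβ)) (holderOrder β) f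
    hf.1 hf.2 _ (hmem t ht)
  set x := (t : ℝ) / T with hx
  have hdiff : ∀ i : ℤ, ((t + i : ℤ) : ℝ) / T - x = i / T := by
    intro i; rw [hx]; push_cast; ring
  have hrem : ∀ i ∈ F, |f (((t + i : ℤ) : ℝ) / T) - f x
      - ∑ k ∈ Finset.range (holderOrder β), a k * ((i : ℝ) / T) ^ (k + 1)|
      ≤ L * ((r : ℝ) / T) ^ β := by
    intro i hi
    have h1 := ha _ (hmem _ (hF i hi))
    rw [hdiff, add_sub_cancel] at h1
    refine h1.trans ?_
    have h2 : |(i : ℝ)| ≤ r := by exact_mod_cast hr i hi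
    rw [abs_div, abs_of_pos hT0]
    gcongr
  have h0 : (F.card : ℝ)⁻¹ * ∑ i ∈ F, w i = 1 := by simpa using hmom 0 (Nat.zero_le _)
  have hk : ∀ k ∈ Finset.range (holderOrder β),
      (F.card : ℝ)⁻¹ * ∑ i ∈ F, (i : ℝ) ^ (k + 1) * w i = 0 := by
    intro k hk
    simpa using hmom (k + 1) (Finset.mem_range.1 hk)
  have hpoly : (F.card : ℝ)⁻¹ * ∑ i ∈ F, w i *
      ∑ k ∈ Finset.range (holderOrder β), a k * ((i : ℝ) / T) ^ (k + 1) = 0 := by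
    calc _ = ∑ k ∈ Finset.range (holderOrder β), a k / T ^ (k + 1) *
          ((F.card : ℝ)⁻¹ * ∑ i ∈ F, (i : ℝ) ^ (k + 1) * w i) := by
          simp_rw [Finset.mul_sum]
          rw [Finset.sum_comm]
          refine Finset.sum_congr rfl fun k _ => Finset.sum_congr rfl fun i _ => ?_
          rw [div_pow]; ring
      _ = 0 := Finset.sum_eq_zero fun k hk' => by rw [hk k hk', mul_zero]
  -- The zeroth moment removes `f x` and the higher ones the Taylor polynomial, so only the
  -- remainders are averaged.
  have key : (F.card : ℝ)⁻¹ * ∑ i ∈ F, w i * f (((t + i : ℤ) : ℝ) / T) - f x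
      = (F.card : ℝ)⁻¹ * ∑ i ∈ F, w i * (f (((t + i : ℤ) : ℝ) / T) - f x
      - ∑ k ∈ Finset.range (holderOrder β), a k * ((i : ℝ) / T) ^ (k + 1)) := by
    simp_rw [mul_sub, Finset.sum_sub_distrib, mul_sub]
    rw [hpoly, ← Finset.sum_mul, ← mul_assoc, h0]
    ring
  rw [key, abs_mul, abs_of_pos (inv_pos.2 hN0), inv_mul_le_iff₀ hN0]
  calc _ ≤ ∑ i ∈ F, |w i * (f (((t + i : ℤ) : ℝ) / T) - f x
      - ∑ k ∈ Finset.range (holderOrder β), a k * ((i : ℝ) / T) ^ (k + 1))| :=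
        Finset.abs_sum_le_sum_abs _ _
    _ ≤ ∑ i ∈ F, Wmax * (L * ((r : ℝ) / T) ^ β) := by
        refine Finset.sum_le_sum fun i hi => ?_
        rw [abs_mul]
        exact mul_le_mul (hw i hi) (hrem i hi) (abs_nonneg _) hWm
    _ = _ := by rw [Finset.sum_const, nsmul_eq_mul]

/-! ### Block matrices and the switching bias -/

lemma specNorm_le_of_abs_apply_le {n : ℕ} {M : Matrix (Fin n) (Fin n) ℝ} {B : ℝ} (hB : 0 ≤ B)
    (h : ∀ i j, |M i j| ≤ B) : specNorm M ≤ n * B := by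
  refine specNorm_le_of_bilin (by positivity) fun x y hx hy => ?_
  calc bilin M x y ≤ ∑ i, ∑ j, B * ((x i ^ 2 + y j ^ 2) / 2) := by
        refine Finset.sum_le_sum fun i _ => Finset.sum_le_sum fun j _ => ?_
        have h1 : |x i * y j| ≤ (x i ^ 2 + y j ^ 2) / 2 := by
          rw [abs_le]; constructor <;> nlinarith [sq_nonneg (x i + y j), sq_nonneg (x i - y j)]
        calc x i * y j * M i j ≤ |x i * y j| * |M i j| := by rw [← abs_mul]; exact le_abs_self _
          _ ≤ (x i ^ 2 + y j ^ 2) / 2 * B := mul_le_mul h1 (h i j) (abs_nonneg _) (by positivity)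
          _ = _ := mul_comm _ _
    _ = B * ((n * ∑ i, x i ^ 2 + n * ∑ i, y i ^ 2) / 2) := by
        simp_rw [← Finset.mul_sum, ← Finset.sum_div, Finset.sum_add_distrib, Finset.sum_const,
          Finset.card_univ, Fintype.card_fin, nsmul_eq_mul, ← Finset.mul_sum]
    _ ≤ B * ((n * 1 + n * 1) / 2) := by gcongr
    _ = n * B := by ring

/-- In an orthonormal eigenbasis the symmetric operator multiplies each coordinate by an eigenvalue.
-/
lemma specNorm_le_of_eigenvalues {K : ℕ} {H : Matrix (Fin K) (Fin K) ℝ} (hH : H.IsSymm) {C : ℝ}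
    (hC : 0 ≤ C)
    (hev : ∀ ev : ℝ, Module.End.HasEigenvalue (Matrix.toLin' H) ev → |ev| ≤ C) :
    specNorm H ≤ C := by
  set A := Matrix.toEuclideanCLM (n := Fin K) (𝕜 := ℝ) H with hA
  have hsymm : (A : EuclideanSpace ℝ (Fin K) →ₗ[ℝ] EuclideanSpace ℝ (Fin K)).IsSymmetric := by
    intro x y
    rw [ContinuousLinearMap.coe_coe, real_inner_comm, hA, inner_toEuclideanCLM,
      inner_toEuclideanCLM, bilin, bilin, Finset.sum_comm]
    refine Finset.sum_congr rfl fun i _ => Finset.sum_congr rfl fun j _ => ?_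
    rw [hH.apply]; ring
  have hfin : Module.finrank ℝ (EuclideanSpace ℝ (Fin K)) = K := by simp
  have hbd : ∀ i, |hsymm.eigenvalues hfin i| ≤ C := by
    intro i
    apply hev
    obtain ⟨v, hv⟩ := (hsymm.hasEigenvalue_eigenvalues hfin i).exists_hasEigenvector
    have h1 := hv.apply_eq_smul
    refine Module.End.hasEigenvalue_of_hasEigenvector (x := WithLp.ofLp v)
      ⟨Module.End.mem_eigenspace_iff.2 ?_, ?_⟩
    · have h2 := congrArg WithLp.ofLp h1
      rw [Matrix.toLin'_apply]
      exact (Matrix.ofLp_toEuclideanCLM H v).symm.trans h2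
    · intro h0
      exact hv.2 (by ext k; exact congrFun h0 k)
  refine ContinuousLinearMap.opNorm_le_bound _ hC fun x => ?_
  refine le_of_sq_le_sq ?_ (by positivity)
  set bs := hsymm.eigenvectorBasis hfin
  rw [← bs.repr.norm_map, ← bs.repr.norm_map x, mul_pow, norm_sq_euclidean, norm_sq_euclidean,
    Finset.mul_sum]
  refine Finset.sum_le_sum fun i _ => ?_
  have h1 := hsymm.eigenvectorBasis_apply_self_apply hfin x i
  rw [ContinuousLinearMap.coe_coe] at h1
  rw [h1, mul_pow]
  have h2 : hsymm.eigenvalues hfin i ^ 2 ≤ C ^ 2 := sq_le_sq.2 (by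
    rw [abs_of_nonneg hC]; exact hbd i)
  exact mul_le_mul_of_nonneg_right h2 (sq_nonneg _)

/-- Sums of a vector over the classes of a labelling. -/
def classSum {n K : ℕ} (ℓ : Fin n → Fin K) (x : Fin n → ℝ) (k : Fin K) : ℝ :=
  ∑ i, (if ℓ i = k then x i else 0)

/-- The block matrix `Θ B Θᵀ` of a labelling. -/
def blockMatrix {n K : ℕ} (ℓ : Fin n → Fin K) (B : Matrix (Fin K) (Fin K) ℝ) :
    Matrix (Fin n) (Fin n) ℝ := Matrix.of fun i j => B (ℓ i) (ℓ j)

lemma sum_classSum_mul {n K : ℕ} (ℓ : Fin n → Fin K) (x : Fin n → ℝ) (g : Fin K → ℝ) :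
    ∑ k, classSum ℓ x k * g k = ∑ i, x i * g (ℓ i) := by
  simp only [classSum, Finset.sum_mul]
  rw [Finset.sum_comm]
  simp

/-- Moves the form from `n` nodes to `K` classes, where the eigenvalue bound on the connectivity
matrix applies. -/
lemma bilin_blockMatrix {n K : ℕ} (ℓ : Fin n → Fin K) (B : Matrix (Fin K) (Fin K) ℝ)
    (x y : Fin n → ℝ) : bilin (blockMatrix ℓ B) x y = bilin B (classSum ℓ x) (classSum ℓ y) := by
  simp only [bilin, mul_assoc, ← Finset.mul_sum]
  rw [sum_classSum_mul ℓ x fun k => ∑ k', classSum ℓ y k' * B k k']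
  refine Finset.sum_congr rfl fun i _ => ?_
  rw [sum_classSum_mul ℓ y fun k' => B (ℓ i) k']
  rfl

lemma sum_sq_classSum_le {n K : ℕ} {ℓ : Fin n → Fin K} {nm : ℕ}
    (hℓ : ∀ k, (Finset.univ.filter fun i => ℓ i = k).card ≤ nm) (x : Fin n → ℝ) :
    ∑ k, classSum ℓ x k ^ 2 ≤ nm * ∑ i, x i ^ 2 := by
  calc ∑ k, classSum ℓ x k ^ 2 ≤ ∑ k, nm * ∑ i with ℓ i = k, x i ^ 2 := by
        refine Finset.sum_le_sum fun k _ => ?_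
        rw [classSum, ← Finset.sum_filter]
        refine sq_sum_le_card_mul_sum_sq.trans ?_
        gcongr
        exact hℓ k
    _ = nm * ∑ i, x i ^ 2 := by
        rw [← Finset.mul_sum, Finset.sum_fiberwise]

/-- Only switched nodes count, and each changes its indicator row in two entries by `±1`. So `Θ' -
Θ` has squared Frobenius norm at most twice their number. -/
lemma sum_sq_classSum_sub_le {n K : ℕ} (ℓ ℓ' : Fin n → Fin K) (x : Fin n → ℝ) :
    ∑ k, (classSum ℓ' x k - classSum ℓ x k) ^ 2
      ≤ 2 * (Finset.univ.filter fun i => ℓ i ≠ ℓ' i).card * ∑ i, x i ^ 2 := by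
  set D := Finset.univ.filter fun i => ℓ i ≠ ℓ' i with hD
  set e : Fin n → Fin K → ℝ := fun i k => (if ℓ' i = k then 1 else 0) - (if ℓ i = k then 1 else 0)
  have h1 : ∀ k, classSum ℓ' x k - classSum ℓ x k = ∑ i ∈ D, e i k * x i := by
    intro k
    rw [classSum, classSum, ← Finset.sum_sub_distrib, hD, Finset.sum_filter]
    refine Finset.sum_congr rfl fun i _ => ?_
    by_cases h : ℓ i = ℓ' i
    · simp [h]
    · simp only [ne_eq, h, not_false_eq_true, if_true, e]
      split_ifs <;> simp
  have h2 : ∀ i, ∑ k, e i k ^ 2 ≤ 2 := by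
    intro i
    calc ∑ k, e i k ^ 2 ≤ ∑ k, ((if ℓ' i = k then 1 else 0) + (if ℓ i = k then 1 else 0)) := by
          refine Finset.sum_le_sum fun k _ => ?_
          simp only [e]
          split_ifs <;> norm_num
      _ = 2 := by rw [Finset.sum_add_distrib]; simp; norm_num
  calc _ ≤ ∑ k, (∑ i ∈ D, e i k ^ 2) * ∑ i, x i ^ 2 := by
        refine Finset.sum_le_sum fun k _ => ?_
        rw [h1]
        refine (Finset.sum_mul_sq_le_sq_mul_sq _ _ _).trans ?_
        refine mul_le_mul_of_nonneg_left ?_ (Finset.sum_nonneg fun _ _ => sq_nonneg _)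
        exact Finset.sum_le_sum_of_subset_of_nonneg (Finset.subset_univ _) fun _ _ _ => sq_nonneg _
    _ = (∑ i ∈ D, ∑ k, e i k ^ 2) * ∑ i, x i ^ 2 := by rw [← Finset.sum_mul, Finset.sum_comm]
    _ ≤ (∑ i ∈ D, 2) * ∑ i, x i ^ 2 := by
        gcongr with i hi
        exact h2 i
    _ = _ := by rw [Finset.sum_const, nsmul_eq_mul]; ring

lemma specNorm_blockMatrix_sub_le {n K : ℕ} {ℓ ℓ' : Fin n → Fin K} {nm D : ℕ}
    (hℓ : ∀ k, (Finset.univ.filter fun i => ℓ i = k).card ≤ nm)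
    (hℓ' : ∀ k, (Finset.univ.filter fun i => ℓ' i = k).card ≤ nm)
    (hD : (Finset.univ.filter fun i => ℓ i ≠ ℓ' i).card ≤ D)
    (B : Matrix (Fin K) (Fin K) ℝ) :
    specNorm (blockMatrix ℓ' B - blockMatrix ℓ B)
      ≤ 2 * √2 * specNorm B * √(nm * D) := by
  have hB := specNorm_nonneg B
  refine specNorm_le_of_bilin (by positivity) fun x y hx hy => ?_
  -- Changing the labels on one side at a time; each of the two terms carries one factor `√(2 D)`
  -- and one factor `√nm`.
  have e : bilin (blockMatrix ℓ' B - blockMatrix ℓ B) x y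
      = bilin B (fun k => classSum ℓ' x k - classSum ℓ x k) (classSum ℓ' y)
        + bilin B (classSum ℓ x) (fun k => classSum ℓ' y k - classSum ℓ y k) := by
    have h1 : bilin (blockMatrix ℓ' B - blockMatrix ℓ B) x y
        = bilin (blockMatrix ℓ' B) x y - bilin (blockMatrix ℓ B) x y := by
      simp only [bilin, ← Finset.sum_sub_distrib, Matrix.sub_apply, mul_sub]
    rw [h1, bilin_blockMatrix, bilin_blockMatrix]
    simp only [bilin, ← Finset.sum_sub_distrib, ← Finset.sum_add_distrib]
    exact Finset.sum_congr rfl fun i _ => Finset.sum_congr rfl fun j _ => by ring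
  have hnorm : ∀ (z : Fin K → ℝ) (c : ℝ), ∑ k, z k ^ 2 ≤ c →
      ‖(WithLp.toLp 2 z : EuclideanSpace ℝ (Fin K))‖ ≤ √c := by
    intro z c hz
    apply Real.le_sqrt_of_sq_le
    rw [norm_sq_euclidean]; exact hz
  have hsum : ∀ (ℓ : Fin n → Fin K), (∀ k, (Finset.univ.filter fun i => ℓ i = k).card ≤ nm) →
      ∀ z : Fin n → ℝ, ∑ i, z i ^ 2 ≤ 1 →
      ‖(WithLp.toLp 2 (classSum ℓ z) : EuclideanSpace ℝ (Fin K))‖ ≤ √(nm : ℝ) := by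
    intro ℓ hℓ z hz
    exact hnorm _ _ ((sum_sq_classSum_le hℓ z).trans (mul_le_of_le_one_right (by positivity) hz))
  have hdiff : ∀ z : Fin n → ℝ, ∑ i, z i ^ 2 ≤ 1 →
      ‖(WithLp.toLp 2 (fun k => classSum ℓ' z k - classSum ℓ z k) : EuclideanSpace ℝ (Fin K))‖
        ≤ √(2 * D : ℝ) := by
    intro z hz
    refine hnorm _ _ ((sum_sq_classSum_sub_le ℓ ℓ' z).trans
      ((mul_le_of_le_one_right (by positivity) hz).trans ?_))
    gcongr
  have hs : √(nm * D : ℝ) * √2 = √(2 * D : ℝ) * √(nm : ℝ) := by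
    rw [← Real.sqrt_mul (by positivity), ← Real.sqrt_mul (by positivity)]
    ring_nf
  have h1 : bilin B (fun k => classSum ℓ' x k - classSum ℓ x k) (classSum ℓ' y)
      ≤ specNorm B * √(2 * D : ℝ) * √(nm : ℝ) :=
    ((le_abs_self _).trans (abs_bilin_le B (WithLp.toLp 2 _) (WithLp.toLp 2 _))).trans
      (by gcongr; exacts [hdiff x hx, hsum ℓ' hℓ' y hy])
  have h2 : bilin B (classSum ℓ x) (fun k => classSum ℓ' y k - classSum ℓ y k)
      ≤ specNorm B * √(nm : ℝ) * √(2 * D : ℝ) :=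
    ((le_abs_self _).trans (abs_bilin_le B (WithLp.toLp 2 _) (WithLp.toLp 2 _))).trans
      (by gcongr; exacts [hsum ℓ hℓ x hx, hdiff y hy])
  rw [e]
  calc _ ≤ specNorm B * √(2 * D : ℝ) * √(nm : ℝ) + specNorm B * √(nm : ℝ) * √(2 * D : ℝ) :=
        add_le_add h1 h2
    _ = 2 * specNorm B * (√(2 * D : ℝ) * √(nm : ℝ)) := by ring
    _ = _ := by rw [← hs]; ring

lemma specNorm_sum_le {n : ℕ} {ι : Type*} (F : Finset ι) (M : ι → Matrix (Fin n) (Fin n) ℝ) :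
    specNorm (∑ i ∈ F, M i) ≤ ∑ i ∈ F, specNorm (M i) := by
  classical
  induction F using Finset.induction_on with
  | empty => simp [specNorm_zero]
  | insert a s ha ih =>
    rw [Finset.sum_insert ha, Finset.sum_insert ha]
    exact (specNorm_add_le _ _).trans (add_le_add le_rfl ih)

namespace DSBM

variable {Ω : Type*} [MeasurableSpace Ω] {μ : Measure Ω} {n K T : ℕ} {d : ℝ}

lemma edgeProb_eq_blockMatrix (m : DSBM μ n K T d) (t : ℤ) :
    m.edgeProb t = blockMatrix (m.label t) (m.conn t) := by
  ext i j; exact m.edgeProb_apply t i j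

lemma card_class_le_nmax (m : DSBM μ n K T d) {t : ℤ} (h1 : 1 ≤ t) (hT : t ≤ T) (k : Fin K) :
    (Finset.univ.filter fun i => m.label t i = k).card ≤ m.nmax := by
  have ha := Finset.le_sup (f := fun k : Fin K =>
    (Finset.univ.filter fun i : Fin n => m.label t i = k).card) (Finset.mem_univ k)
  have hb := Finset.le_sup (f := fun t : ℤ => Finset.univ.sup fun k : Fin K =>
    (Finset.univ.filter fun i : Fin n => m.label t i = k).card) (Finset.mem_Icc.2 ⟨h1, hT⟩)
  exact ha.trans hb

lemma card_switch_nat_le (m : DSBM μ n K T d) {s : ℕ} (hs : m.SlowSwitching s) (t : ℤ)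
    (h1 : 1 ≤ t) (k : ℕ) (hT : t + k ≤ T) :
    (Finset.univ.filter fun i => m.label t i ≠ m.label (t + k) i).card ≤ k * s := by
  induction k with
  | zero => simp
  | succ k ih =>
    have h2 := ih (by push_cast at hT; omega)
    have h3 := hs (t + k) (by omega) (by push_cast at hT; omega)
    calc _ ≤ ((Finset.univ.filter fun i => m.label t i ≠ m.label (t + k) i) ∪
          (Finset.univ.filter fun i => m.label (t + k) i ≠ m.label (t + k + 1) i)).card := by
          apply Finset.card_le_card
          intro i hi
          simp only [Finset.mem_filter, Finset.mem_union, Finset.mem_univ, true_and] at hi ⊢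
          by_contra hcon
          push Not at hcon
          apply hi
          rw [hcon.1, hcon.2]
          push_cast; rw [add_assoc]
      _ ≤ k * s + s := (Finset.card_union_le _ _).trans (add_le_add h2 h3)
      _ = _ := by ring

/-- Chains the consecutive switches; for negative `i` the count runs forward from `t + i`. -/
lemma card_switch_le (m : DSBM μ n K T d) {s r : ℕ} (hs : m.SlowSwitching s) {t i : ℤ}
    (ht : 1 ≤ t ∧ t ≤ T) (hti : 1 ≤ t + i ∧ t + i ≤ T) (hi : |i| ≤ r) :
    (Finset.univ.filter fun v => m.label t v ≠ m.label (t + i) v).card ≤ r * s := by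
  have habs := abs_le.1 hi
  rcases le_total 0 i with h | h
  · obtain ⟨k, rfl⟩ := Int.eq_ofNat_of_zero_le h
    exact (m.card_switch_nat_le hs t ht.1 k hti.2).trans
      (Nat.mul_le_mul_right s (by have := habs.2; omega))
  · obtain ⟨k, hk⟩ := Int.eq_ofNat_of_zero_le (neg_nonneg.2 h)
    have h1 := m.card_switch_nat_le hs (t + i) hti.1 k (by omega)
    have e : t + i + (k : ℤ) = t := by omega
    rw [e] at h1
    simp_rw [ne_comm] at h1
    refine le_trans ?_ (h1.trans (Nat.mul_le_mul_right s (by omega)))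
    apply Finset.card_le_card
    intro v hv
    simpa [eq_comm] using hv

lemma specNorm_conn_le (m : DSBM μ n K T d) {α Cl : ℝ} (hα : 0 < α) (hCl : 1 ≤ Cl)
    (he : m.EigenvalueBounds α Cl) {t : ℤ} (h1 : 1 ≤ t) (hT : t ≤ T) :
    specNorm (m.conn t) ≤ α * Cl := by
  have e : m.conn t = α • m.scaledConn α t := by
    rw [scaledConn, smul_smul, mul_inv_cancel₀ hα.ne', one_smul]
  rw [e, specNorm_smul, abs_of_pos hα]
  gcongr
  refine specNorm_le_of_eigenvalues ?_ (by linarith) fun ev hev => ?_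
  · rw [scaledConn, Matrix.IsSymm, Matrix.transpose_smul, m.conn_symm t h1 hT]
  · obtain ⟨h2, h3⟩ := he t h1 hT ev hev
    have : 0 < Cl⁻¹ := by positivity
    rw [abs_of_pos (by linarith)]; exact h3

/-- The bias of the smoothed connection matrices, with the labels frozen. -/
lemma abs_smooth_conn_sub_le (m : DSBM μ n K T d) {α β L Wmax : ℝ} (hα : 0 < α) (hβ : 0 < β)
    (hL : 0 ≤ L) (hWm : 0 ≤ Wmax) (hsm : m.SmoothConn α β L) {F : Finset ℤ} (hne : F.Nonempty)
    {w : ℤ → ℝ} {r : ℕ} {t : ℤ} (ht : 1 ≤ t ∧ t ≤ T) (hF : ∀ i ∈ F, 1 ≤ t + i ∧ t + i ≤ T)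
    (hr : ∀ i ∈ F, |i| ≤ r) (hw : ∀ i ∈ F, |w i| ≤ Wmax)
    (hmom : ∀ k ≤ holderOrder β, (F.card : ℝ)⁻¹ * ∑ i ∈ F, (i : ℝ) ^ k * w i
      = if k = 0 then 1 else 0) (k k' : Fin K) :
    |(F.card : ℝ)⁻¹ * ∑ i ∈ F, w i * m.conn (t + i) k k' - m.conn t k k'|
      ≤ α * (Wmax * (L * ((r : ℝ) / T) ^ β)) := by
  -- Smoothness is assumed only for `k ≤ k'`; symmetry gives the other entries.
  wlog hkk : k ≤ k' generalizing k k'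
  · have h := this k' k (le_of_not_ge hkk)
    rw [(m.conn_symm t ht.1 ht.2).apply] at h
    rwa [Finset.sum_congr rfl fun i hi => by
      rw [← (m.conn_symm (t + i) (hF i hi).1 (hF i hi).2).apply]]
  obtain ⟨f, hf, hfe⟩ := hsm k k' hkk
  have hconn : ∀ u : ℤ, 1 ≤ u → u ≤ T → m.conn u k k' = α * f ((u : ℝ) / T) := by
    intro u h1 h2
    rw [← hfe u h1 h2, scaledConn, Matrix.smul_apply, smul_eq_mul, mul_inv_cancel_left₀ hα.ne']
  have h := abs_smooth_sub_le hβ hL hWm hf hne ht hF hr hw hmom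
  calc _ = α * |(F.card : ℝ)⁻¹ * ∑ i ∈ F, w i * f (((t + i : ℤ) : ℝ) / T) - f ((t : ℝ) / T)| := by
        have habs : ∀ z : ℝ, α * |z| = |α * z| := fun z => by rw [abs_mul, abs_of_pos hα]
        rw [habs]
        congr 1
        rw [hconn t ht.1 ht.2, Finset.sum_congr rfl fun i hi => by
          rw [hconn (t + i) (hF i hi).1 (hF i hi).2]]
        simp_rw [mul_left_comm _ α, ← Finset.mul_sum]
        ring
    _ ≤ _ := by gcongr

/-- The smoothed matrix is compared with the one built from the labels at time `t`: `R` is the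
smoothing error with frozen labels, `S` collects the label changes. The factor `l!` compensates the
Taylor remainder being bounded with `L` while `biasBound` has `L / l!`. -/
theorem bias_le (m : DSBM μ n K T d) {α β L Wmax Cl : ℝ} (hα : 0 < α) (hβ : 0 < β)
    (hL : 0 ≤ L) (hCl : 1 ≤ Cl) (hsm : m.SmoothConn α β L) {s : ℕ} (hs : m.SlowSwitching s)
    (he : m.EigenvalueBounds α Cl) {W : ℕ → Fin 3 → ℤ → ℝ}
    (hker : IsDiscreteKernel (holderOrder β) Wmax W) {r : ℕ} (hr : 2 * r ≤ T) {t : ℤ}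
    (ht : 1 ≤ t ∧ t ≤ T) :
    m.bias W r t ≤ (holderOrder β).factorial * biasBound Wmax β L Cl n T m.nmax s α r := by
  obtain ⟨j, hF, hsmooth⟩ := exists_window hr ht.1 ht.2
  set F := window r j with hFdef
  have hcard : 0 < F.card := (Nat.succ_pos r).trans_le (card_window_bounds r j).1
  have hne : F.Nonempty := Finset.card_pos.1 hcard
  have hN0 : (0 : ℝ) < F.card := by exact_mod_cast hcard
  have hw := (hker r j).1
  have hmom := (hker r j).2
  have hWm : 0 ≤ Wmax := by
    obtain ⟨i, hi⟩ := hne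
    exact (abs_nonneg _).trans (hw i hi)
  have habs : ∀ i ∈ F, |i| ≤ (r : ℤ) := fun i hi => abs_le_of_mem_window hi
  set S := ∑ i ∈ F, W r j i • (m.edgeProb (t + i) - blockMatrix (m.label t) (m.conn (t + i)))
  set R : Matrix (Fin n) (Fin n) ℝ := Matrix.of fun a b =>
    (F.card : ℝ)⁻¹ * ∑ i ∈ F, W r j i * m.conn (t + i) (m.label t a) (m.label t b)
      - m.conn t (m.label t a) (m.label t b)
  have hdec : kernelSmooth T W r m.edgeProb t - m.edgeProb t = (F.card : ℝ)⁻¹ • S + R := by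
    rw [hsmooth]
    ext a b
    simp only [S, R, Matrix.sub_apply, Matrix.add_apply, Matrix.smul_apply, Matrix.sum_apply,
      smul_eq_mul, Matrix.of_apply, blockMatrix, mul_sub, Finset.sum_sub_distrib,
      m.edgeProb_apply t]
    ring
  have hR : specNorm R ≤ n * (α * (Wmax * (L * ((r : ℝ) / T) ^ β))) :=
    specNorm_le_of_abs_apply_le (by positivity) fun a b =>
      m.abs_smooth_conn_sub_le hα hβ hL hWm hsm hne ht hF habs hw hmom _ _
  have hS : specNorm ((F.card : ℝ)⁻¹ • S)
      ≤ Wmax * (2 * √2 * (α * Cl) * √(m.nmax * (r * s : ℕ))) := by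
    rw [specNorm_smul, abs_of_pos (inv_pos.2 hN0), inv_mul_le_iff₀ hN0]
    calc specNorm S ≤ ∑ i ∈ F, Wmax * (2 * √2 * (α * Cl) * √(m.nmax * (r * s : ℕ))) := by
          refine (specNorm_sum_le _ _).trans (Finset.sum_le_sum fun i hi => ?_)
          rw [specNorm_smul, edgeProb_eq_blockMatrix]
          refine mul_le_mul (hw i hi) ?_ (specNorm_nonneg _) hWm
          refine (specNorm_blockMatrix_sub_le (m.card_class_le_nmax ht.1 ht.2)
            (m.card_class_le_nmax (hF i hi).1 (hF i hi).2)
            (m.card_switch_le hs ht (hF i hi) (habs i hi)) _).trans ?_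
          gcongr
          exact m.specNorm_conn_le hα hCl he (hF i hi).1 (hF i hi).2
      _ = _ := by rw [Finset.sum_const, nsmul_eq_mul]
  have hfac : (1 : ℝ) ≤ (holderOrder β).factorial := by
    exact_mod_cast Nat.factorial_pos _
  have hfac0 : (0 : ℝ) < (holderOrder β).factorial := by linarith
  rw [bias, hdec]
  refine (specNorm_add_le _ _).trans ?_
  rw [biasBound, mul_add, add_comm]
  refine add_le_add (hR.trans (le_of_eq ?_)) (hS.trans ?_)
  · field_simp
  · refine le_trans (le_of_eq ?_) (le_mul_of_one_le_left (by positivity) hfac)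
    push_cast
    rw [← mul_assoc (m.nmax : ℝ)]
    ring

end DSBM

/-! ### The balancing widths and the choice of `r*` -/

/-- The width at which smoothness bias and noise are balanced. -/
noncomputable def smoothWidth (E T β : ℝ) : ℝ := (E⁻¹ * T ^ (2 * β)) ^ (1 / (2 * β + 1))

section SmoothWidth

variable {E T β : ℝ}

lemma smoothWidth_pos (hE : 0 < E) (hT : 0 < T) : 0 < smoothWidth E T β := by
  unfold smoothWidth; positivity

lemma smoothWidth_rpow (hE : 0 < E) (hT : 0 < T) (hβ : 0 < β) :
    smoothWidth E T β ^ (2 * β + 1) = E⁻¹ * T ^ (2 * β) := by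
  rw [smoothWidth, ← Real.rpow_mul (by positivity), one_div_mul_cancel (by positivity),
    Real.rpow_one]

/-- Squared, this is `E X ^ (2β + 1) = T ^ (2β)`, the equation defining the width `X`. -/
lemma mul_smoothWidth_div_rpow (hE : 0 < E) (hT : 0 < T) (hβ : 0 < β) :
    E * (smoothWidth E T β / T) ^ β = √(E / smoothWidth E T β) := by
  have hX := smoothWidth_pos (β := β) hE hT
  have h := smoothWidth_rpow hE hT hβ
  set X := smoothWidth E T β
  rw [eq_comm, Real.sqrt_eq_iff_mul_self_eq (by positivity) (by positivity)]
  rw [Real.rpow_add hX, Real.rpow_one] at h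
  have h2 : ∀ z : ℝ, 0 < z → z ^ (2 * β) = z ^ β * z ^ β := by
    intro z hz
    rw [two_mul, Real.rpow_add hz]
  rw [h2 X hX, h2 T hT] at h
  rw [Real.div_rpow hX.le hT.le]
  have hTβ : 0 < T ^ β := by positivity
  rw [eq_comm, eq_div_iff hX.ne']
  calc E * (X ^ β / T ^ β) * (E * (X ^ β / T ^ β)) * X
      = E ^ 2 / (T ^ β * T ^ β) * (X ^ β * X ^ β * X) := by field_simp
    _ = E := by rw [h]; field_simp

/-- The first summand of `δ₂` is the noise level at the smoothness balance; checked by raising both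
sides to the power `2β + 1`. -/
lemma delta2_smooth_term_eq (hE : 0 < E) (hT : 0 < T) (hβ : 0 < β) :
    (E ^ (β + 1) / T ^ β) ^ (1 / (2 * β + 1)) = √(E / smoothWidth E T β) := by
  have hX := smoothWidth_pos (β := β) hE hT
  rw [← mul_smoothWidth_div_rpow hE hT hβ]
  refine Real.rpow_left_injOn (x := 2 * β + 1) (by positivity) (by simp; positivity)
    (by simp; positivity) ?_
  simp only
  rw [← Real.rpow_mul (by positivity), one_div_mul_cancel (by positivity), Real.rpow_one,
    Real.mul_rpow hE.le (by positivity), ← Real.rpow_mul (by positivity), mul_comm β,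
    Real.rpow_mul (by positivity), Real.div_rpow hX.le hT.le, smoothWidth_rpow hE hT hβ,
    Real.rpow_add hT, Real.rpow_one]
  have e : E⁻¹ * T ^ (2 * β) / (T ^ (2 * β) * T) = (E * T)⁻¹ := by field_simp
  rw [e, Real.inv_rpow (by positivity), Real.mul_rpow hE.le hT.le,
    show 2 * β + 1 = (β + 1) + β by ring, Real.rpow_add hE (β + 1) β]
  generalize E ^ (β + 1) = z
  field_simp

/-- Makes the width admissible: a lower bound on `E` caps `smoothWidth` at a multiple of `T`. -/
lemma smoothWidth_le {c : ℝ} (hc : 0 < c) (hcE : c ≤ E) (hT : 1 ≤ T) (hβ : 0 < β) :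
    c ^ (1 / (2 * β + 1)) * smoothWidth E T β ≤ T := by
  have hE : 0 < E := by linarith
  have hT0 : 0 < T := by linarith
  rw [smoothWidth, ← Real.mul_rpow hc.le (by positivity)]
  calc (c * (E⁻¹ * T ^ (2 * β))) ^ (1 / (2 * β + 1)) ≤ (T ^ (2 * β + 1)) ^ (1 / (2 * β + 1)) := by
        gcongr
        calc c * (E⁻¹ * T ^ (2 * β)) = c / E * T ^ (2 * β) := by ring
          _ ≤ 1 * T ^ (2 * β) := by gcongr; exact (div_le_one hE).2 hcE
          _ ≤ T ^ (2 * β + 1) := by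
              rw [one_mul]; exact Real.rpow_le_rpow_of_exponent_le hT (by linarith)
    _ = T := by
        rw [← Real.rpow_mul hT0.le, mul_one_div_cancel (by positivity), Real.rpow_one]

end SmoothWidth

/-- The width at which switching bias and noise are balanced. -/
noncomputable def switchWidth (n q : ℝ) : ℝ := √(q⁻¹ * n)

lemma mul_sqrt_switchWidth_eq {α n q : ℝ} (hα : 0 < α) (hn : 0 < n) (hq : 0 < q) :
    α * √(q * switchWidth n (α * q)) = √(n * α / switchWidth n (α * q)) := by
  have hZ : 0 < switchWidth n (α * q) := by unfold switchWidth; positivity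
  have hZ2 : switchWidth n (α * q) ^ 2 = (α * q)⁻¹ * n := Real.sq_sqrt (by positivity)
  set Z := switchWidth n (α * q)
  rw [eq_comm, Real.sqrt_eq_iff_mul_self_eq (by positivity) (by positivity)]
  rw [mul_mul_mul_comm, Real.mul_self_sqrt (by positivity), eq_comm, eq_div_iff hZ.ne']
  calc α * α * (q * Z) * Z = α * α * q * Z ^ 2 := by ring
    _ = n * α := by rw [hZ2]; field_simp

/-- The second summand of `δ₂` is the noise level at the switching balance. -/
lemma delta2_switch_term_eq {α n q : ℝ} (hα : 0 < α) (hn : 0 < n) (hq : 0 < q) :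
    (α ^ 3 * n * q) ^ ((1 : ℝ) / 4) = √(n * α / switchWidth n (α * q)) := by
  have hZ : 0 < switchWidth n (α * q) := by unfold switchWidth; positivity
  have hZ2 : switchWidth n (α * q) ^ 2 = (α * q)⁻¹ * n := Real.sq_sqrt (by positivity)
  set Z := switchWidth n (α * q)
  have h : n * α / Z = √(α ^ 3 * n * q) := by
    rw [eq_comm, Real.sqrt_eq_iff_mul_self_eq (by positivity) (by positivity)]
    rw [div_mul_div_comm, ← sq Z, hZ2]
    field_simp
  rw [h, Real.sqrt_eq_rpow, Real.sqrt_eq_rpow, ← Real.rpow_mul (by positivity)]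
  norm_num

/-- The last clause records which balancing width realizes the minimum, up to the integer part. The
switching one is excluded when `s = 0`, where it stands for infinity. -/
lemma optWidth_spec {CT α β : ℝ} {n T nm s : ℕ} (hCT : 0 < CT) (hα : 0 < α) (hn : 0 < n)
    (hT : 0 < T) :
    (optWidth CT 1 n T nm s α β : ℝ) ≤ CT * smoothWidth (n * α) T β ∧
    (s ≠ 0 → (optWidth CT 1 n T nm s α β : ℝ) ≤ switchWidth n (α * nm * s)) ∧
    (CT * smoothWidth (n * α) T β < optWidth CT 1 n T nm s α β + 1 ∨
      s ≠ 0 ∧ switchWidth n (α * nm * s) < optWidth CT 1 n T nm s α β + 1) := by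
  have hn0 : (0 : ℝ) < n := by positivity
  have hT0 : (0 : ℝ) < T := by positivity
  have hX : 0 < smoothWidth (n * α) T β := smoothWidth_pos (by positivity) hT0
  have hZ : 0 ≤ switchWidth n (α * nm * s) := Real.sqrt_nonneg _
  have f1 := Nat.floor_le (a := CT * smoothWidth (n * α) T β) (by positivity)
  have f2 := Nat.floor_le hZ
  have g1 := Nat.lt_floor_add_one (CT * smoothWidth (n * α) T β)
  have g2 := Nat.lt_floor_add_one (switchWidth n (α * nm * s))
  have e1 : CT * (((n : ℝ) * α)⁻¹ * (T : ℝ) ^ (2 * β)) ^ (1 / (2 * β + 1))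
      = CT * smoothWidth (n * α) T β := rfl
  have e2 : (1 : ℝ) * √((α * nm * s)⁻¹ * n) = switchWidth n (α * nm * s) := one_mul _
  rw [optWidth, e1, e2]
  split_ifs with hs
  · exact ⟨f1, fun h => absurd hs h, Or.inl g1⟩
  · refine ⟨le_trans (by exact_mod_cast min_le_left _ _) f1,
      fun _ => le_trans (by exact_mod_cast min_le_right _ _) f2, ?_⟩
    rcases min_choice ⌊CT * smoothWidth (n * α) T β⌋₊ ⌊switchWidth n (α * nm * s)⌋₊ with h | h
    · rw [h]; exact Or.inl g1
    · rw [h]; exact Or.inr ⟨hs, g2⟩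

/-- The integer part and the maximum with `1` cost only a factor two, since `r + 1 ≤ 2 max r 1`. -/
lemma sqrt_div_max_le {E A x : ℝ} {r : ℕ} (hE : 0 ≤ E) (hA : 0 < A) (hx : 0 < x)
    (h : A * x < r + 1) : √(E / (max r 1 : ℕ)) ≤ √(2 / A) * √(E / x) := by
  have hm : (0 : ℝ) < (max r 1 : ℕ) := by positivity
  have h1 : (r : ℝ) ≤ (max r 1 : ℕ) := by exact_mod_cast le_max_left r 1
  have h2 : (1 : ℝ) ≤ (max r 1 : ℕ) := by exact_mod_cast le_max_right r 1
  rw [← Real.sqrt_mul (by positivity)]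
  apply Real.sqrt_le_sqrt
  rw [div_mul_div_comm, div_le_div_iff₀ hm (by positivity)]
  calc E * (A * x) ≤ E * (2 * (max r 1 : ℕ)) := by exact mul_le_mul_of_nonneg_left (by linarith) hE
    _ = _ := by ring

/-- Consequences of the choice of the width, in terms of the standard deviation of the noise. -/
lemma optWidth_balance {CT α β : ℝ} {n T nm s : ℕ} (hCT : 0 < CT) (hCT1 : CT ≤ 1) (hα : 0 < α)
    (hβ : 0 < β) (hn : 0 < n) (hT : 0 < T) (hnm : 0 < nm) :
    (α * n * ((optWidth CT 1 n T nm s α β : ℝ) / T) ^ β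
      ≤ √(n * α / (max (optWidth CT 1 n T nm s α β) 1 : ℕ))) ∧
    (α * √(nm * (optWidth CT 1 n T nm s α β : ℝ) * s)
      ≤ √(n * α / (max (optWidth CT 1 n T nm s α β) 1 : ℕ))) ∧
    (√(n * α / (max (optWidth CT 1 n T nm s α β) 1 : ℕ)) ≤ √(2 / CT) * delta2 n T nm s α β) ∧
    (∀ r : ℕ, optWidth CT 1 n T nm s α β < r →
      √(n * α / (max (optWidth CT 1 n T nm s α β) 1 : ℕ))
        ≤ √(2 / CT) * (CT ^ (-β) * (α * n * ((r : ℝ) / T) ^ β) + α * √(nm * (r : ℝ) * s))) := by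
  have hn0 : (0 : ℝ) < n := by positivity
  have hT0 : (0 : ℝ) < T := by positivity
  have hnm0 : (0 : ℝ) < nm := by positivity
  have hE : 0 < n * α := by positivity
  obtain ⟨ha, hb, hc⟩ := optWidth_spec (β := β) (nm := nm) (s := s) hCT hα hn hT
  set ρ := optWidth CT 1 n T nm s α β
  have hX := smoothWidth_pos (β := β) hE hT0
  have hXeq := mul_smoothWidth_div_rpow hE hT0 hβ
  have hXδ := delta2_smooth_term_eq hE hT0 hβ
  set X := smoothWidth (n * α) T β
  have hq : s ≠ 0 → (0 : ℝ) < nm * s := fun h => by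
    have : 0 < s := Nat.pos_of_ne_zero h
    positivity
  have hassoc : α * nm * s = α * (nm * s) := mul_assoc _ _ _
  have hZ : s ≠ 0 → 0 < switchWidth n (α * nm * s) := fun h => by
    have := hq h
    rw [hassoc]; unfold switchWidth; positivity
  have hρX : (ρ : ℝ) ≤ X := ha.trans (mul_le_of_le_one_left hX.le hCT1)
  have hmaxpos : ∀ r : ℕ, r ≠ 0 → ((max r 1 : ℕ) : ℝ) = r := fun r hr => by
    rw [max_eq_left (Nat.pos_of_ne_zero hr)]
  have hδ1 : √(n * α / X) ≤ delta2 n T nm s α β := by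
    rw [delta2, ← hXδ, Real.mul_rpow hn0.le hα.le, mul_comm ((n : ℝ) ^ (β + 1))]
    exact le_add_of_nonneg_right (by positivity)
  have hδ2 : s ≠ 0 → √(n * α / switchWidth n (α * nm * s)) ≤ delta2 n T nm s α β := fun h => by
    rw [delta2, hassoc, ← delta2_switch_term_eq hα hn0 (hq h), mul_assoc _ (nm : ℝ)]
    exact le_add_of_nonneg_left (by positivity)
  have hdisj : √(n * α / (max ρ 1 : ℕ)) ≤ √(2 / CT) * √(n * α / X) ∧ CT * X < ρ + 1 ∨
      s ≠ 0 ∧ √(n * α / (max ρ 1 : ℕ)) ≤ √(2 / CT) * √(n * α / switchWidth n (α * nm * s)) ∧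
        switchWidth n (α * nm * s) < ρ + 1 := by
    rcases hc with h | ⟨hs, h⟩
    · exact Or.inl ⟨sqrt_div_max_le hE.le hCT hX h, h⟩
    · refine Or.inr ⟨hs, sqrt_div_max_le hE.le hCT (hZ hs) ?_, h⟩
      exact (mul_le_of_le_one_left (hZ hs).le hCT1).trans_lt h
  refine ⟨?_, ?_, ?_, ?_⟩
  -- At width zero the noise is taken at `1` instead, but the bias term vanishes.
  · rcases eq_or_ne ρ 0 with h0 | h0
    · rw [h0]; simp [Real.zero_rpow hβ.ne']; positivity
    · have hρ0 : (0 : ℝ) < ρ := by exact_mod_cast Nat.pos_of_ne_zero h0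
      rw [hmaxpos ρ h0, mul_comm α]
      calc n * α * ((ρ : ℝ) / T) ^ β ≤ n * α * (X / T) ^ β := by gcongr
        _ = √(n * α / X) := hXeq
        _ ≤ _ := by gcongr
  · rcases eq_or_ne s 0 with hs | hs
    · rw [hs]; simp; positivity
    rcases eq_or_ne ρ 0 with h0 | h0
    · rw [h0]; simp; positivity
    · have hρ0 : (0 : ℝ) < ρ := by exact_mod_cast Nat.pos_of_ne_zero h0
      have hZ' := hZ hs
      have hle := hb hs
      rw [hmaxpos ρ h0, show (nm : ℝ) * ρ * s = nm * s * ρ by ring]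
      calc α * √(nm * s * ρ) ≤ α * √(nm * s * switchWidth n (α * nm * s)) := by gcongr
        _ = √(n * α / switchWidth n (α * nm * s)) := by
            rw [hassoc, mul_sqrt_switchWidth_eq hα hn0 (hq hs)]
        _ ≤ _ := by gcongr
  · rcases hdisj with ⟨h, _⟩ | ⟨hs, h, _⟩
    · exact h.trans (by gcongr)
    · exact h.trans (by gcongr; exact hδ2 hs)
  · intro r hr
    have hr1 : (ρ : ℝ) + 1 ≤ r := by exact_mod_cast hr
    -- As `r ≥ ρ + 1`, the width `r` exceeds the balancing width that realized the minimum, so the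
    -- corresponding bias dominates its value there. The factor `CT ^ (-β)` undoes the scaling of
    -- the smoothness width by `CT`.
    rcases hdisj with ⟨h, hlt⟩ | ⟨hs, h, hlt⟩
    · refine h.trans ?_
      gcongr
      refine le_trans ?_ (le_add_of_nonneg_right (by positivity))
      rw [← hXeq, mul_comm α]
      calc n * α * (X / T) ^ β = CT ^ (-β) * (n * α * (CT * X / T) ^ β) := by
            rw [mul_div_assoc CT, Real.mul_rpow hCT.le (by positivity), Real.rpow_neg hCT.le]
            have : 0 < CT ^ β := by positivity
            field_simp
        _ ≤ _ := by gcongr; linarith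
    · refine h.trans ?_
      gcongr
      refine le_trans ?_ (le_add_of_nonneg_left (by positivity))
      rw [hassoc, ← mul_sqrt_switchWidth_eq hα hn0 (hq hs), show (nm : ℝ) * r * s = nm * s * r by ring,
        ← hassoc]
      gcongr
      linarith

/-! ### Diagonal error and assembly -/

/-- For `r = 0` the window is a single point, where the zeroth moment forces the value `1`. -/
lemma one_le_of_isDiscreteKernel {l : ℕ} {Wmax : ℝ} {W : ℕ → Fin 3 → ℤ → ℝ}
    (h : IsDiscreteKernel l Wmax W) : 1 ≤ Wmax := by
  have h1 := (h 0 0).2 0 (Nat.zero_le _)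
  have h2 := (h 0 0).1 0 (by simp [window])
  simp only [window] at h1
  simp at h1
  rw [h1] at h2
  simpa using h2

lemma biasBound_nonneg {Wmax β L Cl α : ℝ} {n T nm s r : ℕ} (hW : 0 ≤ Wmax) (hL : 0 ≤ L)
    (hCl : 0 ≤ Cl) (hα : 0 ≤ α) : 0 ≤ biasBound Wmax β L Cl n T nm s α r := by
  unfold biasBound; positivity

namespace DSBM

variable {Ω : Type*} [MeasurableSpace Ω] {μ : Measure Ω} {n K T : ℕ} {d : ℝ}

lemma nmax_pos (m : DSBM μ n K T d) (hn : 0 < n) (hT : 1 ≤ T) : 0 < m.nmax := by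
  have h := m.card_class_le_nmax (t := 1) le_rfl (by exact_mod_cast hT) (m.label 1 ⟨0, hn⟩)
  exact (Finset.card_pos.2 ⟨⟨0, hn⟩, by simp⟩).trans_le h

/-- The weights average to one, so smoothing reproduces the constant diagonal `d`; the entries of
`P_t` lie in `[0, 1]`. -/
lemma abs_estimator_sub_diag_le (m : DSBM μ n K T d) {l : ℕ} {Wmax : ℝ}
    {W : ℕ → Fin 3 → ℤ → ℝ} (hker : IsDiscreteKernel l Wmax W) {r : ℕ} (hr : 2 * r ≤ T) {t : ℤ}
    (ht : 1 ≤ t ∧ t ≤ T) (ω : Ω) (i : Fin n) :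
    |(m.estimator W r t ω - m.edgeProb t) i i| ≤ |d| + 1 := by
  obtain ⟨j, hF, hsmooth⟩ := exists_window hr ht.1 ht.2
  have h0 := (hker r j).2 0 (Nat.zero_le _)
  have h1 : m.estimator W r t ω i i = d := by
    rw [estimator, hsmooth, Matrix.smul_apply, Matrix.sum_apply, smul_eq_mul]
    have : ∀ u ∈ window r j, (W r j u • m.adj (t + u) ω) i i = W r j u * d := fun u hu => by
      rw [Matrix.smul_apply, smul_eq_mul, m.adj_diag _ (hF u hu).1 (hF u hu).2]
    rw [Finset.sum_congr rfl this, ← Finset.sum_mul, ← mul_assoc]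
    simp only [pow_zero, one_mul, if_true] at h0
    rw [h0, one_mul]
  rw [Matrix.sub_apply, h1]
  refine (abs_sub _ _).trans ?_
  rw [abs_of_nonneg (m.edgeProb_nonneg ht.1 ht.2 i i)]
  gcongr
  exact m.edgeProb_le_one ht.1 ht.2 i i

lemma offDiagError_le (m : DSBM μ n K T d) (W : ℕ → Fin 3 → ℤ → ℝ) (r : ℕ) (t : ℤ) (ω : Ω) :
    m.offDiagError W r t ω
      ≤ specNorm (offDiagPart (m.estimator W r t ω - kernelSmooth T W r m.edgeProb t))
        + 2 * m.bias W r t := by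
  have e : m.estimator W r t ω - m.edgeProb t
      = (m.estimator W r t ω - kernelSmooth T W r m.edgeProb t)
        + (kernelSmooth T W r m.edgeProb t - m.edgeProb t) := by abel
  rw [offDiagError, e, offDiagPart_add]
  exact (specNorm_add_le _ _).trans (add_le_add le_rfl (specNorm_offDiagPart_le _))

end DSBM

theorem lemma4 (τ c₀ Wmax β L Cα Cl : ℝ) (hτ : 0 < τ) (hc₀ : 0 < c₀) (hβ : 0 < β) (hL : 0 < L)
    (hCα : 1 ≤ Cα) (hCl : 1 ≤ Cl) :
    ∃ CT : ℝ, 0 < CT ∧ ∃ Cs : ℝ, 0 < Cs ∧ ∀ C₀ d : ℝ, 0 < C₀ → ∃ CΔ : ℝ, 0 < CΔ ∧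
      ∀ {Ω : Type*} [MeasurableSpace Ω] (μ : Measure Ω) [IsProbabilityMeasure μ]
        (n K T s : ℕ) (α : ℝ) (m : DSBM μ n K T d) (W : ℕ → Fin 3 → ℤ → ℝ) (t : ℤ),
        2 ≤ n → 1 ≤ T → 1 ≤ t → t ≤ T → 0 < α →
        Cα⁻¹ * c₀ * Real.log n / n ≤ α →
        m.SparsityLevel Cα α →
        m.SmoothConn α β L →
        m.SlowSwitching s →
        m.EigenvalueBounds α Cl →
        IsDiscreteKernel (holderOrder β) Wmax W →
        -- the width is admissible
        2 * optWidth CT Cs n T m.nmax s α β ≤ T ∧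
        -- it is optimal, up to a constant, for the bias-variance bound
        (∀ r : ℕ, 2 * r ≤ T →
          biasBound Wmax β L Cl n T m.nmax s α (optWidth CT Cs n T m.nmax s α β)
              + varBound C₀ n α (optWidth CT Cs n T m.nmax s α β)
            ≤ CΔ * (biasBound Wmax β L Cl n T m.nmax s α r + varBound C₀ n α r)) ∧
        -- error of the estimator with this width, and with the exact minimizing width
        ∀ r : ℕ, (r = optWidth CT Cs n T m.nmax s α β ∨ m.IsBalancedWidth W C₀ α t r) →
          1 - 4 * (n : ℝ) ^ (-τ) ≤
            μ.real {ω |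
              m.offDiagError W r t ω ≤ CΔ * min (delta1 n α) (delta2 n T m.nmax s α β) ∧
              m.totalError W r t ω
                ≤ CΔ * min (delta1 n α) (max (delta2 n T m.nmax s α β) 1)} := by
  have hCα0 : 0 < Cα := by linarith
  have hlog2 : 0 < Real.log 2 := Real.log_pos one_lt_two
  set c₁ := Cα⁻¹ * c₀ * Real.log 2 with hc₁
  have hc₁0 : 0 < c₁ := by positivity
  -- `c₁` is a lower bound for `n α`; the second term yields `2 r* ≤ T` through `smoothWidth_le`,
  -- and the first keeps `r*` below the smoothness balance.
  set CT := min 1 (c₁ ^ (1 / (2 * β + 1)) / 2) with hCTdef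
  have hCT : 0 < CT := lt_min one_pos (by positivity)
  refine ⟨CT, hCT, 1, one_pos, fun C₀ d hC₀ => ?_⟩
  obtain ⟨C, hC, htail⟩ := exists_stochastic_error_tail τ c₀ Wmax Cα hτ hc₀ hCα
  -- No kernel exists otherwise, and the claim is vacuous.
  by_cases hWmax : 1 ≤ Wmax
  swap
  · exact ⟨1, one_pos, fun μ _ n K T s α m W t _ _ _ _ _ _ _ _ _ _ hker =>
      absurd (one_le_of_isDiscreteKernel hker) hWmax⟩
  set fac : ℝ := ((holderOrder β).factorial : ℝ) with hfac
  have hfac0 : 0 < fac := by rw [hfac]; positivity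
  set A₁ := L / fac * Wmax with hA₁
  set A₂ := 2 * √2 * Wmax * Cl with hA₂
  have hA₁0 : 0 < A₁ := by positivity
  have hA₂0 : 0 < A₂ := by positivity
  set C₂ := √(2 / CT) with hC₂
  have hC₂1 : 1 ≤ C₂ := by
    rw [hC₂, Real.one_le_sqrt, le_div_iff₀ hCT]
    have : CT ≤ 1 := min_le_left _ _
    linarith
  -- Bounds bias plus `C₀` times noise at `r*`, in units of the noise level `V` there; `fac` comes
  -- from `DSBM.bias_le`.
  set G := fac * (A₁ + A₂) + C₀ with hG
  have hG0 : 0 < G := by positivity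
  -- Stochastic error, plus the bias doubled by removing its diagonal; `C₂` converts `V` into `min
  -- δ₁ δ₂`.
  set C₄ := (C * (G / C₀) + 2 * G) * C₂ with hC₄
  have hC₄0 : 0 < C₄ := by positivity
  -- A lower bound for `min δ₁ (max δ₂ 1)`, which lets `C₅` absorb the constant diagonal error.
  set κ := min (√c₁) 1 with hκ
  have hκ0 : 0 < κ := lt_min (by positivity) one_pos
  set C₅ := (|d| + 1) / κ with hC₅
  have hC₅0 : 0 < C₅ := by positivity
  -- For optimality: `D₁` serves the widths up to `r*`, where the noise is at least `V`, and `D₂`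
  -- the larger ones, where the bias is.
  set D₁ := (A₁ + A₂ + C₀) / C₀ with hD₁
  set D₂ := (A₁ + A₂ + C₀) * (C₂ * (CT ^ (-β) / A₁ + 1 / A₂)) with hD₂
  have hD₁0 : 0 < D₁ := by positivity
  have hD₂0 : 0 < D₂ := by positivity
  refine ⟨C₄ + C₅ + D₁ + D₂, by positivity, ?_⟩
  intro Ω _ μ _ n K T s α m W t hn hT ht1 htT hα hαn hsp hsm hslow heig hker
  have hn0 : (0 : ℝ) < n := by positivity
  have hT1 : (1 : ℝ) ≤ T := by exact_mod_cast hT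
  have hE : c₁ ≤ n * α := by
    rw [div_le_iff₀ hn0] at hαn
    have : Real.log 2 ≤ Real.log n := Real.log_le_log two_pos (by exact_mod_cast hn)
    calc c₁ ≤ Cα⁻¹ * c₀ * Real.log n := by rw [hc₁]; gcongr
      _ ≤ n * α := by linarith
  have hE0 : 0 < n * α := by linarith
  have hnm := m.nmax_pos (by omega) hT
  obtain ⟨hspec, -, -⟩ := optWidth_spec (β := β) (nm := m.nmax) (s := s) hCT hα
    (by omega : 0 < n) (by omega : 0 < T)
  obtain ⟨hb₁, hb₂, hδ₂, hlarge⟩ := optWidth_balance (nm := m.nmax) (s := s) hCT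
    (min_le_left _ _) hα hβ (by omega : 0 < n) (by omega : 0 < T) hnm
  set ρ := optWidth CT 1 n T m.nmax s α β with hρ
  set V := √(n * α / (max ρ 1 : ℕ)) with hV
  have hV0 : 0 ≤ V := Real.sqrt_nonneg _
  have hbias : ∀ r : ℕ, biasBound Wmax β L Cl n T m.nmax s α r
      = A₁ * (α * n * ((r : ℝ) / T) ^ β) + A₂ * (α * √(m.nmax * r * s)) := by
    intro r; rw [biasBound, hA₁, hA₂]; ring
  have hbρ : biasBound Wmax β L Cl n T m.nmax s α ρ ≤ (A₁ + A₂) * V := by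
    rw [hbias, add_mul]
    gcongr
  have hadm : 2 * ρ ≤ T := by
    have h1 := smoothWidth_le hc₁0 hE hT1 hβ
    have hX := smoothWidth_pos (β := β) hE0 (by linarith : (0 : ℝ) < T)
    have h2 : CT * smoothWidth (n * α) T β ≤ c₁ ^ (1 / (2 * β + 1)) / 2 * smoothWidth (n * α) T β :=
      mul_le_mul_of_nonneg_right (min_le_right _ _) hX.le
    have h3 : 2 * (ρ : ℝ) ≤ T := by linarith
    exact_mod_cast h3
  have hU : biasBound Wmax β L Cl n T m.nmax s α ρ + varBound C₀ n α ρ ≤ (A₁ + A₂ + C₀) * V := by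
    rw [varBound, add_mul _ C₀]
    exact add_le_add hbρ le_rfl
  have hbnn : ∀ r : ℕ, 0 ≤ biasBound Wmax β L Cl n T m.nmax s α r := fun r =>
    biasBound_nonneg (by linarith) hL.le (by linarith) hα.le
  have hvnn : ∀ r : ℕ, 0 ≤ varBound C₀ n α r := fun r => by unfold varBound; positivity
  refine ⟨hadm, ?_, ?_⟩
  · intro r hr
    have hUr : 0 ≤ biasBound Wmax β L Cl n T m.nmax s α r + varBound C₀ n α r :=
      add_nonneg (hbnn r) (hvnn r)
    refine hU.trans ?_
    rcases le_or_gt r ρ with hle | hgt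
    · have h1 : C₀ * V ≤ varBound C₀ n α r := by
        rw [varBound, hV]
        have hmax : ((max r 1 : ℕ) : ℝ) ≤ (max ρ 1 : ℕ) := by
          exact_mod_cast max_le_max hle le_rfl
        have : (0 : ℝ) < (max r 1 : ℕ) := by positivity
        gcongr
      calc (A₁ + A₂ + C₀) * V = D₁ * (C₀ * V) := by rw [hD₁]; field_simp
        _ ≤ D₁ * (biasBound Wmax β L Cl n T m.nmax s α r + varBound C₀ n α r) := by
            gcongr; linarith [hbnn r]
        _ ≤ _ := by gcongr; linarith
    · have h1 := hlarge r hgt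
      set b₁ := α * n * ((r : ℝ) / T) ^ β with hb₁def
      set b₂ := α * √(m.nmax * (r : ℝ) * s) with hb₂def
      have hb₁0 : 0 ≤ b₁ := by positivity
      have hb₂0 : 0 ≤ b₂ := by positivity
      have h2 : CT ^ (-β) * b₁ + b₂
          ≤ (CT ^ (-β) / A₁ + 1 / A₂) * biasBound Wmax β L Cl n T m.nmax s α r := by
        rw [hbias, add_mul]
        have e1 : CT ^ (-β) * b₁ = CT ^ (-β) / A₁ * (A₁ * b₁) := by field_simp
        have e2 : b₂ = 1 / A₂ * (A₂ * b₂) := by field_simp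
        refine add_le_add ?_ ?_
        · rw [e1]
          gcongr
          exact le_add_of_nonneg_right (by positivity)
        · conv_lhs => rw [e2]
          gcongr
          exact le_add_of_nonneg_left (by positivity)
      calc (A₁ + A₂ + C₀) * V
          ≤ (A₁ + A₂ + C₀) * (C₂ * ((CT ^ (-β) / A₁ + 1 / A₂)
            * biasBound Wmax β L Cl n T m.nmax s α r)) := by
            gcongr
            exact h1.trans (by gcongr)
        _ = D₂ * biasBound Wmax β L Cl n T m.nmax s α r := by rw [hD₂]; ring
        _ ≤ D₂ * (biasBound Wmax β L Cl n T m.nmax s α r + varBound C₀ n α r) := by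
            gcongr; linarith [hvnn r]
        _ ≤ _ := by gcongr; linarith
  · intro r hr
    have hbiasρ : m.bias W ρ t ≤ fac * (A₁ + A₂) * V := by
      refine (m.bias_le hα hβ hL.le hCl hsm hslow heig hker hadm ⟨ht1, htT⟩).trans ?_
      rw [mul_assoc]
      gcongr
    -- A minimizer does at least as well as `r*` for the exact criterion, so both widths obey the
    -- same bound.
    have hbal : 2 * r ≤ T ∧ m.bias W r t + C₀ * √(n * α / (max r 1 : ℕ)) ≤ G * V := by
      have hρG : m.bias W ρ t + C₀ * V ≤ G * V := by rw [hG]; linarith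
      rcases hr with rfl | ⟨h1, h2⟩
      · exact ⟨hadm, hρG⟩
      · exact ⟨h1, (h2 ρ hadm).trans hρG⟩
    obtain ⟨hr2, hbal⟩ := hbal
    have hbias0 : 0 ≤ m.bias W r t := specNorm_nonneg _
    have hsq : √(n * α / (max r 1 : ℕ)) ≤ G / C₀ * V := by
      rw [div_mul_eq_mul_div, le_div_iff₀ hC₀]; linarith
    have hbr : m.bias W r t ≤ G * V := by
      have : 0 ≤ C₀ * √(n * α / (max r 1 : ℕ)) := by positivity
      linarith
    have hV1 : V ≤ delta1 n α := by
      rw [hV, delta1]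
      apply Real.sqrt_le_sqrt
      exact div_le_self hE0.le (by exact_mod_cast le_max_right ρ 1)
    have hδ₁0 : 0 ≤ delta1 n α := Real.sqrt_nonneg _
    have hVmin : V ≤ C₂ * min (delta1 n α) (delta2 n T m.nmax s α β) := by
      rw [mul_min_of_nonneg _ _ (by positivity)]
      exact le_min (hV1.trans (le_mul_of_one_le_left hδ₁0 hC₂1)) hδ₂
    have hmin0 : 0 ≤ min (delta1 n α) (delta2 n T m.nmax s α β) := by
      have := hV0.trans hVmin
      exact nonneg_of_mul_nonneg_right this (by linarith)
    have hκle : κ ≤ min (delta1 n α) (max (delta2 n T m.nmax s α β) 1) :=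
      min_le_min (Real.sqrt_le_sqrt hE) (le_max_right _ _)
    have hmm : min (delta1 n α) (delta2 n T m.nmax s α β)
        ≤ min (delta1 n α) (max (delta2 n T m.nmax s α β) 1) :=
      min_le_min le_rfl (le_max_left _ _)
    have hbad := htail μ n K T d α m (holderOrder β) W t r hn ht1 htT hα hαn hsp hker hr2
    set S := {ω | m.offDiagError W r t ω
          ≤ (C₄ + C₅ + D₁ + D₂) * min (delta1 n α) (delta2 n T m.nmax s α β) ∧
        m.totalError W r t ω ≤ (C₄ + C₅ + D₁ + D₂)
          * min (delta1 n α) (max (delta2 n T m.nmax s α β) 1)} with hS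
    have hsub : Sᶜ ⊆ {ω | C * √(n * α / (max r 1 : ℕ))
        < specNorm (offDiagPart (m.estimator W r t ω - kernelSmooth T W r m.edgeProb t))} := by
      intro ω hω
      by_contra hcon
      simp only [Set.mem_ofPred_eq, not_lt] at hcon
      apply hω
      have hoff : m.offDiagError W r t ω
          ≤ C₄ * min (delta1 n α) (delta2 n T m.nmax s α β) := by
        calc _ ≤ C * √(n * α / (max r 1 : ℕ)) + 2 * m.bias W r t :=
              (m.offDiagError_le W r t ω).trans (add_le_add hcon le_rfl)
          _ ≤ C * (G / C₀ * V) + 2 * (G * V) := by gcongr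
          _ = (C * (G / C₀) + 2 * G) * V := by ring
          _ ≤ (C * (G / C₀) + 2 * G) * (C₂ * min (delta1 n α) (delta2 n T m.nmax s α β)) := by
              gcongr
          _ = _ := by rw [hC₄]; ring
      have htot : m.totalError W r t ω ≤ m.offDiagError W r t ω + (|d| + 1) :=
        specNorm_le_offDiagPart_add _ (by positivity)
          fun i => m.abs_estimator_sub_diag_le hker hr2 ⟨ht1, htT⟩ ω i
      have hd : |d| + 1 ≤ C₅ * min (delta1 n α) (max (delta2 n T m.nmax s α β) 1) := by
        calc |d| + 1 = C₅ * κ := by rw [hC₅]; field_simp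
          _ ≤ _ := by gcongr
      refine ⟨hoff.trans ?_, htot.trans ?_⟩
      · gcongr; linarith
      · calc _ ≤ C₄ * min (delta1 n α) (max (delta2 n T m.nmax s α β) 1)
              + C₅ * min (delta1 n α) (max (delta2 n T m.nmax s α β) 1) :=
              add_le_add (hoff.trans (by gcongr)) hd
          _ = (C₄ + C₅) * min (delta1 n α) (max (delta2 n T m.nmax s α β) 1) := by ring
          _ ≤ _ := mul_le_mul_of_nonneg_right (by linarith) (hmin0.trans hmm)
    -- Subadditivity suffices, so measurability of `S` is not needed.
    have h1 : 1 ≤ μ.real S + μ.real Sᶜ := by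
      calc 1 = μ.real (S ∪ Sᶜ) := by rw [Set.union_compl_self]; simp
        _ ≤ _ := measureReal_union_le _ _
    have h2 : μ.real Sᶜ ≤ 4 * (n : ℝ) ^ (-τ) :=
      (measureReal_mono hsub (measure_ne_top _ _)).trans hbad
    linarith
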